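/- **Setting and notation.** Let $F$ be a field of characteristic $p>2$, $G$ a (possibly infinite) group and $\sigma:G\to\{\pm1\}$ a nontrivial homomorphism with kernel $N$. Let $*$ be the oriented classical involution $\left(\sum_g\alpha_g g\right)^*=\sum_g\alpha_g\sigma(g)g^{-1}$ of the group algebra $FG$, let $(FG)^+=\{\alpha\in FG:\alpha^*=\alpha\}$, and let $\mathcal U^+(FG)$ be the set of units of $FG$ lying in $(FG)^+$. For a nonempty subset $S$ of a ring $R$, with $[a,b]=ab-ba$, put $\gamma^1(S)=S$ and let $\gamma^{n+1}(S)$ be the additive subgroup generated by all $[a,b]$ with $a\in\gamma^n(S)$, $b\in S$. $S$ is Lie nilpotent if $\gamma^n(S)=0$ for some $n\ge1$, and $t(S)$ is the least such $n$. Put $S^{(1)}=S$ and, for $n\ge 1$, let $S^{(n+1)}$ be the two-sided ideal of $R$ generated by all $[a,b]$ with $a\in S^{(n)}$, $b\in S$. $S$ is strongly Lie nilpotent if $S^{(n)}=0$ for some $n\ge1$, and $t^L(S)$ is the least such $n$. For a nonempty subset $H$ of a group, with $(x,y)=x^{-1}y^{-1}xy$, put $\gamma_1(H)=H$ and let $\gamma_{n+1}(H)$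 be the subgroup generated by all $(x,y)$ with $x\in\gamma_n(H)$, $y\in H$. $H$ is nilpotent if $\gamma_{n+1}(H)=1$ for some $n\ge0$, and $\mathrm{cl}(H)$ is the least such $n$. For a finite $p$-group $P$, $t_{\rm nil}(P)$ is the least $n$ with $\Delta(P)^n=0$, where $\Delta(P)$ is the augmentation ideal of $FP$. $P$ is powerful if $P'\subseteq P^p$, where $P^p$ is the subgroup generated by the $p$-th powers. $\zeta$ denotes the center of a group. **Theorem.** Assume that $x,y\in G$ generate a quaternion group $Q_8=\langle x,y\rangle$ of order $8$, that $(FG)^+$ is Lie nilpotent, and that a Sylow $p$-subgroup $P$ of $G$ has order $p^m$ with $m\ge1$. Then: (i) $(FG)^+$ is strongly Lie nilpotent, $\mathcal U^+(FG)$ is nilpotent, $\Delta(P)$ is nilpotent, and $$1+m(p-1)\le t((FG)^+)\le t^L((FG)^+)\le t_{\rm nil}(P),\qquad \mathrm{cl}(\mathcal U^+(FG))\le t_{\rm nil}(P)-1.$$ (ii) If $t((FG)^+)=t_{\rm nil}(P)$, then $\mathrm{cl}(\mathcal U^+(FG))+1=t((FG)^+)$. (iii) If $P$ is powerful, then $t((FG)^+)=t_{\rm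 nil}(P)$. (iv) There are a subgroup $E\le G$ with $e^2=1$ for all $e\in E$ and an element $g\in G\setminus N$ commuting with $x$ and $y$ and with $g^2=x^2$, such that $N=Q_8\times E\times P$ and $G=\langle Q_8,g\rangle\times E\times P$ (internal direct products). If $P$ is abelian then, for every such choice of $E$ and $g$ and every $k\ge2$, $\gamma^k((FG)^+)$ is the $F$-linear span of the elements $$(h_1-h_1^{-1})\cdots(h_k-h_k^{-1})(1-a^2)a\quad\text{and}\quad g(h_1-h_1^{-1})\cdots(h_k-h_k^{-1})(1-a^2)a$$ with $h_1,\dots,h_k\in P$ and $a\in(Q_8\times E)\setminus\zeta(Q_8\times E)$. -/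

import Mathlib

noncomputable section

namespace SymmLie

/-! ### Lie series and group series of a subset -/

/-- `lieSeries S n` is `γⁿ(S)`: `γ¹(S) = S`, and `γⁿ⁺¹(S)` is the additive subgroup generated by
the Lie commutators `[a, b]`, `a ∈ γⁿ(S)`, `b ∈ S`. (The value at `0` is a dummy.) -/
def lieSeries {R : Type*} [Ring R] (S : Set R) : ℕ → Set R
  | 0 => S
  | 1 => S
  | n + 2 => (AddSubgroup.closure
      {c : R | ∃ a ∈ lieSeries S (n + 1), ∃ b ∈ S, c = a * b - b * a} : Set R)

/-- `upperLieSeries S n` is `S⁽ⁿ⁾`: `S⁽¹⁾ = S` (as for `γ¹(S)`), and `S⁽ⁿ⁺¹⁾` is the two-sided associative ideal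
generated by the Lie commutators `[a, b]`, `a ∈ S⁽ⁿ⁾`, `b ∈ S`. (The value at `0` is a dummy.) -/
def upperLieSeries {R : Type*} [Ring R] (S : Set R) : ℕ → Set R
  | 0 => S
  | 1 => S
  | n + 2 => (TwoSidedIdeal.span
      {c : R | ∃ a ∈ upperLieSeries S (n + 1), ∃ b ∈ S, c = a * b - b * a} : Set R)

/-- `S` is Lie nilpotent. -/
def IsLieNilpotent {R : Type*} [Ring R] (S : Set R) : Prop :=
  ∃ n, 1 ≤ n ∧ lieSeries S n = {0}

/-- `S` is strongly Lie nilpotent. -/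
def IsStronglyLieNilpotent {R : Type*} [Ring R] (S : Set R) : Prop :=
  ∃ n, 1 ≤ n ∧ upperLieSeries S n = {0}

/-- The Lie nilpotency index `t(S)` (meaningful when `S` is Lie nilpotent). -/
def lieIndex {R : Type*} [Ring R] (S : Set R) : ℕ :=
  sInf {n | 1 ≤ n ∧ lieSeries S n = {0}}

/-- The upper Lie nilpotency index `t^L(S)` (meaningful when `S` is strongly Lie nilpotent). -/
def upperLieIndex {R : Type*} [Ring R] (S : Set R) : ℕ :=
  sInf {n | 1 ≤ n ∧ upperLieSeries S n = {0}}

/-- The lower central series of a subset `H` of a group: `γ₁(H) = H`, and `γₙ₊₁(H)` is the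
subgroup generated by the commutators `(x, y) = x⁻¹y⁻¹xy`, `x ∈ γₙ(H)`, `y ∈ H`.
(The value at `0` is a dummy.) -/
def groupSeries {U : Type*} [Group U] (H : Set U) : ℕ → Set U
  | 0 => H
  | 1 => H
  | n + 2 => (Subgroup.closure
      {c : U | ∃ x ∈ groupSeries H (n + 1), ∃ y ∈ H, c = x⁻¹ * y⁻¹ * x * y} : Set U)

/-- The subset `H` is nilpotent. -/
def IsNilpotentSubset {U : Type*} [Group U] (H : Set U) : Prop :=
  ∃ n, groupSeries H (n + 1) = {1}

/-- The nilpotency class `cl(H) = min {n ∈ ℕ₀ : γₙ₊₁(H) = 1}` (meaningful when `H` is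
nilpotent). -/
def nilClass {U : Type*} [Group U] (H : Set U) : ℕ :=
  sInf {n | groupSeries H (n + 1) = {1}}

/-! ### The group algebra with an oriented classical involution -/

/-- The oriented classical involution `(∑ α_g g)^* = ∑ α_g σ(g) g⁻¹`. -/
def orientedStar {F G : Type*} [Field F] [Group G] (σ : G →* ℤˣ) (α : MonoidAlgebra F G) :
    MonoidAlgebra F G :=
  α.coeff.sum fun g r => MonoidAlgebra.single g⁻¹ (r * (((σ g : ℤˣ) : ℤ) : F))

/-- The set `(FG)⁺` of symmetric elements. -/
def symm (F : Type*) {G : Type*} [Field F] [Group G] (σ : G →* ℤˣ) : Set (MonoidAlgebra F G) :=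
  {α | orientedStar σ α = α}

/-- The set `𝒰⁺(FG)` of symmetric units. -/
def symmUnits (F : Type*) {G : Type*} [Field F] [Group G] (σ : G →* ℤˣ) :
    Set (MonoidAlgebra F G)ˣ :=
  {u | (u : MonoidAlgebra F G) ∈ symm F σ}

/-- The augmentation ideal `Δ(P)` of the group algebra `FP`. -/
def augIdeal (F P : Type*) [Field F] [Group P] : Ideal (MonoidAlgebra F P) :=
  RingHom.ker (MonoidAlgebra.lift F F P (1 : P →* F))

/-- The nilpotency index `t_nil(P)` of `Δ(P)` (meaningful when `Δ(P)` is nilpotent). -/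
def tNil (F P : Type*) [Field F] [Group P] : ℕ :=
  sInf {n | augIdeal F P ^ n = ⊥}

/-! ### Group theory -/

/-- A finite `p`-group `P` (`p` odd) is powerful if `P' ⊆ P^p`, where `P^p` is the subgroup
generated by all `p`-th powers. -/
def IsPowerful (p : ℕ) (P : Type*) [Group P] : Prop :=
  commutator P ≤ Subgroup.closure (Set.range fun h : P => h ^ p)

/-- `K` is the internal direct product `A × B × C` of its subgroups `A`, `B`, `C`. -/
def IsInternalProd {G : Type*} [Group G] (A B C K : Subgroup G) : Prop :=
  (∀ a ∈ A, ∀ b ∈ B, Commute a b) ∧ (∀ a ∈ A, ∀ c ∈ C, Commute a c) ∧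
  (∀ b ∈ B, ∀ c ∈ C, Commute b c) ∧
  Set.BijOn (fun t : G × G × G => t.1 * t.2.1 * t.2.2)
    ((A : Set G) ×ˢ (B : Set G) ×ˢ (C : Set G)) (K : Set G)

/-- With `Q₈ = ⟨x, y⟩` and `N = ker σ`: `N = Q₈ × E × P` and `G = ⟨Q₈, g⟩ × E × P`, where `E² = 1`,
`g ∈ G ∖ N`, `(g, x) = (g, y) = 1` and `g² = x²`. -/
structure IsQuaternionDecomposition {G : Type*} [Group G] (σ : G →* ℤˣ) (x y : G)
    (P E : Subgroup G) (g : G) : Prop where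
  sq_eq_one : ∀ e ∈ E, e ^ 2 = 1
  not_mem : g ∉ σ.ker
  comm_x : Commute g x
  comm_y : Commute g y
  sq_eq : g ^ 2 = x ^ 2
  prod_ker : IsInternalProd (Subgroup.closure {x, y}) E P σ.ker
  prod_top : IsInternalProd (Subgroup.closure {x, y, g}) E P ⊤

/-- The product `(h₁ - h₁⁻¹) ⋯ (h_k - h_k⁻¹)` in `FG`. -/
def diffProd (F : Type*) {G : Type*} [Field F] [Group G] {k : ℕ} (h : Fin k → G) :
    MonoidAlgebra F G :=
  (List.ofFn fun i => MonoidAlgebra.of F G (h i) - MonoidAlgebra.of F G (h i)⁻¹).prod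

/-- The elements `(h₁ - h₁⁻¹) ⋯ (h_k - h_k⁻¹)(1 - a²)a` with `h_i ∈ P` and
`a ∈ B ∖ ζ(B)`. -/
def halfGenSet (F : Type*) {G : Type*} [Field F] [Group G] (P B : Subgroup G) (k : ℕ) :
    Set (MonoidAlgebra F G) :=
  {α | ∃ h : Fin k → G, (∀ i, h i ∈ P) ∧
    ∃ a ∈ (B : Set G) \ ((Subgroup.center B).map B.subtype : Set G),
      α = diffProd F h * (1 - MonoidAlgebra.of F G (a ^ 2)) * MonoidAlgebra.of F G a}

/-- The set `ℳ_k`: the elements of `halfGenSet` with `B = Q₈ × E`, and their left multiples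
by `g`. -/
def genSet (F : Type*) {G : Type*} [Field F] [Group G] (P B : Subgroup G) (g : G) (k : ℕ) :
    Set (MonoidAlgebra F G) :=
  halfGenSet F P B k ∪ (fun α => MonoidAlgebra.of F G g * α) '' halfGenSet F P B k

end SymmLie

end

/-! In characteristic p one has ad(b)^(p^j) = ad(b^(p^j)). Lie nilpotency of FG⁺ therefore makes
p^j-th powers of symmetric elements commute with all symmetric elements (`exists_pow_commute`). The
p^j-th power of g + σ(g)g⁻¹ is g^q + σ(g)g^(-q) with q = p^j, and q ≡ 1 (mod 4) can be arranged, so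
that elements of order dividing 4 equal their q-th power. Comparing coefficients then gives the
structure of G: x and y lie in N, z = x² is central, x and y are central modulo ⟨z⟩, and if c
centralizes x and y then c^q is central with square 1 or z according to σ(c).

Put f = 1 - z. Then f² = 2f, and after multiplication by f the elements x, y, xy are quaternion
units. For m ∈ N centralizing x and y, f x (m - m⁻¹) is symmetric, and [f x u, f y v] = 2 f xy (uv +
vu): Lie commutators of symmetric elements turn into Jordan products of coefficients. With
`jordan_mul_mem` it follows that f kills a power of the ideal J generated by the Jordan products of
the m - m⁻¹ (`twist_mul_eq_zero`). Modulo J the elements h - 1, for h with h^q = 1 in the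
centralizer, square to zero and anticommute. Hence p-elements form a subgroup, which is P, and Δ(P)³
⊆ J; as f can be cancelled on FP, Δ(P) is nilpotent (`isQuaternionExtension`).

Upper bounds: up to a central summand every symmetric element lies in D = Δ(P)FG
(`isCentralModulo`), so each Lie or group commutator gains a power of D. To leading order group
commutators of units 1 + d are Lie commutators, which gives (ii).

Lower bounds: it suffices to find a nonzero v in FP with f x v ∈ γⁿ(FG⁺). Along a chain of subgroups
of index p, the product of the (c - c⁻¹)^(p-1) is a nonzero multiple of the sum over P and reaches n
= m(p-1). If P is powerful, commutators in Δ(P) lie in Δ(P)³, so Jordan products give all of Δ(P)ⁿ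
modulo Δ(P)ⁿ⁺¹, and n = t_nil(P) - 1 is reached.

For (iv), E is a complement of ⟨z⟩ in the central elements of N with square 1, and g is central with
σ(g) = -1, g² = z. If P is abelian, FG⁺ is, modulo the centre, spanned by f k (r - r⁻¹) c with k ∈
{x, y, xy}, r ∈ P and c ∈ ⟨g⟩E; the factors other than k are central, so commutators follow the
quaternion table. -/

noncomputable section
namespace SymmLie

open MonoidAlgebra

/-! ### Lie series of a subspace -/

section LieSub

variable {F R : Type*} [Field F] [Ring R] [Algebra F R]

/-- The Lie series of a linear subspace, as a sequence of linear subspaces. -/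
def lieSub (S : Submodule F R) : ℕ → Submodule F R
  | 0 => S
  | 1 => S
  | n + 2 => Submodule.span F {c : R | ∃ a ∈ lieSub S (n + 1), ∃ b ∈ S, c = a * b - b * a}

theorem commutator_mem_lieSub {S : Submodule F R} {n : ℕ} (hn : 1 ≤ n) {a b : R}
    (ha : a ∈ lieSub S n) (hb : b ∈ S) : a * b - b * a ∈ lieSub S (n + 1) := by
  obtain ⟨n, rfl⟩ := Nat.exists_eq_add_of_le' hn
  exact Submodule.subset_span ⟨a, ha, b, hb, rfl⟩

/-- A scalar can be absorbed into the left entry of a commutator, so the additive closure is already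
a subspace. -/
theorem coe_lieSub (S : Submodule F R) (n : ℕ) : lieSeries (S : Set R) n = lieSub S n := by
  induction n using Nat.strong_induction_on with
  | _ n ih =>
    match n with
    | 0 => rfl
    | 1 => rfl
    | n + 2 =>
      have h1 := ih (n + 1) (by omega)
      simp only [lieSeries, lieSub, h1, SetLike.mem_coe]
      apply Set.Subset.antisymm
      · exact (AddSubgroup.closure_le (K := (Submodule.span F _).toAddSubgroup)).2
          Submodule.subset_span
      · intro v hv
        refine Submodule.closure_induction (p := fun v _ => v ∈ AddSubgroup.closure
            {c : R | ∃ a ∈ lieSub S (n + 1), ∃ b ∈ S, c = a * b - b * a})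
          (zero_mem _) (fun _ _ _ _ hu hv => add_mem hu hv) ?_ hv
        rintro r _ ⟨a, ha, b, hb, rfl⟩
        refine AddSubgroup.subset_closure ⟨r • a, Submodule.smul_mem _ r ha, b, hb, ?_⟩
        simp [smul_sub]

theorem lieSub_eq_bot_of_le {S : Submodule F R} {n m : ℕ} (hn : 1 ≤ n) (hnm : n ≤ m)
    (h : lieSub S n = ⊥) : lieSub S m = ⊥ := by
  induction m, hnm using Nat.le_induction with
  | base => exact h
  | succ m hm ih =>
    obtain ⟨m, rfl⟩ := Nat.exists_eq_add_of_le' (hn.trans hm)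
    rw [lieSub, Submodule.span_eq_bot]
    rintro _ ⟨a, ha, b, -, rfl⟩
    rw [ih, Submodule.mem_bot] at ha
    simp [ha]

theorem isLieNilpotent_iff (S : Submodule F R) :
    IsLieNilpotent (S : Set R) ↔ ∃ n, 1 ≤ n ∧ lieSub S n = ⊥ := by
  simp only [IsLieNilpotent, coe_lieSub]
  refine exists_congr fun n => and_congr_right fun _ => ?_
  rw [← Submodule.bot_coe (R := F), SetLike.coe_set_eq]

theorem lt_lieIndex {S : Submodule F R} (hS : IsLieNilpotent (S : Set R)) {n : ℕ}
    {a : R} (ha : a ∈ lieSub S n) (h0 : a ≠ 0) : n < lieIndex (S : Set R) := by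
  by_contra! hlt
  have h1 : lieIndex (S : Set R) ∈ {n | 1 ≤ n ∧ lieSeries (S : Set R) n = {0}} := Nat.sInf_mem hS
  obtain ⟨h2, h3⟩ := h1
  rw [coe_lieSub, ← Submodule.bot_coe (R := F), SetLike.coe_set_eq] at h3
  have := lieSub_eq_bot_of_le h2 hlt h3
  rw [this, Submodule.mem_bot] at ha
  exact h0 ha

theorem iterate_commutator_mem_lieSub {S : Submodule F R} {a b : R} (ha : a ∈ S) (hb : b ∈ S)
    (n : ℕ) :
    ((LinearMap.mulRight F b - LinearMap.mulLeft F b) ^ n) a ∈ lieSub S (n + 1) := by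
  induction n with
  | zero => simpa [lieSub] using ha
  | succ n ih =>
    rw [pow_succ']
    simpa using commutator_mem_lieSub (by omega) ih hb

/-- Right and left multiplication by b commute, so in characteristic p the p^j-th power of their
difference is the difference of the multiplications by b^(p^j); for large j it vanishes on S by
nilpotency. -/
theorem exists_pow_commute {p : ℕ} [Fact p.Prime] [CharP F p] (hp : 2 < p) {S : Submodule F R}
    (hS : IsLieNilpotent (S : Set R)) :
    ∃ j : ℕ, p ^ j % 4 = 1 ∧ ∀ a ∈ S, ∀ b ∈ S, Commute a (b ^ p ^ j) := by
  obtain ⟨n, hn, h⟩ := (isLieNilpotent_iff S).1 hS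
  -- An even exponent makes p^(2n) ≡ 1 (mod 4), and p^(2n) exceeds the nilpotency index n.
  refine ⟨2 * n, ?_, fun a ha b hb => ?_⟩
  · have hodd : p % 4 = 1 ∨ p % 4 = 3 := by
      have := (Fact.out : p.Prime).eq_two_or_odd
      omega
    have h2 : p ^ 2 % 4 = 1 := by rcases hodd with h | h <;> simp [Nat.pow_mod, h]
    rw [pow_mul, Nat.pow_mod, h2]
    simp
  · rcases subsingleton_or_nontrivial R with hR | hR
    · exact Subsingleton.elim _ _
    have : Nontrivial (Module.End F R) := by
      refine ⟨⟨0, 1, fun h => ?_⟩⟩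
      have := congrArg (fun φ : Module.End F R => φ 1) h
      simp at this
    have : CharP (Module.End F R) p := charP_of_injective_algebraMap' F p
    have h1 := iterate_commutator_mem_lieSub ha hb (p ^ (2 * n))
    have hle : n ≤ p ^ (2 * n) + 1 := by
      have : 2 * n < p ^ (2 * n) := Nat.lt_pow_self (by omega)
      omega
    rw [lieSub_eq_bot_of_le hn hle h, Submodule.mem_bot,
      sub_pow_char_pow_of_commute _ _ (LinearMap.commute_mulLeft_right (R := F) b b).symm,
      LinearMap.pow_mulLeft, LinearMap.pow_mulRight] at h1
    simpa [sub_eq_zero, commute_iff_eq] using h1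

end LieSub

/-! ### Symmetric elements -/

section Symm

variable {F G : Type*} [Field F] [Group G]

/-- The orientation as a sign in `F`. -/
def sgn (F : Type*) {G : Type*} [Field F] [Group G] (σ : G →* ℤˣ) (g : G) : F :=
  ((σ g : ℤˣ) : ℤ)

theorem sgn_mul (σ : G →* ℤˣ) (g h : G) : sgn F σ (g * h) = sgn F σ g * sgn F σ h := by
  simp [sgn]

theorem sgn_eq (σ : G →* ℤˣ) (g : G) :
    (σ g = 1 ∧ sgn F σ g = 1) ∨ (σ g = -1 ∧ sgn F σ g = -1) := by
  rcases Int.units_eq_one_or (σ g) with h | h <;> simp [sgn, h]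

theorem sgn_mul_self (σ : G →* ℤˣ) (g : G) : sgn F σ g * sgn F σ g = 1 := by
  rcases sgn_eq (F := F) σ g with h | h <;> simp [h]

theorem sgn_inv (σ : G →* ℤˣ) (g : G) : sgn F σ g⁻¹ = sgn F σ g := by
  rcases sgn_eq (F := F) σ g with h | h <;> simp [sgn, h.1]

theorem sgn_of_eq_one {σ : G →* ℤˣ} {g : G} (h : σ g = 1) : sgn F σ g = 1 := by simp [sgn, h]

theorem sgn_of_eq_neg_one {σ : G →* ℤˣ} {g : G} (h : σ g = -1) : sgn F σ g = -1 := by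
  simp [sgn, h]

/-- The oriented involution as a linear map. -/
def starLin (F : Type*) {G : Type*} [Field F] [Group G] (σ : G →* ℤˣ) :
    MonoidAlgebra F G →ₗ[F] MonoidAlgebra F G where
  toFun := orientedStar σ
  map_add' a b := by
    simp only [orientedStar, coeff_add]
    rw [Finsupp.sum_add_index' (by simp) (by simp [add_mul])]
  map_smul' r a := by
    simp only [orientedStar, coeff_smul, RingHom.id_apply]
    rw [Finsupp.sum_smul_index' (by simp), Finsupp.smul_sum]
    simp [mul_assoc]

theorem starLin_of (σ : G →* ℤˣ) (g : G) :
    starLin F σ (of F G g) = sgn F σ g • of F G g⁻¹ := by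
  simp [starLin, orientedStar, sgn, of_apply]

/-- The symmetric elements form a subspace. -/
def symmSub (F : Type*) {G : Type*} [Field F] [Group G] (σ : G →* ℤˣ) :
    Submodule F (MonoidAlgebra F G) :=
  LinearMap.ker (starLin F σ - LinearMap.id)

theorem mem_symmSub {σ : G →* ℤˣ} {a : MonoidAlgebra F G} : a ∈ symmSub F σ ↔ starLin F σ a = a := by
  simp [symmSub, sub_eq_zero]

theorem coe_symmSub (σ : G →* ℤˣ) : (symmSub F σ : Set (MonoidAlgebra F G)) = symm F σ := by
  ext a
  simp only [SetLike.mem_coe, mem_symmSub]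
  rfl

/-- The symmetric element `g + σ(g) g⁻¹`. -/
def sy (F : Type*) {G : Type*} [Field F] [Group G] (σ : G →* ℤˣ) (g : G) : MonoidAlgebra F G :=
  of F G g + sgn F σ g • of F G g⁻¹

theorem sy_mem (σ : G →* ℤˣ) (g : G) : sy F σ g ∈ symmSub F σ := by
  rw [mem_symmSub, sy, map_add, map_smul, starLin_of, starLin_of, sgn_inv, smul_smul,
    sgn_mul_self, inv_inv, one_smul, add_comm]

theorem mem_span_of (a : MonoidAlgebra F G) :
    a ∈ Submodule.span F (Set.range (of F G)) := by
  induction a using MonoidAlgebra.induction_on with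
  | of g => exact Submodule.subset_span ⟨g, rfl⟩
  | add a b ha hb => exact add_mem ha hb
  | smul r a ha => exact Submodule.smul_mem _ r ha

/-- A symmetric a equals (a + a*)/2, and g + g* is `sy F σ g`. -/
theorem symmSub_eq_span (h2 : (2 : F) ≠ 0) (σ : G →* ℤˣ) :
    symmSub F σ = Submodule.span F (Set.range (sy F σ)) := by
  apply le_antisymm
  · have key : ∀ a : MonoidAlgebra F G,
        a + starLin F σ a ∈ Submodule.span F (Set.range (sy F σ)) := by
      intro a
      refine Submodule.span_induction (p := fun a _ => a + starLin F σ a ∈ _) ?_ ?_ ?_ ?_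
        (mem_span_of a)
      · rintro _ ⟨g, rfl⟩
        rw [starLin_of]
        exact Submodule.subset_span ⟨g, rfl⟩
      · simp
      · intro a b _ _ ha hb
        rw [map_add, add_add_add_comm]
        exact add_mem ha hb
      · intro r a _ ha
        rw [map_smul, ← smul_add]
        exact Submodule.smul_mem _ _ ha
    intro a ha
    have := key a
    rw [mem_symmSub.1 ha, ← two_smul F] at this
    simpa [smul_smul, h2] using Submodule.smul_mem _ (2⁻¹ : F) this
  · rw [Submodule.span_le]
    rintro _ ⟨g, rfl⟩
    exact sy_mem σ g

theorem sgn_pow_of_odd (σ : G →* ℤˣ) (g : G) {n : ℕ} (hn : Odd n) :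
    sgn F σ (g ^ n) = sgn F σ g := by
  rcases sgn_eq (F := F) σ g with h | h <;> simp [sgn, h.1, hn.neg_one_pow]

theorem sgn_pow_self_of_odd (σ : G →* ℤˣ) (g : G) {n : ℕ} (hn : Odd n) :
    sgn F σ g ^ n = sgn F σ g := by
  rcases sgn_eq (F := F) σ g with h | h <;> simp [h.2, hn.neg_one_pow]

theorem sy_pow {p : ℕ} [Fact p.Prime] [CharP F p] (hp : 2 < p) (σ : G →* ℤˣ) (g : G) (j : ℕ) :
    sy F σ g ^ p ^ j = sy F σ (g ^ p ^ j) := by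
  have hodd : Odd (p ^ j) := ((Fact.out : p.Prime).odd_of_ne_two (by omega)).pow
  have : CharP (MonoidAlgebra F G) p := charP_of_injective_algebraMap' F p
  have hc : Commute (of F G g) (sgn F σ g • of F G g⁻¹) := by
    apply Commute.smul_right
    rw [commute_iff_eq, ← map_mul, ← map_mul]
    simp
  rw [sy, add_pow_char_pow_of_commute _ _ hc, smul_pow, ← map_pow, ← map_pow, sy, sgn_pow_of_odd σ g hodd,
    sgn_pow_self_of_odd σ g hodd, inv_pow]

end Symm

/-! ### Quaternion relations -/

/-- `x` and `y` satisfy the defining relations of the quaternion group with `x² = y² = z`. -/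
structure IsQuaternionPair {G : Type*} [Group G] (x y z : G) : Prop where
  xx : x * x = z
  yy : y * y = z
  zz : z * z = 1
  z_ne : z ≠ 1
  yx : y * x = x * y * z

namespace IsQuaternionPair

variable {G : Type*} [Group G] {x y z : G} (h : IsQuaternionPair x y z)
include h

theorem zx : z * x = x * z := by rw [← h.xx, mul_assoc]

theorem zy : z * y = y * z := by rw [← h.yy, mul_assoc]

theorem z_inv : z⁻¹ = z := inv_eq_of_mul_eq_one_left h.zz

theorem x_inv : x⁻¹ = x * z :=
  inv_eq_of_mul_eq_one_right (by rw [← mul_assoc, h.xx, h.zz])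

theorem y_inv : y⁻¹ = y * z :=
  inv_eq_of_mul_eq_one_right (by rw [← mul_assoc, h.yy, h.zz])

theorem xy_ne : y * x ≠ x * y := by
  rw [h.yx]
  simpa using h.z_ne

theorem swap : IsQuaternionPair y x z :=
  ⟨h.yy, h.xx, h.zz, h.z_ne, by rw [h.yx, mul_assoc, h.zz, mul_one]⟩

theorem xy_mul_xy : x * y * (x * y) = z := by
  rw [mul_assoc, ← mul_assoc y, h.yx, mul_assoc x y z, h.zy.symm, mul_assoc x, mul_assoc z, h.yy,
    h.zz, mul_one, h.xx]

theorem right : IsQuaternionPair x (x * y) z :=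
  ⟨h.xx, h.xy_mul_xy, h.zz, h.z_ne, by rw [mul_assoc, h.yx]; simp only [mul_assoc]⟩

end IsQuaternionPair

/-- Any two noncommuting elements of the quaternion group satisfy the standard relations, so nothing
depends on which generators x, y are given. -/
theorem quaternionGroup_relations :
    ∀ a b : QuaternionGroup 2, a * b ≠ b * a →
      b * b = a * a ∧ a * a * (a * a) = 1 ∧ a * a ≠ 1 ∧ b * a = a * b * (a * a) := by
  decide

theorem isQuaternionPair_of_equiv {G : Type*} [Group G] {x y : G}
    (hQ : Nonempty (Subgroup.closure ({x, y} : Set G) ≃* QuaternionGroup 2)) :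
    IsQuaternionPair x y (x * x) := by
  obtain ⟨φ⟩ := hQ
  have hx : x ∈ Subgroup.closure ({x, y} : Set G) := Subgroup.subset_closure (by simp)
  have hy : y ∈ Subgroup.closure ({x, y} : Set G) := Subgroup.subset_closure (by simp)
  have hne : x * y ≠ y * x := by
    intro hxy
    have hcomm : ∀ a ∈ Subgroup.closure ({x, y} : Set G),
        ∀ b ∈ Subgroup.closure ({x, y} : Set G), a * b = b * a := by
      have := Subgroup.isMulCommutative_closure (k := ({x, y} : Set G)) (by
        rintro a (rfl | rfl) b (rfl | rfl) <;> simp [hxy])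
      intro a ha b hb
      exact congrArg Subtype.val (this.is_comm.comm ⟨a, ha⟩ ⟨b, hb⟩)
    have : ∀ a b : QuaternionGroup 2, a * b = b * a := fun a b => by
      have : φ.symm a * φ.symm b = φ.symm b * φ.symm a :=
        Subtype.ext (hcomm _ (φ.symm a).2 _ (φ.symm b).2)
      simpa using congrArg φ this
    exact absurd this (by decide)
  have hne' : φ ⟨x, hx⟩ * φ ⟨y, hy⟩ ≠ φ ⟨y, hy⟩ * φ ⟨x, hx⟩ := by
    rw [← map_mul, ← map_mul]
    intro h
    exact hne (congrArg Subtype.val (φ.injective h))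
  obtain ⟨h1, h2, h3, h4⟩ := quaternionGroup_relations _ _ hne'
  simp only [← map_mul, ← map_one φ, ne_eq, φ.injective.eq_iff, Subtype.ext_iff] at h1 h2 h3 h4
  exact ⟨rfl, h1, h2, h3, h4⟩

/-! ### Elements commuting with symmetric elements -/

section Commuting

variable {F G : Type*} [Field F] [Group G]

theorem coeff_of_apply [DecidableEq G] (g h : G) :
    (of F G g).coeff h = if g = h then 1 else 0 := by
  simp [of_apply, Finsupp.single_apply]

/-- The coefficient of `t * h` is compared on both sides of the commutation relation; outside the
three cases this forces 1 or 2 to vanish in F. -/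
theorem commute_trichotomy (h2 : (2 : F) ≠ 0) {s : F} (hs : s = 1 ∨ s = -1) {t h : G}
    (H : Commute (of F G t) (of F G h + s • of F G h⁻¹)) :
    t * h = h * t ∨ (s = -1 ∧ h * h = 1) ∨ (s = 1 ∧ t * h = h⁻¹ * t) := by
  classical
  by_contra! hcon
  obtain ⟨h1, h3, h4⟩ := hcon
  have hinv : h⁻¹ = h ↔ h * h = 1 := by
    rw [inv_eq_iff_mul_eq_one]
  rw [commute_iff_eq, mul_add, add_mul, mul_smul_comm, smul_mul_assoc] at H
  simp only [← map_mul] at H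
  have := congrArg (fun a => a.coeff (t * h)) H
  simp only [coeff_add, coeff_smul, Finsupp.add_apply, Finsupp.smul_apply, coeff_of_apply,
    if_true, mul_right_inj, hinv, smul_eq_mul, mul_ite, mul_one, mul_zero, Ne.symm h1,
    if_false, zero_add] at this
  rcases hs with rfl | rfl
  · rw [if_neg (Ne.symm (h4 rfl))] at this
    split_ifs at this
    · exact h2 (by linear_combination this)
    · simp at this
  · rw [if_neg (h3 rfl)] at this
    split_ifs at this
    · exact h2 (by linear_combination this)
    · simp at this

theorem one_sub_mul_cancel (h2 : (2 : F) ≠ 0) {z a b : G} (hz : z ≠ 1)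
    (h : (1 - of F G z) * of F G a = (1 - of F G z) * of F G b) : a = b := by
  classical
  by_contra hab
  simp only [sub_mul, one_mul, ← map_mul] at h
  have := congrArg (fun c => c.coeff a) h
  simp only [coeff_sub, Finsupp.sub_apply, coeff_of_apply, if_true, Ne.symm hab, if_false,
    mul_eq_right, hz, sub_zero, zero_sub] at this
  split_ifs at this
  · exact h2 (by linear_combination this)
  · simp at this

/-- The hypothesis is A² = zA² for A = w + s z w⁻¹ and v = w², with z central; the coefficient at 1
decides. -/
theorem sign_square_dichotomy (h2 : (2 : F) ≠ 0) {s : F} (hs : s = 1 ∨ s = -1) {z v : G}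
    (zz : z * z = 1) (hz : z ≠ 1)
    (H : of F G v + (2 * s) • of F G z + of F G v⁻¹ =
      of F G (z * v) + (2 * s) • of F G 1 + of F G (z * v⁻¹)) :
    (s = 1 ∧ v = 1) ∨ (s = -1 ∧ v = z) := by
  classical
  have h4 : (4 : F) ≠ 0 := by
    have : (4 : F) = 2 * 2 := by norm_num
    rw [this]
    exact mul_ne_zero h2 h2
  have hzi : z⁻¹ = z := inv_eq_of_mul_eq_one_left zz
  have e1 : z * v = 1 ↔ v = z := by
    rw [mul_eq_one_iff_inv_eq, hzi, eq_comm]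
  have e2 : z * v⁻¹ = 1 ↔ v = z := by
    rw [mul_inv_eq_one, eq_comm]
  have := congrArg (fun a => a.coeff 1) H
  simp only [coeff_add, coeff_smul, Finsupp.add_apply, Finsupp.smul_apply, coeff_of_apply,
    inv_eq_one, e1, e2, hz, if_false, if_true, smul_eq_mul, mul_zero, mul_one, add_zero] at this
  by_cases hv1 : v = 1
  · subst hv1
    simp only [if_true, if_neg hz.symm, zero_add, add_zero] at this
    rcases hs with rfl | rfl
    · simp
    · exact absurd (by linear_combination this) h4
  · by_cases hvz : v = z
    · subst hvz
      simp only [if_true, if_neg hz, add_zero] at this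
      rcases hs with rfl | rfl
      · exact absurd (by linear_combination -this) h4
      · simp
    · simp only [if_neg hv1, if_neg hvz, zero_add, add_zero] at this
      rcases hs with rfl | rfl
      · exact absurd (by linear_combination -this) h2
      · exact absurd (by linear_combination this) h2

end Commuting

/-! ### Group-theoretic consequences of the Engel-type identity -/

theorem sgn_eq_one_or_neg_one {F G : Type*} [Field F] [Group G] (σ : G →* ℤˣ) (h : G) :
    sgn F σ h = 1 ∨ sgn F σ h = -1 := by
  rcases sgn_eq (F := F) σ h with h | h <;> simp [h]

/-- The element `1 - z`. -/
def twist (F : Type*) {G : Type*} [Field F] [Group G] (z : G) : MonoidAlgebra F G :=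
  1 - of F G z

section Twist

variable {F G : Type*} [Field F] [Group G] {z : G}

theorem of_comm (hz : ∀ g, z * g = g * z) (a : MonoidAlgebra F G) : Commute (of F G z) a := by
  induction a using MonoidAlgebra.induction_on with
  | of g => exact (show Commute z g from hz g).map (of F G)
  | add a b ha hb => exact ha.add_right hb
  | smul r a ha => exact ha.smul_right r

theorem twist_comm (hz : ∀ g, z * g = g * z) (a : MonoidAlgebra F G) : Commute (twist F z) a :=
  (Commute.one_left a).sub_left (of_comm hz a)

theorem twist_mul_of (zz : z * z = 1) : twist F z * of F G z = - twist F z := by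
  rw [twist, sub_mul, one_mul, ← map_mul, zz, map_one, neg_sub]

theorem twist_mul_twist (zz : z * z = 1) : twist F z * twist F z = (2 : F) • twist F z := by
  conv_lhs => rw [twist, mul_sub, ← twist, twist_mul_of zz, mul_one]
  rw [two_smul, sub_neg_eq_add]

end Twist

/-- `q ≡ 1 (mod 4)` and `g ^ q + σ(g) g ^ (-q)` commutes with all symmetric elements. -/
structure IsEngelExponent (F : Type*) {G : Type*} [Field F] [Group G] (σ : G →* ℤˣ) (q : ℕ) :
    Prop where
  two_ne : (2 : F) ≠ 0
  mod_four : q % 4 = 1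
  comm : ∀ g h : G, Commute (sy F σ (g ^ q)) (sy F σ h)

namespace IsEngelExponent

variable {F G : Type*} [Field F] [Group G] {σ : G →* ℤˣ} {q : ℕ} (hq : IsEngelExponent F σ q)
include hq

theorem pow_eq {g : G} (hg : g * g * (g * g) = 1) : g ^ q = g := by
  have h4 : g ^ 4 = 1 := by rw [← hg]; simp only [pow_succ, pow_zero, one_mul, mul_assoc]
  rw [← Nat.div_add_mod q 4, hq.mod_four, pow_add, pow_mul, h4, one_pow, one_mul, pow_one]

theorem odd : Odd q := by
  have := hq.mod_four
  exact Nat.odd_iff.2 (by omega)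

theorem comm_of_pow {g : G} (hg : g * g * (g * g) = 1) (h : G) :
    Commute (sy F σ g) (sy F σ h) := by
  have := hq.comm g h
  rwa [hq.pow_eq hg] at this

theorem eq_one_of_sgn {h : G} (hs : sgn F σ h = 1) : σ h = 1 := by
  rcases sgn_eq (F := F) σ h with h | h
  · exact h.1
  · rw [h.2] at hs
    exact absurd (by linear_combination -hs) hq.two_ne

theorem eq_neg_one_of_sgn {h : G} (hs : sgn F σ h = -1) : σ h = -1 := by
  rcases sgn_eq (F := F) σ h with h | h
  · rw [h.2] at hs
    exact absurd (by linear_combination hs) hq.two_ne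
  · exact h.1

variable {x y z : G} (Q : IsQuaternionPair x y z)
include Q

/-- If σ(x) = σ(y) = -1, the two symmetric elements are x(1 - z) and y(1 - z). Their products in the
two orders are 2xy(1 - z) and its negative, so they do not commute. -/
theorem sgn_eq_one_or : σ x = 1 ∨ σ y = 1 := by
  classical
  have H := hq.comm_of_pow (g := x) (by rw [Q.xx, Q.zz]) y
  rw [commute_iff_eq, sy, sy, Q.x_inv, Q.y_inv] at H
  have e1 : x * (y * z) = x * y * z := by rw [mul_assoc]
  have e2 : x * z * y = x * y * z := by rw [mul_assoc, Q.zy, mul_assoc]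
  have e3 : x * z * (y * z) = x * y := by
    rw [mul_assoc, ← mul_assoc z, Q.zy, mul_assoc y, Q.zz, mul_one]
  have e4 : y * (x * z) = x * y := by
    rw [← mul_assoc, Q.yx, mul_assoc, Q.zz, mul_one]
  have e5 : y * z * x = x * y := by
    rw [mul_assoc, Q.zx, ← mul_assoc, Q.yx, mul_assoc, Q.zz, mul_one]
  have e6 : y * z * (x * z) = x * y * z := by
    rw [mul_assoc, ← mul_assoc z, Q.zx, mul_assoc x, Q.zz, mul_one, Q.yx]
  simp only [add_mul, mul_add, smul_mul_assoc, mul_smul_comm, ← map_mul, e1, e2, e3, e4, e5, e6,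
    Q.yx] at H
  have := congrArg (fun a => a.coeff (x * y)) H
  have h1 : ¬ (x * y * z = x * y) := by simpa using Q.z_ne
  simp only [coeff_add, coeff_smul, Finsupp.add_apply, Finsupp.smul_apply, coeff_of_apply,
    if_true, if_neg h1, smul_eq_mul, mul_zero, mul_one, add_zero, zero_add] at this
  rcases sgn_eq_one_or_neg_one (F := F) σ x with hx | hx
  · exact Or.inl (hq.eq_one_of_sgn hx)
  rcases sgn_eq_one_or_neg_one (F := F) σ y with hy | hy
  · exact Or.inr (hq.eq_one_of_sgn hy)
  rw [hx, hy] at this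
  have h4 : (2 : F) * 2 = 0 := by linear_combination this
  simp [hq.two_ne] at h4

/-- If σ(x) = -1, the previous dichotomy for the pairs (x, y) and (x, xy) gives σ(y) = σ(xy) = 1, a
contradiction. -/
theorem map_x : σ x = 1 := by
  rcases Int.units_eq_one_or (σ x) with h | h
  · exact h
  have h1 := (hq.sgn_eq_one_or Q).resolve_left (by rw [h]; decide)
  have h2 := (hq.sgn_eq_one_or Q.right).resolve_left (by rw [h]; decide)
  rw [map_mul, h, h1] at h2
  exact absurd h2 (by decide)

theorem map_y : σ y = 1 := hq.map_x Q.swap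

theorem map_z : σ z = 1 := by rw [← Q.xx, map_mul, hq.map_x Q, one_mul]

theorem z_trichotomy (h : G) :
    z * h = h * z ∨ (σ h = -1 ∧ h * h = 1) ∨ (σ h = 1 ∧ z * h = h⁻¹ * z) := by
  have H := hq.comm_of_pow (g := z) (by rw [Q.zz, mul_one]) h
  have e : sy F σ z = (2 : F) • of F G z := by
    rw [sy, Q.z_inv, sgn_of_eq_one (hq.map_z Q), one_smul, two_smul]
  rw [e, Commute.smul_left_iff₀ hq.two_ne] at H
  rcases commute_trichotomy hq.two_ne (sgn_eq_one_or_neg_one σ h) H with h1 | h1 | h1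
  · exact Or.inl h1
  · exact Or.inr (Or.inl ⟨hq.eq_neg_one_of_sgn h1.1, h1.2⟩)
  · exact Or.inr (Or.inr ⟨hq.eq_one_of_sgn h1.1, h1.2⟩)

theorem z_comm (h : G) : z * h = h * z := by
  by_contra hne
  have σz := hq.map_z Q
  have hmul : ∀ u, z * u = u * z → ¬ z * (h * u) = h * u * z := by
    intro u hu h1
    rw [mul_assoc, ← hu, ← mul_assoc, ← mul_assoc] at h1
    exact hne (mul_right_cancel h1)
  rcases hq.z_trichotomy Q h with h1 | ⟨h1, h3⟩ | ⟨h1, h3⟩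
  · exact hne h1
  -- For σ(h) = -1 both h and hz are involutions, which forces h and z to commute.
  · rcases hq.z_trichotomy Q (h * z) with h4 | ⟨-, h5⟩ | ⟨h4, -⟩
    · exact hmul z rfl h4
    · apply hne
      have e1 : h * z = (h * z)⁻¹ := eq_inv_of_mul_eq_one_left h5
      have e2 : h = h⁻¹ := eq_inv_of_mul_eq_one_left h3
      rw [mul_inv_rev, Q.z_inv, ← e2] at e1
      exact e1.symm
    · rw [map_mul, h1, σz] at h4
      exact absurd h4 (by decide)
  -- For σ(h) = 1, z inverts h and hu for every even u centralizing z, so conjugation by h inverts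
  -- u. Inverting x, y and xy at once is possible only if x and y commute.
  · have key : ∀ u, z * u = u * z → σ u = 1 → u * h⁻¹ * u = h⁻¹ := by
      intro u hu σu
      rcases hq.z_trichotomy Q (h * u) with h4 | ⟨h4, -⟩ | ⟨-, h4⟩
      · exact absurd h4 (hmul u hu)
      · rw [map_mul, h1, σu] at h4
        exact absurd h4 (by decide)
      · rw [← mul_assoc, h3, mul_assoc, hu, ← mul_assoc, mul_left_inj, mul_inv_rev] at h4
        rw [mul_assoc, h4, mul_inv_cancel_left]
    have kx := key x Q.zx (hq.map_x Q)
    have ky := key y Q.zy (hq.map_y Q)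
    have kxy := key (x * y) (by rw [← mul_assoc, Q.zx, mul_assoc, Q.zy, mul_assoc])
      (by rw [map_mul, hq.map_x Q, hq.map_y Q, one_mul])
    have e1 : y * h⁻¹ = h⁻¹ * y⁻¹ := eq_mul_inv_of_mul_eq ky
    have e2 : x * h⁻¹ = h⁻¹ * x⁻¹ := eq_mul_inv_of_mul_eq kx
    have e3 : h⁻¹ * (x⁻¹ * y⁻¹ * (x * y)) = h⁻¹ := by
      calc h⁻¹ * (x⁻¹ * y⁻¹ * (x * y)) = (h⁻¹ * x⁻¹) * y⁻¹ * (x * y) := by group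
        _ = x * (h⁻¹ * y⁻¹) * (x * y) := by rw [← e2]; group
        _ = x * y * h⁻¹ * (x * y) := by rw [← e1]; group
        _ = h⁻¹ := kxy
    rw [mul_eq_left] at e3
    apply Q.xy_ne
    rw [← mul_inv_rev, inv_mul_eq_one] at e3
    exact e3

end IsEngelExponent

/-! ### The action of G on x and y modulo z -/

theorem commute_of_trichotomy {G Γ : Type*} [Group G] [Group Γ] (π : G →* Γ) (σ : G →* ℤˣ)
    {u : G} (hu : π u * π u = 1) (hσ : σ u = 1)
    (H : ∀ k, π u * π k = π k * π u ∨ (σ k = -1 ∧ π k * π k = 1) ∨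
      (σ k = 1 ∧ π u * π k = (π k)⁻¹ * π u)) (h : G) :
    π u * π h = π h * π u := by
  have hu' : (π u)⁻¹ = π u := inv_eq_of_mul_eq_one_left hu
  have H' := H (h * u)
  rw [map_mul, map_mul, hσ, mul_one] at H'
  rcases H h with h1 | ⟨h1, h2⟩ | ⟨h1, h2⟩
  · exact h1
  · rcases H' with h3 | ⟨-, h3⟩ | ⟨h3, -⟩
    · rw [← mul_assoc] at h3
      exact mul_right_cancel h3
    · have e1 : π h * π u = (π h * π u)⁻¹ := eq_inv_of_mul_eq_one_left h3
      have e2 : π h = (π h)⁻¹ := eq_inv_of_mul_eq_one_left h2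
      rw [mul_inv_rev, hu', ← e2] at e1
      exact e1.symm
    · rw [h1] at h3
      exact absurd h3 (by decide)
  · rcases H' with h3 | ⟨h3, -⟩ | ⟨-, h3⟩
    · rw [← mul_assoc] at h3
      exact mul_right_cancel h3
    · rw [h1] at h3
      exact absurd h3 (by decide)
    · rw [← mul_assoc, mul_inv_rev, hu', mul_left_inj, h2] at h3
      exact (Commute.inv_left_iff.1 h3).symm

namespace IsEngelExponent

variable {F G : Type*} [Field F] [Group G] {σ : G →* ℤˣ} {q : ℕ} (hq : IsEngelExponent F σ q)
include hq

variable {x y z : G} (Q : IsQuaternionPair x y z)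
include Q

/-- In G/⟨z⟩ the image of x has square 1, so `sy F σ x` maps to twice a group element and the
trichotomy applies to it. -/
theorem x_comm (h : G) : h * x = x * h ∨ h * x = x * h * z := by
  have hcen : ∀ n ∈ Subgroup.zpowers z, ∀ g : G, g * n = n * g := by
    rintro _ ⟨i, rfl⟩ g
    exact ((show Commute z g from hq.z_comm Q g).zpow_left i).symm
  have hZ : (Subgroup.zpowers z).Normal :=
    ⟨fun n hn g => by rwa [hcen n hn, mul_inv_cancel_right]⟩
  let π := QuotientGroup.mk' (Subgroup.zpowers z)
  have πz : π z = 1 := (QuotientGroup.eq_one_iff z).2 (Subgroup.mem_zpowers z)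
  have hmap : ∀ g : G, mapDomainRingHom F π (of F G g) = of F _ (π g) := by
    intro g
    simp [of_apply]
  have hmap' : ∀ (s : F) (g : G), mapDomainRingHom F π (s • of F G g) = s • of F _ (π g) := by
    intro s g
    simp [of_apply]
  have hu : π x * π x = 1 := by rw [← map_mul, Q.xx, πz]
  have H := commute_of_trichotomy π σ hu (hq.map_x Q) (fun k => by
    have H := (hq.comm_of_pow (g := x) (by rw [Q.xx, Q.zz]) k).map (mapDomainRingHom F π)
    have e : mapDomainRingHom F π (sy F σ x) = (2 : F) • of F _ (π x) := by
      rw [sy, map_add, hmap, hmap', sgn_of_eq_one (hq.map_x Q), map_inv,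
        inv_eq_of_mul_eq_one_left hu, one_smul, two_smul]
    rw [e, Commute.smul_left_iff₀ hq.two_ne, sy, map_add, hmap, hmap', map_inv] at H
    rcases commute_trichotomy hq.two_ne (sgn_eq_one_or_neg_one σ k) H with h1 | h1 | h1
    · exact Or.inl h1
    · exact Or.inr (Or.inl ⟨hq.eq_neg_one_of_sgn h1.1, h1.2⟩)
    · exact Or.inr (Or.inr ⟨hq.eq_one_of_sgn h1.1, h1.2⟩)) h
  rw [← map_mul, ← map_mul] at H
  have H2 : (x * h)⁻¹ * (h * x) ∈ Subgroup.zpowers z := QuotientGroup.eq.1 H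
  obtain ⟨i, hi⟩ := H2
  replace hi : z ^ i = (x * h)⁻¹ * (h * x) := hi
  rw [eq_inv_mul_iff_mul_eq] at hi
  have hz2 : z ^ (2 : ℤ) = 1 := by rw [zpow_two, Q.zz]
  rcases Int.even_or_odd' i with ⟨j, rfl | rfl⟩
  · rw [zpow_mul, hz2, one_zpow, mul_one] at hi
    exact Or.inl hi.symm
  · rw [zpow_add, zpow_mul, hz2, one_zpow, one_mul, zpow_one] at hi
    exact Or.inr hi.symm

theorem y_comm (h : G) : h * y = y * h ∨ h * y = y * h * z := hq.x_comm Q.swap h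

theorem commute_inv_mul {k h u : G} (hk : k * u = u * k * z) (hh : h * u = u * h * z) :
    Commute (k⁻¹ * h) u := by
  have zc := hq.z_comm Q
  have e : k⁻¹ * u = u * k⁻¹ * z := by
    rw [inv_mul_eq_iff_eq_mul, ← mul_assoc, ← mul_assoc, hk, mul_assoc (u * k), zc k⁻¹,
      mul_assoc, mul_assoc, mul_assoc, Q.zz, mul_one, mul_inv_cancel, mul_one]
  rw [commute_iff_eq, mul_assoc, hh, ← mul_assoc, ← mul_assoc, e, mul_assoc _ z, zc h, mul_assoc,
    mul_assoc, mul_assoc, Q.zz, mul_one]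

/-- Every element of `G` is a product of an element of `{1, x, y, xy}` and an element centralizing
`x` and `y`. -/
theorem exists_mul_centralizing (h : G) : ∃ k ∈ ({1, x, y, x * y} : Set G), ∃ c : G,
    h = k * c ∧ Commute c x ∧ Commute c y := by
  have hxy : x * y = y * x * z := Q.swap.yx
  rcases hq.x_comm Q h with hx | hx <;> rcases hq.y_comm Q h with hy | hy
  · exact ⟨1, by simp, h, by simp, hx, hy⟩
  · exact ⟨x, by simp, x⁻¹ * h, by group, (Commute.refl x).inv_left.mul_left hx,
      hq.commute_inv_mul Q hxy hy⟩
  · exact ⟨y, by simp, y⁻¹ * h, by group, hq.commute_inv_mul Q Q.yx hx,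
      (Commute.refl y).inv_left.mul_left hy⟩
  · refine ⟨x * y, by simp, (x * y)⁻¹ * h, by group, hq.commute_inv_mul Q ?_ hx,
      hq.commute_inv_mul Q ?_ hy⟩
    · rw [mul_assoc, Q.yx]; simp only [mul_assoc]
    · rw [← mul_assoc y, mul_assoc (y * x), ← Q.zy, ← mul_assoc, ← hxy]

theorem sy_x_mul {c : G} (hx : Commute c x) :
    sy F σ (x * c) = of F G x * (of F G c + sgn F σ c • of F G (z * c⁻¹)) := by
  have e : (x * c)⁻¹ = x * (z * c⁻¹) := by
    rw [← mul_assoc, ← Q.x_inv, mul_inv_rev, hx.inv_inv.eq]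
  rw [sy, sgn_mul, sgn_of_eq_one (hq.map_x Q), one_mul, mul_add, mul_smul_comm, ← map_mul,
    ← map_mul, e]

/-- The square of the `q`-th power of an element centralizing `x` and `y`. -/
theorem pow_mul_pow {c : G} (hx : Commute c x) (hy : Commute c y) :
    (σ c = 1 ∧ c ^ q * c ^ q = 1) ∨ (σ c = -1 ∧ c ^ q * c ^ q = z) := by
  have zc := hq.z_comm Q
  have hwx : Commute (c ^ q) x := hx.pow_left q
  have hwy : Commute (c ^ q) y := hy.pow_left q
  -- With w = c^q and x^q = x, the elements attached to xw and yw have the form xA and yA, where A =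
  -- w + σ(c) z w⁻¹ commutes with x and y. Their commuting gives xyA² = yxA² = xyzA².
  have H := hq.comm (x * c) (y * c ^ q)
  rw [hx.symm.mul_pow, hq.pow_eq (g := x) (by rw [Q.xx, Q.zz]), hq.sy_x_mul Q hwx,
    hq.sy_x_mul Q.swap hwy] at H
  rw [sgn_pow_of_odd σ c hq.odd] at H
  generalize c ^ q = w at *
  have hs := sgn_eq_one_or_neg_one (F := F) σ c
  set A := of F G w + sgn F σ c • of F G (z * w⁻¹) with hA
  have comm_of : ∀ {a b : G}, Commute a b → Commute (of F G a) (of F G b) :=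
    fun h => h.map (of F G)
  have hAx : Commute A (of F G x) :=
    (comm_of hwx).add_left ((comm_of ((show Commute z x from zc x).mul_left
      hwx.inv_left)).smul_left _)
  have hAy : Commute A (of F G y) :=
    (comm_of hwy).add_left ((comm_of ((show Commute z y from zc y).mul_left
      hwy.inv_left)).smul_left _)
  have e1 : of F G (x * y) * (A * A) = of F G (x * y) * (of F G z * (A * A)) := by
    calc of F G (x * y) * (A * A) = of F G x * A * (of F G y * A) := by
          rw [map_mul, mul_assoc, mul_assoc, ← mul_assoc A, hAy.eq]; simp only [mul_assoc]
      _ = of F G y * A * (of F G x * A) := H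
      _ = of F G (y * x) * (A * A) := by
          rw [map_mul, mul_assoc, mul_assoc, ← mul_assoc A, hAx.eq]; simp only [mul_assoc]
      _ = _ := by rw [Q.yx, map_mul _ (x * y), mul_assoc]
  have e2 := ((Group.isUnit (x * y)).map (of F G)).mul_left_cancel e1
  have hss := sgn_mul_self (F := F) σ c
  have eA : A * A = of F G (w * w) + (2 * sgn F σ c) • of F G z + of F G (w * w)⁻¹ := by
    have g1 : w * (z * w⁻¹) = z := by rw [← mul_assoc, ← zc, mul_assoc, mul_inv_cancel, mul_one]
    have g2 : z * w⁻¹ * w = z := by simp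
    have g3 : z * w⁻¹ * (z * w⁻¹) = (w * w)⁻¹ := by
      rw [mul_assoc, ← mul_assoc w⁻¹, ← zc, mul_assoc z, ← mul_assoc, Q.zz, one_mul, mul_inv_rev]
    simp only [hA, add_mul, mul_add, smul_mul_assoc, mul_smul_comm, ← map_mul, g1, g2, g3,
      smul_add, smul_smul, hss, one_smul, two_mul, add_smul]
    abel
  rw [eA] at e2
  simp only [mul_add, mul_smul_comm, ← map_mul, Q.zz] at e2
  rcases sign_square_dichotomy hq.two_ne hs Q.zz Q.z_ne e2 with h | h
  · exact Or.inl ⟨hq.eq_one_of_sgn h.1, h.2⟩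
  · exact Or.inr ⟨hq.eq_neg_one_of_sgn h.1, h.2⟩

/-- Multiplication by f = 1 - z turns symmetric elements into group elements: f·sy(w) = 2fw and
f(x·sy(d) + sy(xd)) = 2fxd. Both left sides commute, and cancelling f shows that w = c^q commutes
with each d centralizing x and y; such d together with x and y generate G. -/
theorem pow_central {c : G} (hx : Commute c x) (hy : Commute c y) (g : G) :
    Commute (c ^ q) g := by
  have zc := hq.z_comm Q
  have hwx : Commute (c ^ q) x := hx.pow_left q
  have hwy : Commute (c ^ q) y := hy.pow_left q
  have hw := hq.pow_mul_pow Q hx hy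
  rw [← show σ (c ^ q) = σ c by
    rcases Int.units_eq_one_or (σ c) with h | h <;> simp [h, hq.odd.neg_one_pow]] at hw
  generalize c ^ q = w at *
  have hw4 : w * w * (w * w) = 1 := by
    rcases hw with ⟨-, h⟩ | ⟨-, h⟩ <;> simp [h, Q.zz]
  set f := twist F z with hf
  have fc : ∀ a, Commute f a := twist_comm zc
  have fz : f * of F G z = - f := twist_mul_of Q.zz
  have ff : f * f = (2 : F) • f := twist_mul_twist Q.zz
  have fw : f * sy F σ w = (2 : F) • (f * of F G w) := by
    rcases hw with ⟨h1, h2⟩ | ⟨h1, h2⟩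
    · rw [sy, sgn_of_eq_one h1, inv_eq_of_mul_eq_one_left h2, one_smul, mul_add, two_smul]
    · have : w⁻¹ = z * w :=
        inv_eq_of_mul_eq_one_left (by rw [mul_assoc, h2, Q.zz])
      rw [sy, sgn_of_eq_neg_one h1, this, map_mul, neg_one_smul, ← sub_eq_add_neg, mul_sub,
        ← mul_assoc, fz, neg_mul, sub_neg_eq_add, two_smul]
  have key : ∀ d, Commute d x → Commute d y → w * d = d * w := by
    intro d hdx hdy
    have h1 : Commute (sy F σ w) (sy F σ d) := hq.comm_of_pow hw4 d
    have h2 : Commute (sy F σ w) (sy F σ (x * d)) := hq.comm_of_pow hw4 _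
    have h3 : Commute (sy F σ w) (of F G x) :=
      (hwx.map (of F G)).add_left ((hwx.inv_left.map (of F G)).smul_left _)
    have fB : f * (of F G x * sy F σ d + sy F σ (x * d)) = (2 : F) • (f * of F G (x * d)) := by
      have e1 : f * (sy F σ d + (of F G d + sgn F σ d • of F G (z * d⁻¹))) =
          (2 : F) • (f * of F G d) := by
        rw [sy, map_mul _ z, mul_add, mul_add, mul_add, mul_smul_comm, mul_smul_comm,
          ← mul_assoc f (of F G z), fz, neg_mul, smul_neg, two_smul]
        abel
      rw [hq.sy_x_mul Q hdx, ← mul_add, ← mul_assoc, (fc (of F G x)).eq, mul_assoc, e1,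
        mul_smul_comm, ← mul_assoc, ← (fc (of F G x)).eq, mul_assoc, map_mul]
    have h5 : Commute (f * sy F σ w) (f * (of F G x * sy F σ d + sy F σ (x * d))) :=
      Commute.mul_right (fc _).symm
        (Commute.mul_left (fc _) ((h3.mul_right h1).add_right h2))
    rw [fw, fB, Commute.smul_left_iff₀ hq.two_ne, Commute.smul_right_iff₀ hq.two_ne,
      commute_iff_eq] at h5
    have e : ∀ a b : G, f * of F G a * (f * of F G b) = (2 : F) • (f * of F G (a * b)) := by
      intro a b
      rw [mul_assoc, ← mul_assoc _ f, ← (fc (of F G a)).eq, mul_assoc, ← mul_assoc, ff, map_mul,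
        smul_mul_assoc]
    rw [e, e] at h5
    have h6 := one_sub_mul_cancel hq.two_ne Q.z_ne (smul_right_injective _ hq.two_ne h5)
    rw [← mul_assoc, hwx.eq, mul_assoc, mul_assoc] at h6
    exact mul_left_cancel h6
  obtain ⟨k, hk, d, rfl, hdx, hdy⟩ := hq.exists_mul_centralizing Q g
  refine Commute.mul_right ?_ (key d hdx hdy)
  rcases hk with rfl | rfl | rfl | rfl
  · exact Commute.one_right _
  · exact hwx
  · exact hwy
  · exact hwx.mul_right hwy

end IsEngelExponent

/-! ### Quaternionic components of Lie series -/

section QuatComp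

variable {F R : Type*} [Field F] [Ring R] [Algebra F R]

/-- The central element `f` satisfies `f² = 2 f`, and `i`, `j`, `k` satisfy the relations of the
quaternion units after multiplication by `f`. -/
structure IsTwistedQuaternion (f i j k : R) : Prop where
  central : ∀ a, f * a = a * f
  ff : f * f = f + f
  ii : f * (i * i) = -f
  jj : f * (j * j) = -f
  kk : f * (k * k) = -f
  ij : f * (i * j) = f * k
  jk : f * (j * k) = f * i
  ki : f * (k * i) = f * j
  ji : f * (j * i) = -(f * k)
  kj : f * (k * j) = -(f * i)
  ik : f * (i * k) = -(f * j)

namespace IsTwistedQuaternion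

variable {f i j k : R} (H : IsTwistedQuaternion f i j k)
include H

theorem rotate : IsTwistedQuaternion f j k i :=
  ⟨H.central, H.ff, H.jj, H.kk, H.ii, H.jk, H.ki, H.ij, H.kj, H.ik, H.ji⟩

theorem mul_mul {a b u v : R} (hu : Commute u b) :
    f * a * u * (f * b * v) = f * (a * b) * (u * v) + f * (a * b) * (u * v) := by
  calc f * a * u * (f * b * v) = f * a * (u * f) * b * v := by simp only [mul_assoc]
    _ = f * (a * f) * (u * b) * v := by rw [← H.central u]; simp only [mul_assoc]
    _ = (f * f) * a * (b * u) * v := by rw [← H.central a, hu.eq]; simp only [mul_assoc]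
    _ = _ := by rw [H.ff]; simp only [add_mul, mul_assoc]

end IsTwistedQuaternion

/-- The elements `u` centralizing `i`, `j`, `k` whose multiples `f i u`, `f j u`, `f k u` lie in
`X`. -/
def quatComp (f i j k : R) (X : Submodule F R) : Submodule F R where
  carrier := {u | (Commute u i ∧ Commute u j ∧ Commute u k) ∧
    f * i * u ∈ X ∧ f * j * u ∈ X ∧ f * k * u ∈ X}
  add_mem' := by
    rintro a b ⟨⟨h1, h2, h3⟩, h4, h5, h6⟩ ⟨⟨h1', h2', h3'⟩, h4', h5', h6'⟩
    refine ⟨⟨h1.add_left h1', h2.add_left h2', h3.add_left h3'⟩, ?_, ?_, ?_⟩ <;>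
      rw [mul_add] <;> apply add_mem <;> assumption
  zero_mem' := by simp
  smul_mem' := by
    rintro r a ⟨⟨h1, h2, h3⟩, h4, h5, h6⟩
    refine ⟨⟨h1.smul_left r, h2.smul_left r, h3.smul_left r⟩, ?_, ?_, ?_⟩ <;>
      rw [mul_smul_comm] <;> apply Submodule.smul_mem <;> assumption

theorem mem_of_add_self_mem (h2 : (2 : F) ≠ 0) {X : Submodule F R} {a : R} (h : a + a ∈ X) :
    a ∈ X := by
  rw [← two_smul F] at h
  simpa [smul_smul, h2] using X.smul_mem (2⁻¹ : F) h

namespace IsTwistedQuaternion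

variable {f i j k : R} (H : IsTwistedQuaternion f i j k) (h2 : (2 : F) ≠ 0)
  {S X Y : Submodule F R} (hXY : ∀ a ∈ X, ∀ s ∈ S, a * s - s * a ∈ Y)
include H h2 hXY

/-- Since ij = k = -ji under f, one has [f i u, f j v] = 2 f k (uv + vu). -/
theorem jordan_aux {u v : R} (hu : Commute u j) (hv : Commute v i) (hu' : f * i * u ∈ X)
    (hv' : f * j * v ∈ S) : f * k * (u * v + v * u) ∈ Y := by
  have := hXY _ hu' _ hv'
  rw [H.mul_mul hu, H.mul_mul hv, H.ij, H.ji] at this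
  apply mem_of_add_self_mem h2
  convert this using 1
  noncomm_ring

theorem jordan_mem {u v : R} (hu : u ∈ quatComp f i j k X) (hv : v ∈ quatComp f i j k S) :
    u * v + v * u ∈ quatComp f i j k Y := by
  obtain ⟨⟨h1, h3, h4⟩, h5, h6, h7⟩ := hu
  obtain ⟨⟨h1', h3', h4'⟩, h5', h6', h7'⟩ := hv
  have hc : ∀ {w : R}, Commute u w → Commute v w → Commute (u * v + v * u) w :=
    fun h h' => (h.mul_left h').add_left (h'.mul_left h)
  exact ⟨⟨hc h1 h1', hc h3 h3', hc h4 h4'⟩,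
    H.rotate.jordan_aux h2 hXY h4 h3' h6 h7', H.rotate.rotate.jordan_aux h2 hXY h1 h4' h7 h5',
    H.jordan_aux h2 hXY h3 h1' h5 h6'⟩

/-- With 1 in place of a second unit, [f i u, f d] = 2 f i [u, d]. -/
theorem lie_aux {u d : R} (hd : Commute d i) (hu' : f * i * u ∈ X)
    (hd' : f * d ∈ S) : f * i * (u * d - d * u) ∈ Y := by
  have := hXY _ hu' _ hd'
  have e1 : f * i * u * (f * d) = f * i * (u * d) + f * i * (u * d) := by
    simpa using H.mul_mul (a := i) (b := 1) (u := u) (v := d) (Commute.one_right u)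
  have e2 : f * d * (f * i * u) = f * i * (d * u) + f * i * (d * u) := by
    simpa using H.mul_mul (a := 1) (b := i) (u := d) (v := u) hd
  rw [e1, e2] at this
  apply mem_of_add_self_mem h2
  convert this using 1
  noncomm_ring

theorem lie_mem {u d : R} (hu : u ∈ quatComp f i j k X) (hi : Commute d i) (hj : Commute d j)
    (hk : Commute d k) (hd : f * d ∈ S) : u * d - d * u ∈ quatComp f i j k Y := by
  obtain ⟨⟨h1, h3, h4⟩, h5, h6, h7⟩ := hu
  have hc : ∀ {w : R}, Commute u w → Commute d w → Commute (u * d - d * u) w :=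
    fun h h' => (h.mul_left h').sub_left (h'.mul_left h)
  exact ⟨⟨hc h1 hi, hc h3 hj, hc h4 hk⟩, H.lie_aux h2 hXY hi h5 hd,
    H.rotate.lie_aux h2 hXY hj h6 hd, H.rotate.rotate.lie_aux h2 hXY hk h7 hd⟩

/-- Using the same unit twice, [f i u, f i v] = -2 f [u, v]. -/
theorem lie_one_mem {u v : R} (hu : u ∈ quatComp f i j k X) (hv : v ∈ quatComp f i j k S) :
    f * (u * v - v * u) ∈ Y := by
  have := hXY _ hu.2.1 _ hv.2.1
  rw [H.mul_mul hu.1.1, H.mul_mul hv.1.1, H.ii] at this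
  apply mem_of_add_self_mem h2
  rw [← neg_mem_iff]
  convert this using 1
  noncomm_ring

omit hXY in
theorem double_aux {W : Submodule F R} (hYW : ∀ a ∈ Y, ∀ s ∈ S, a * s - s * a ∈ W) {e v : R}
    (he : f * e ∈ Y) (hei : Commute e i) (hv : f * i * v ∈ S) :
    f * i * (e * v - v * e) ∈ W := by
  have := hYW _ he _ hv
  have e1 : f * i * v * (f * e) = f * i * (v * e) + f * i * (v * e) := by
    simpa using H.mul_mul (a := i) (b := 1) (u := v) (v := e) (Commute.one_right v)
  have e2 : f * e * (f * i * v) = f * i * (e * v) + f * i * (e * v) := by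
    simpa using H.mul_mul (a := 1) (b := i) (u := e) (v := v) hei
  rw [e1, e2] at this
  apply mem_of_add_self_mem h2
  convert this using 1
  noncomm_ring

/-- The element f [u, v] is reached after one step, and its bracket with f i w is 2 f i [[u, v], w].
-/
theorem double_mem {W : Submodule F R} (hYW : ∀ a ∈ Y, ∀ s ∈ S, a * s - s * a ∈ W) {u v w : R}
    (hu : u ∈ quatComp f i j k X) (hv : v ∈ quatComp f i j k S) (hw : w ∈ quatComp f i j k S) :
    (u * v - v * u) * w - w * (u * v - v * u) ∈ quatComp f i j k W := by
  have he := H.lie_one_mem h2 hXY hu hv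
  obtain ⟨⟨h1, h3, h4⟩, h5, h6, h7⟩ := hu
  obtain ⟨⟨h1', h3', h4'⟩, h5', h6', h7'⟩ := hv
  have hc : ∀ {r a b : R}, Commute a r → Commute b r → Commute (a * b - b * a) r :=
    fun h h' => (h.mul_left h').sub_left (h'.mul_left h)
  exact ⟨⟨hc (hc h1 h1') hw.1.1, hc (hc h3 h3') hw.1.2.1, hc (hc h4 h4') hw.1.2.2⟩,
    H.double_aux h2 hYW he (hc h1 h1') hw.2.1,
    H.rotate.double_aux h2 hYW he (hc h3 h3') hw.2.2.1,
    H.rotate.rotate.double_aux h2 hYW he (hc h4 h4') hw.2.2.2⟩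

end IsTwistedQuaternion

/-- The sum of the terms of the Lie series from the `n`-th on. -/
def upLie (S : Submodule F R) (n : ℕ) : Submodule F R := ⨆ m, lieSub S (n + m)

theorem commutator_mem_upLie {S : Submodule F R} {n : ℕ} (hn : 1 ≤ n) (a : R)
    (ha : a ∈ upLie S n) (s : R) (hs : s ∈ S) : a * s - s * a ∈ upLie S (n + 1) := by
  refine Submodule.iSup_induction _ (motive := fun a => a * s - s * a ∈ upLie S (n + 1)) ha ?_ ?_ ?_
  · intro m a ha
    refine Submodule.mem_iSup_of_mem m ?_
    have := commutator_mem_lieSub (by omega) ha hs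
    rwa [show n + m + 1 = n + 1 + m by omega] at this
  · simp
  · intro a b ha hb
    convert add_mem ha hb using 1
    noncomm_ring

/-- S need not be closed under brackets, so its Lie series need not decrease. The tail sums do,
which lets brackets of different lengths be combined. -/
theorem upLie_succ_le (S : Submodule F R) (n : ℕ) : upLie S (n + 1) ≤ upLie S n := by
  refine iSup_le fun m => ?_
  rw [show n + 1 + m = n + (m + 1) by omega]
  exact le_iSup (fun m => lieSub S (n + m)) (m + 1)

theorem upLie_eq_bot {S : Submodule F R} {n : ℕ} (hn : 1 ≤ n) (h : lieSub S n = ⊥) :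
    upLie S n = ⊥ := by
  rw [upLie, iSup_eq_bot]
  exact fun m => lieSub_eq_bot_of_le hn (by omega) h

theorem quatComp_mono {f i j k : R} {X Y : Submodule F R} (h : X ≤ Y) :
    quatComp f i j k X ≤ quatComp f i j k Y := by
  rintro u ⟨h1, h3, h4, h5⟩
  exact ⟨h1, h h3, h h4, h h5⟩

/-- The span of the Jordan products of elements of `A`. -/
def jordanSpan (A : Submodule F R) : Submodule F R :=
  Submodule.span F {c | ∃ a ∈ A, ∃ b ∈ A, c = a * b + b * a}

namespace IsTwistedQuaternion

variable {f i j k : R} (H : IsTwistedQuaternion f i j k) (h2 : (2 : F) ≠ 0)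
  {S : Submodule F R} (hS : ∀ a ∈ S, ∀ b ∈ S, a * b + b * a ∈ S)
include H h2 hS

/-- Writing a∘b = ab + ba, one has 4(v∘w)u = (u∘v)∘w + (u∘w)∘v + [[u,v],w] + [[u,w],v] - 2[u, v∘w].
Each term lies in a component at level n + 1 or n + 2; for the last one f(v∘w) ∈ S because S is
closed under Jordan products. -/
theorem jordan_mul_mem {n : ℕ} (hn : 1 ≤ n) {u v w : R} (hu : u ∈ quatComp f i j k (upLie S n))
    (hv : v ∈ quatComp f i j k S) (hw : w ∈ quatComp f i j k S) :
    (v * w + w * v) * u ∈ quatComp f i j k (upLie S (n + 1)) := by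
  have c1 := commutator_mem_upLie (S := S) hn
  have c2 := commutator_mem_upLie (S := S) (n := n + 1) (by omega)
  have hle : quatComp f i j k (upLie S (n + 2)) ≤ quatComp f i j k (upLie S (n + 1)) :=
    quatComp_mono (upLie_succ_le S (n + 1))
  have hd : f * (v * w + w * v) ∈ S := by
    have := hS _ hv.2.1 _ hw.2.1
    rw [H.mul_mul hv.1.1, H.mul_mul hw.1.1, H.ii] at this
    apply mem_of_add_self_mem h2
    rw [← neg_mem_iff]
    convert this using 1
    noncomm_ring
  have hc : ∀ {r : R}, Commute v r → Commute w r → Commute (v * w + w * v) r :=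
    fun h h' => (h.mul_left h').add_left (h'.mul_left h)
  have m0 := H.lie_mem h2 c1 hu (hc hv.1.1 hw.1.1) (hc hv.1.2.1 hw.1.2.1) (hc hv.1.2.2 hw.1.2.2) hd
  have m1 := hle (H.jordan_mem h2 c2 (H.jordan_mem h2 c1 hu hv) hw)
  have m2 := hle (H.jordan_mem h2 c2 (H.jordan_mem h2 c1 hu hw) hv)
  have m3 := hle (H.double_mem h2 c1 c2 hu hv hw)
  have m4 := hle (H.double_mem h2 c1 c2 hu hw hv)
  apply mem_of_add_self_mem h2
  apply mem_of_add_self_mem h2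
  convert sub_mem (add_mem (add_mem m1 m2) (add_mem m3 m4)) (add_mem m0 m0) using 1
  noncomm_ring

theorem jordanSpan_pow_mul_le {A : Submodule F R} (hA : A ≤ quatComp f i j k S) (n : ℕ) :
    jordanSpan A ^ n * A ≤ quatComp f i j k (upLie S (n + 1)) := by
  induction n with
  | zero =>
    rw [pow_zero, one_mul]
    refine hA.trans (quatComp_mono ?_)
    exact le_iSup (fun m => lieSub S (0 + 1 + m)) 0
  | succ n ih =>
    rw [pow_succ', mul_assoc, Submodule.mul_le]
    intro c hc u hu
    refine Submodule.span_induction (p := fun c _ => c * u ∈ quatComp f i j k (upLie S (n + 1 + 1)))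
      ?_ ?_ ?_ ?_ hc
    · rintro _ ⟨a, ha, b, hb, rfl⟩
      exact H.jordan_mul_mem h2 hS (by omega) (ih hu) (hA ha) (hA hb)
    · simp
    · intro a b _ _ ha hb
      rw [add_mul]
      exact add_mem ha hb
    · intro r a _ ha
      rw [smul_mul_assoc]
      exact Submodule.smul_mem _ _ ha

/-- Once the tail of the Lie series vanishes, f i b = 0 for b ∈ jordanSpan(A)ⁿA, and multiplying by
i recovers f b = 0. -/
theorem jordanSpan_pow_eq_zero {A : Submodule F R} (hA : A ≤ quatComp f i j k S) {n : ℕ}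
    (hn : lieSub S (n + 1) = ⊥) {a : R} (ha : a ∈ jordanSpan A ^ (n + 1)) : f * a = 0 := by
  have h0 : ∀ b ∈ jordanSpan A ^ n * A, f * b = 0 := by
    intro b hb
    have := (H.jordanSpan_pow_mul_le h2 hS hA n hb).2.1
    rw [upLie_eq_bot (by omega) hn, Submodule.mem_bot] at this
    have h3 := congrArg (i * ·) this
    simp only [mul_zero] at h3
    rw [mul_assoc, ← mul_assoc, ← H.central, mul_assoc, ← mul_assoc i, ← mul_assoc f, H.ii,
      neg_mul, neg_eq_zero] at h3
    exact h3
  -- Each summand of a Jordan product starts with an element of A.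
  have hle : jordanSpan A ^ (n + 1) ≤ jordanSpan A ^ n * A * ⊤ := by
    rw [pow_succ, mul_assoc]
    refine mul_le_mul' le_rfl ?_
    rw [jordanSpan, Submodule.span_le]
    rintro _ ⟨a, ha, b, hb, rfl⟩
    exact add_mem (Submodule.mul_mem_mul ha trivial) (Submodule.mul_mem_mul hb trivial)
  refine Submodule.mul_induction_on (hle ha) ?_ ?_
  · intro b hb c _
    rw [← mul_assoc, h0 b hb, zero_mul]
  · intro b c hb hc
    rw [mul_add, hb, hc, add_zero]

end IsTwistedQuaternion

end QuatComp

/-! ### The subgroup of `p`-elements -/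

section

variable {F G : Type*} [Field F] [Group G]

theorem of_mul_sy {σ : G →* ℤˣ} {z : G} (zc : ∀ h, z * h = h * z) (zz : z * z = 1) (σz : σ z = 1)
    (h : G) : of F G z * sy F σ h = sy F σ (z * h) := by
  have : (z * h)⁻¹ = z * h⁻¹ := by
    rw [zc, mul_inv_rev, inv_eq_of_mul_eq_one_left zz]
  rw [sy, sy, sgn_mul, sgn_of_eq_one σz, one_mul, this, mul_add, mul_smul_comm, ← map_mul,
    ← map_mul]

theorem mem_symmSub_of_sy (h2 : (2 : F) ≠ 0) {σ : G →* ℤˣ}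
    (φ : MonoidAlgebra F G →ₗ[F] MonoidAlgebra F G) {X : Submodule F (MonoidAlgebra F G)}
    (h : ∀ g, φ (sy F σ g) ∈ X) {a : MonoidAlgebra F G} (ha : a ∈ symmSub F σ) : φ a ∈ X := by
  rw [symmSub_eq_span h2] at ha
  have : Submodule.span F (Set.range (sy F σ)) ≤ X.comap φ := by
    rw [Submodule.span_le]
    rintro _ ⟨g, rfl⟩
    exact h g
  exact this ha

theorem twist_mul_mem (h2 : (2 : F) ≠ 0) {σ : G →* ℤˣ} {z : G} (zc : ∀ h, z * h = h * z)
    (zz : z * z = 1) (σz : σ z = 1) {a : MonoidAlgebra F G} (ha : a ∈ symmSub F σ) :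
    twist F z * a ∈ symmSub F σ := by
  refine mem_symmSub_of_sy h2 (LinearMap.mulLeft F (twist F z)) (fun g => ?_) ha
  rw [LinearMap.mulLeft_apply, twist, sub_mul, one_mul, of_mul_sy zc zz σz]
  exact sub_mem (sy_mem _ _) (sy_mem _ _)

theorem sy_jordan (σ : G →* ℤˣ) (g h : G) :
    sy F σ g * sy F σ h + sy F σ h * sy F σ g ∈ symmSub F σ := by
  have e : sy F σ g * sy F σ h + sy F σ h * sy F σ g = sy F σ (g * h) + sy F σ (h * g) +
      sgn F σ h • sy F σ (g * h⁻¹) + sgn F σ g • sy F σ (g⁻¹ * h) := by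
    simp only [sy, sgn_mul, sgn_inv, add_mul, mul_add, smul_mul_assoc, mul_smul_comm, ← map_mul,
      smul_add, smul_smul, mul_inv_rev, inv_inv]
    rw [show sgn F σ h * (sgn F σ g * sgn F σ h) = sgn F σ g by
        rw [mul_left_comm, sgn_mul_self, mul_one],
      show sgn F σ g * (sgn F σ g * sgn F σ h) = sgn F σ h by
        rw [← mul_assoc, sgn_mul_self, one_mul], mul_comm (sgn F σ h) (sgn F σ g)]
    abel
  rw [e]
  exact add_mem (add_mem (add_mem (sy_mem _ _) (sy_mem _ _)) (Submodule.smul_mem _ _ (sy_mem _ _)))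
    (Submodule.smul_mem _ _ (sy_mem _ _))

theorem symmSub_jordan (h2 : (2 : F) ≠ 0) {σ : G →* ℤˣ} (a : MonoidAlgebra F G)
    (ha : a ∈ symmSub F σ) (b : MonoidAlgebra F G) (hb : b ∈ symmSub F σ) :
    a * b + b * a ∈ symmSub F σ := by
  refine mem_symmSub_of_sy h2 (LinearMap.mulRight F b + LinearMap.mulLeft F b) (fun g => ?_) ha
  refine mem_symmSub_of_sy h2 (LinearMap.mulLeft F (sy F σ g) + LinearMap.mulRight F (sy F σ g))
    (fun h => ?_) hb
  exact sy_jordan σ g h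

/-- The skew element `g - g⁻¹`. -/
def dif (F : Type*) {G : Type*} [Field F] [Group G] (g : G) : MonoidAlgebra F G :=
  of F G g - of F G g⁻¹

/-- The elements of `ker σ` centralizing `x` and `y`. -/
def evenCentralizer (σ : G →* ℤˣ) (x y : G) : Subgroup G :=
  Subgroup.centralizer {x, y} ⊓ σ.ker

theorem mem_evenCentralizer {σ : G →* ℤˣ} {x y c : G} :
    c ∈ evenCentralizer σ x y ↔ Commute c x ∧ Commute c y ∧ σ c = 1 := by
  simp only [evenCentralizer, Subgroup.mem_inf, Subgroup.mem_centralizer_iff, MonoidHom.mem_ker,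
    Set.mem_insert_iff, Set.mem_singleton_iff, forall_eq_or_imp, forall_eq, and_assoc,
    commute_iff_eq, @eq_comm _ (x * c), @eq_comm _ (y * c)]

/-- The span of the elements `g - g⁻¹` with `g ∈ M`. -/
def skewSpan (F : Type*) {G : Type*} [Field F] [Group G] (M : Subgroup G) :
    Submodule F (MonoidAlgebra F G) :=
  Submodule.span F (dif F '' M)

end

theorem top_mul_le_of_conj {F G : Type*} [Field F] [Group G]
    {K : Submodule F (MonoidAlgebra F G)}
    (h : ∀ g, ∀ a ∈ K, of F G g * a * of F G g⁻¹ ∈ K) : ⊤ * K ≤ K * ⊤ := by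
  rw [Submodule.mul_le]
  rintro a - b hb
  refine Submodule.span_induction (p := fun a _ => a * b ∈ _) ?_ ?_ ?_ ?_ (mem_span_of a)
  · rintro _ ⟨g, rfl⟩
    have := Submodule.mul_mem_mul (h g b hb)
      (Submodule.mem_top (R := F) (x := of F G g))
    rwa [mul_assoc, ← map_mul, inv_mul_cancel, map_one, mul_one] at this
  · simp
  · intro a c _ _ ha hc
    rw [add_mul]
    exact add_mem ha hc
  · intro r a _ ha
    rw [smul_mul_assoc]
    exact Submodule.smul_mem _ _ ha

namespace IsEngelExponent

variable {F G : Type*} [Field F] [Group G] {σ : G →* ℤˣ} {q : ℕ} (hq : IsEngelExponent F σ q)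
  {x y z : G} (Q : IsQuaternionPair x y z)
include hq Q

theorem isTwistedQuaternion :
    IsTwistedQuaternion (twist F z) (of F G x) (of F G y) (of F G (x * y)) := by
  have fz : twist F z * of F G z = - twist F z := twist_mul_of Q.zz
  have zc := hq.z_comm Q
  have fz' : ∀ a : G, twist F z * of F G (a * z) = - (twist F z * of F G a) := fun a => by
    rw [← zc, map_mul, ← mul_assoc, fz, neg_mul]
  have yxy : y * (x * y) = x := by
    rw [← mul_assoc, Q.yx, mul_assoc, Q.zy, mul_assoc, ← mul_assoc y, Q.yy, Q.zz, mul_one]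
  have xyx : x * y * x = y := by
    rw [mul_assoc, Q.yx, mul_assoc, ← mul_assoc, ← mul_assoc, Q.xx, zc, mul_assoc, Q.zz, mul_one]
  refine ⟨fun a => (twist_comm zc a).eq, by rw [twist_mul_twist Q.zz, two_smul],
    ?_, ?_, ?_, ?_, ?_, ?_, ?_, ?_, ?_⟩ <;> simp only [← map_mul]
  · rw [Q.xx, fz]
  · rw [Q.yy, fz]
  · rw [Q.xy_mul_xy, fz]
  · rw [yxy]
  · rw [xyx]
  · rw [Q.yx, fz']
  · rw [mul_assoc, Q.yy, fz']
  · rw [← mul_assoc, Q.xx, zc, fz']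

/-- Since (xm)⁻¹ = x z m⁻¹ and f z = -f, the symmetric element f·sy(xm) equals f x (m - m⁻¹). -/
theorem skewSpan_le : skewSpan F (evenCentralizer σ x y) ≤
    quatComp (twist F z) (of F G x) (of F G y) (of F G (x * y)) (symmSub F σ) := by
  have zc := hq.z_comm Q
  have fz : twist F z * of F G z = - twist F z := twist_mul_of Q.zz
  rw [skewSpan, Submodule.span_le]
  rintro _ ⟨m, hm, rfl⟩
  obtain ⟨hx, hy, hσ⟩ := mem_evenCentralizer.1 hm
  have hc : ∀ {u : G}, Commute m u → Commute (dif F m) (of F G u) := fun h =>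
    (h.map (of F G)).sub_left (h.inv_left.map (of F G))
  have key : ∀ {u v : G}, IsQuaternionPair u v z → Commute m u →
      twist F z * of F G u * dif F m ∈ symmSub F σ := by
    intro u v Q' hu
    have := twist_mul_mem hq.two_ne zc Q.zz (hq.map_z Q) (sy_mem (F := F) σ (u * m))
    rw [hq.sy_x_mul Q' hu, sgn_of_eq_one hσ, one_smul, ← mul_assoc,
      (twist_comm zc (of F G u)).eq, mul_assoc, mul_add, map_mul, ← mul_assoc (twist F z), fz,
      neg_mul, ← sub_eq_add_neg, ← mul_sub, ← mul_assoc, ← (twist_comm zc (of F G u)).eq] at this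
    exact this
  exact ⟨⟨hc hx, hc hy, hc (hx.mul_right hy)⟩, key Q hx, key Q.swap hy,
    key (Q.right.swap) (hx.mul_right hy)⟩

theorem conj_mem {m : G} (hm : m ∈ evenCentralizer σ x y) (g : G) :
    g * m * g⁻¹ ∈ evenCentralizer σ x y := by
  have zc := hq.z_comm Q
  obtain ⟨hx, hy, hσ⟩ := mem_evenCentralizer.1 hm
  have key : ∀ u, (g * u = u * g ∨ g * u = u * g * z) → Commute m u →
      Commute (g * m * g⁻¹) u := by
    rintro u (hu | hu) hmu
    · exact (Commute.mul_left (Commute.mul_left hu hmu) (Commute.inv_left hu))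
    · have e : u * g = g * u * z := by rw [hu, mul_assoc, Q.zz, mul_one]
      rw [commute_iff_eq, ← mul_left_inj g]
      calc g * m * g⁻¹ * u * g = g * m * g⁻¹ * (u * g) := by simp only [mul_assoc]
        _ = g * (m * u) * z := by rw [e]; group
        _ = g * u * z * m := by rw [hmu.eq, mul_assoc, mul_assoc, ← zc]; simp only [mul_assoc]
        _ = u * (g * m * g⁻¹) * g := by rw [← e]; group
  refine mem_evenCentralizer.2 ⟨key x (hq.x_comm Q g) hx, key y (hq.y_comm Q g) hy, ?_⟩
  simp [hσ]

theorem conj_jordanSpan (g : G) {a : MonoidAlgebra F G}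
    (ha : a ∈ jordanSpan (skewSpan F (evenCentralizer σ x y))) :
    of F G g * a * of F G g⁻¹ ∈ jordanSpan (skewSpan F (evenCentralizer σ x y)) := by
  let φ : MonoidAlgebra F G →ₗ[F] MonoidAlgebra F G :=
    LinearMap.mulRight F (of F G g⁻¹) ∘ₗ LinearMap.mulLeft F (of F G g)
  have hφ : ∀ a, φ a = of F G g * a * of F G g⁻¹ := fun a => rfl
  have hmul : ∀ a b, φ a * φ b = φ (a * b) := by
    intro a b
    rw [hφ, hφ, hφ]
    calc _ = of F G g * a * (of F G g⁻¹ * of F G g) * b * of F G g⁻¹ := by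
          simp only [mul_assoc]
      _ = _ := by rw [← map_mul, inv_mul_cancel, map_one, mul_one]; simp only [mul_assoc]
  have h1 : skewSpan F (evenCentralizer σ x y) ≤ (skewSpan F (evenCentralizer σ x y)).comap φ := by
    conv_lhs => rw [skewSpan]
    rw [Submodule.span_le]
    rintro _ ⟨m, hm, rfl⟩
    refine Submodule.subset_span ⟨g * m * g⁻¹, hq.conj_mem Q hm g, ?_⟩
    rw [hφ, dif, dif, mul_sub, sub_mul]
    simp only [← map_mul, mul_inv_rev, inv_inv, mul_assoc]
  have h3 : jordanSpan (skewSpan F (evenCentralizer σ x y)) ≤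
      (jordanSpan (skewSpan F (evenCentralizer σ x y))).comap φ := by
    conv_lhs => rw [jordanSpan]
    rw [Submodule.span_le]
    rintro _ ⟨a, ha, b, hb, rfl⟩
    refine Submodule.subset_span ⟨φ a, h1 ha, φ b, h1 hb, ?_⟩
    rw [hmul, hmul, map_add]
  exact h3 ha

theorem top_mul_jordanSpan :
    ⊤ * jordanSpan (skewSpan F (evenCentralizer σ x y)) ≤
      jordanSpan (skewSpan F (evenCentralizer σ x y)) * ⊤ :=
  top_mul_le_of_conj fun g _ ha => hq.conj_jordanSpan Q g ha

end IsEngelExponent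

theorem mul_top_pow_le {F R : Type*} [Field F] [Ring R] [Algebra F R] {K : Submodule F R}
    (h : ⊤ * K ≤ K * ⊤) (n : ℕ) : (K * ⊤) ^ (n + 1) ≤ K ^ (n + 1) * ⊤ := by
  induction n with
  | zero => simp
  | succ n ih =>
    calc (K * ⊤) ^ (n + 1 + 1) = (K * ⊤) ^ (n + 1) * (K * ⊤) := pow_succ _ _
      _ ≤ K ^ (n + 1) * ⊤ * (K * ⊤) := mul_le_mul' ih le_rfl
      _ = K ^ (n + 1) * (⊤ * K) * ⊤ := by simp only [mul_assoc]
      _ ≤ K ^ (n + 1) * (K * ⊤) * ⊤ :=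
        mul_le_mul' (mul_le_mul' le_rfl h) le_rfl
      _ = K ^ (n + 1 + 1) * (⊤ * ⊤) := by rw [pow_succ _ (n + 1)]; simp only [mul_assoc]
      _ ≤ K ^ (n + 1 + 1) * ⊤ := mul_le_mul' le_rfl le_top

/-! ### Structure of `G` -/

/-- The span of the elements `h - 1` with `h ∈ P`. -/
def delta (F : Type*) {G : Type*} [Field F] [Group G] (P : Subgroup G) :
    Submodule F (MonoidAlgebra F G) :=
  Submodule.span F ((fun h => of F G h - 1) '' P)

theorem mul_mem_mul_top_left {F R : Type*} [Field F] [Ring R] [Algebra F R] {K : Submodule F R}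
    (h : ⊤ * K ≤ K * ⊤) (b : R) {a : R} (ha : a ∈ K * ⊤) : b * a ∈ K * ⊤ := by
  have : ⊤ * (K * ⊤) ≤ K * ⊤ := by
    calc ⊤ * (K * ⊤) = ⊤ * K * ⊤ := (mul_assoc _ _ _).symm
      _ ≤ K * ⊤ * ⊤ := mul_le_mul' h le_rfl
      _ = K * (⊤ * ⊤) := mul_assoc _ _ _
      _ ≤ K * ⊤ := mul_le_mul' le_rfl le_top
  exact this (Submodule.mul_mem_mul Submodule.mem_top ha)

theorem mul_mem_mul_top_right {F R : Type*} [Field F] [Ring R] [Algebra F R] {K : Submodule F R}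
    (b : R) {a : R} (ha : a ∈ K * ⊤) : a * b ∈ K * ⊤ := by
  have : K * ⊤ * ⊤ ≤ K * ⊤ := by
    rw [mul_assoc]
    exact mul_le_mul' le_rfl le_top
  exact this (Submodule.mul_mem_mul ha Submodule.mem_top)

/-- The two-sided ideal generated by the Jordan products of the `m - m⁻¹`, where `m ∈ ker σ`
centralizes `x` and `y`. -/
def jordanIdeal (F : Type*) {G : Type*} [Field F] [Group G] (σ : G →* ℤˣ) (x y : G) :
    Submodule F (MonoidAlgebra F G) :=
  jordanSpan (skewSpan F (evenCentralizer σ x y)) * ⊤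

/-! ### Augmentation elements modulo the Jordan ideal -/

namespace IsEngelExponent

variable {F G : Type*} [Field F] [Group G] {σ : G →* ℤˣ} {q : ℕ} (hq : IsEngelExponent F σ q)
  {x y z : G} (Q : IsQuaternionPair x y z)
include hq Q

theorem jordanIdeal_mul_left (b : MonoidAlgebra F G) {a : MonoidAlgebra F G}
    (ha : a ∈ jordanIdeal F σ x y) : b * a ∈ jordanIdeal F σ x y :=
  mul_mem_mul_top_left (hq.top_mul_jordanSpan Q) b ha

omit hq Q in
theorem jordanIdeal_mul_right (b : MonoidAlgebra F G) {a : MonoidAlgebra F G}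
    (ha : a ∈ jordanIdeal F σ x y) : a * b ∈ jordanIdeal F σ x y :=
  mul_mem_mul_top_right b ha

theorem twist_mul_eq_zero {n : ℕ} (hn : lieSub (symmSub F σ) (n + 1) = ⊥)
    {a : MonoidAlgebra F G} (ha : a ∈ jordanIdeal F σ x y ^ (n + 1)) : twist F z * a = 0 := by
  refine Submodule.mul_induction_on (mul_top_pow_le (hq.top_mul_jordanSpan Q) n ha) ?_ ?_
  · intro b hb c _
    rw [← mul_assoc, (hq.isTwistedQuaternion Q).jordanSpan_pow_eq_zero hq.two_ne
      (symmSub_jordan hq.two_ne) (hq.skewSpan_le Q) hn hb, zero_mul]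
  · intro b c hb hc
    rw [mul_add, hb, hc, add_zero]

omit hq Q in
theorem dif_jordan_mem {c d : G} (hc : c ∈ evenCentralizer σ x y)
    (hd : d ∈ evenCentralizer σ x y) :
    dif F c * dif F d + dif F d * dif F c ∈ jordanIdeal F σ x y := by
  have : dif F c * dif F d + dif F d * dif F c ∈ jordanSpan (skewSpan F (evenCentralizer σ x y)) :=
    Submodule.subset_span ⟨_, Submodule.subset_span ⟨c, hc, rfl⟩, _,
      Submodule.subset_span ⟨d, hd, rfl⟩, rfl⟩
  rw [← mul_one (dif F c * dif F d + dif F d * dif F c)]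
  exact Submodule.mul_mem_mul this Submodule.mem_top

-- As q is odd, c = d² with d = c^((q+1)/2), and c + c⁻¹ - 2 = (d - d⁻¹)².
omit Q in
theorem add_inv_sub_two_mem {c : G} (hc : c ∈ evenCentralizer σ x y) (hcq : c ^ q = 1) :
    of F G c + of F G c⁻¹ - 2 ∈ jordanIdeal F σ x y := by
  set d := c ^ ((q + 1) / 2) with hd
  have hdd : d * d = c := by
    obtain ⟨m, hm⟩ := hq.odd
    rw [hd, ← pow_add, show (q + 1) / 2 + (q + 1) / 2 = q + 1 by omega, pow_succ, hcq, one_mul]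
  have hdT : d ∈ evenCentralizer σ x y := pow_mem hc _
  have := mem_of_add_self_mem hq.two_ne (dif_jordan_mem (F := F) hdT hdT)
  have e : of F G c + of F G c⁻¹ - 2 = dif F d * dif F d := by
    simp only [dif, sub_mul, mul_sub, ← map_mul, hdd, mul_inv_cancel, inv_mul_cancel, map_one,
      ← mul_inv_rev]
    rw [← one_add_one_eq_two]
    abel
  rwa [e]

theorem sub_one_sq_mem {c : G} (hc : c ∈ evenCentralizer σ x y) (hcq : c ^ q = 1) :
    (of F G c - 1) * (of F G c - 1) ∈ jordanIdeal F σ x y := by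
  have := hq.jordanIdeal_mul_left Q (of F G c) (hq.add_inv_sub_two_mem hc hcq)
  have e : (of F G c - 1) * (of F G c - 1) = of F G c * (of F G c + of F G c⁻¹ - 2) := by
    rw [mul_sub (of F G c), mul_add, ← map_mul _ c c⁻¹, mul_inv_cancel, map_one]
    noncomm_ring
  rwa [e]

/-- Modulo the ideal 2(c - 1) ≡ c - c⁻¹, so four times this Jordan product is one of its generators.
-/
theorem sub_one_jordan_mem {c d : G} (hc : c ∈ evenCentralizer σ x y) (hcq : c ^ q = 1)
    (hd : d ∈ evenCentralizer σ x y) (hdq : d ^ q = 1) :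
    (of F G c - 1) * (of F G d - 1) + (of F G d - 1) * (of F G c - 1) ∈
      jordanIdeal F σ x y := by
  have h1 := hq.add_inv_sub_two_mem (x := x) (y := y) hc hcq
  have h2 := hq.add_inv_sub_two_mem (x := x) (y := y) hd hdq
  have h3 := dif_jordan_mem (F := F) hc hd
  have ec : (of F G c - 1) + (of F G c - 1) =
      dif F c + (of F G c + of F G c⁻¹ - 2) := by
    rw [dif, ← one_add_one_eq_two]; abel
  have ed : (of F G d - 1) + (of F G d - 1) =
      dif F d + (of F G d + of F G d⁻¹ - 2) := by
    rw [dif, ← one_add_one_eq_two]; abel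
  apply mem_of_add_self_mem hq.two_ne
  apply mem_of_add_self_mem hq.two_ne
  set u := of F G c + of F G c⁻¹ - 2
  set v := of F G d + of F G d⁻¹ - 2
  have e : ∀ a b : MonoidAlgebra F G, a * b + b * a + (a * b + b * a) +
      (a * b + b * a + (a * b + b * a)) = (a + a) * (b + b) + (b + b) * (a + a) := by
    intro a b; noncomm_ring
  rw [e, ec, ed]
  have e' : (dif F c + u) * (dif F d + v) + (dif F d + v) * (dif F c + u) =
      (dif F c * dif F d + dif F d * dif F c) + (dif F c * v + v * dif F c) +
      (u * (dif F d + v) + (dif F d + v) * u) := by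
    noncomm_ring
  rw [e']
  exact add_mem (add_mem h3 (add_mem (hq.jordanIdeal_mul_left Q _ h2) (jordanIdeal_mul_right _ h2)))
    (add_mem (jordanIdeal_mul_right _ h1) (hq.jordanIdeal_mul_left Q _ h1))

/-- Modulo the ideal a = c - 1 and b = d - 1 square to zero and anticommute, hence so does a + b +
ab = cd - 1 square to zero. -/
theorem mul_sub_one_sq_mem {c d : G} (hc : c ∈ evenCentralizer σ x y) (hcq : c ^ q = 1)
    (hd : d ∈ evenCentralizer σ x y) (hdq : d ^ q = 1) :
    (of F G (c * d) - 1) * (of F G (c * d) - 1) ∈ jordanIdeal F σ x y := by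
  have h1 := hq.sub_one_sq_mem Q hc hcq
  have h2 := hq.sub_one_sq_mem Q hd hdq
  have h3 := hq.sub_one_jordan_mem Q hc hcq hd hdq
  have e : of F G (c * d) - 1 = (of F G c - 1) + (of F G d - 1) +
      (of F G c - 1) * (of F G d - 1) := by
    rw [map_mul]; noncomm_ring
  rw [e]
  generalize of F G c - 1 = a at *
  generalize of F G d - 1 = b at *
  have L := fun (r s : MonoidAlgebra F G) (hs : s ∈ jordanIdeal F σ x y) =>
    hq.jordanIdeal_mul_left Q r hs
  have R := fun (r s : MonoidAlgebra F G) (hs : s ∈ jordanIdeal F σ x y) =>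
    jordanIdeal_mul_right r hs
  have e' : (a + b + a * b) * (a + b + a * b) =
      a * a + b * b + (a * b + b * a) + a * a * b + ((a * b + b * a) * a - b * (a * a)) +
      (b * (a * b + b * a) - (b * b) * a) + a * (b * b) +
      ((a * b + b * a) * (a * b) - b * (a * a) * b) := by
    noncomm_ring
  rw [e']
  refine add_mem (add_mem (add_mem (add_mem (add_mem (add_mem (add_mem h1 h2) h3) ?_) ?_) ?_) ?_) ?_
  · exact R _ _ h1
  · exact sub_mem (R _ _ h3) (L _ _ h1)
  · exact sub_mem (L _ _ h3) (R _ _ h2)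
  · exact L _ _ h2
  · exact sub_mem (R _ _ h3) (R _ _ (L _ _ h1))

/-- Modulo the ideal t = e - 1 anticommutes with a, b and a + b + ab, hence with ab. It also
commutes with ab, having anticommuted past both factors; so 2abt ≡ 0. -/
theorem triple_mem {c d e : G} (hc : c ∈ evenCentralizer σ x y) (hcq : c ^ q = 1)
    (hd : d ∈ evenCentralizer σ x y) (hdq : d ^ q = 1)
    (he : e ∈ evenCentralizer σ x y) (heq : e ^ q = 1) (hcd : (c * d) ^ q = 1) :
    (of F G c - 1) * (of F G d - 1) * (of F G e - 1) ∈ jordanIdeal F σ x y := by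
  have h1 := hq.sub_one_jordan_mem Q hc hcq he heq
  have h2 := hq.sub_one_jordan_mem Q hd hdq he heq
  have h3 := hq.sub_one_jordan_mem Q (mul_mem hc hd) hcd he heq
  have e0 : of F G (c * d) - 1 = (of F G c - 1) + (of F G d - 1) +
      (of F G c - 1) * (of F G d - 1) := by
    rw [map_mul]; noncomm_ring
  rw [e0] at h3
  generalize of F G c - 1 = a at *
  generalize of F G d - 1 = b at *
  generalize of F G e - 1 = t at *
  apply mem_of_add_self_mem hq.two_ne
  have e' : a * b * t + a * b * t = (a + b + a * b) * t + t * (a + b + a * b) - (a * t + t * a) -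
      (b * t + t * b) - (a * t + t * a) * b + a * (b * t + t * b) := by
    noncomm_ring
  rw [e']
  exact add_mem (sub_mem (sub_mem (sub_mem h3 h1) h2) (jordanIdeal_mul_right _ h1))
    (hq.jordanIdeal_mul_left Q _ h2)

/-- The element c^q has square 1 because σ(c) = 1, and it has odd order. -/
theorem pow_eq_one_of_pow_eq_one {c : G} (hc : c ∈ evenCentralizer σ x y) {n : ℕ} (hn : Odd n)
    (h : c ^ n = 1) : c ^ q = 1 := by
  obtain ⟨hx, hy, hσ⟩ := mem_evenCentralizer.1 hc
  rcases hq.pow_mul_pow Q hx hy with ⟨-, h1⟩ | ⟨h1, -⟩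
  · obtain ⟨m, rfl⟩ := hn
    rw [← pow_two] at h1
    have h3 : (c ^ q) ^ (2 * m + 1) = 1 := by rw [← pow_mul, mul_comm, pow_mul, h, one_pow]
    rwa [pow_succ, pow_mul, h1, one_pow, one_mul] at h3
  · rw [hσ] at h1
    exact absurd h1 (by decide)

/-- Conjugation by x or y sends h to h or hz, and (hz)ⁿ = z ≠ 1 for odd n; a sign of odd order is
trivial. -/
theorem mem_of_pow_eq_one {h : G} {n : ℕ} (hn : Odd n) (hh : h ^ n = 1) :
    h ∈ evenCentralizer σ x y := by
  have key : ∀ u, (h * u = u * h ∨ h * u = u * h * z) → Commute h u := by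
    rintro u (hu | hu)
    · exact hu
    · exfalso
      have e : u⁻¹ * h * u = h * z := by rw [mul_assoc, hu]; group
      have e2 := congrArg (· ^ n) e
      have hc : Commute h z := (hq.z_comm Q h).symm
      have e3 : (u⁻¹ * h * u) ^ n = u⁻¹ * h ^ n * u := by
        simpa using conj_pow (a := u⁻¹) (b := h) (i := n)
      simp only [hc.mul_pow, e3, hh, mul_one, one_mul, inv_mul_cancel] at e2
      obtain ⟨m, rfl⟩ := hn
      rw [pow_succ, pow_mul, pow_two, Q.zz, one_pow, one_mul] at e2
      exact Q.z_ne e2.symm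
  refine mem_evenCentralizer.2 ⟨key x (hq.x_comm Q h), key y (hq.y_comm Q h), ?_⟩
  have := congrArg σ hh
  rw [map_pow, map_one] at this
  rcases Int.units_eq_one_or (σ h) with h1 | h1
  · exact h1
  · rw [h1, hn.neg_one_pow] at this
    exact absurd this (by decide)

/-- The element f kills a power of (cd - 1)², hence some (cd - 1)^(p^k) = (cd)^(p^k) - 1. Cancelling
f shows that cd is a p-element. -/
theorem mul_pow_eq_one {p : ℕ} [Fact p.Prime] [CharP F p] (hp : 2 < p)
    (hL : IsLieNilpotent (symmSub F σ : Set (MonoidAlgebra F G)))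
    {c d : G} (hc : c ∈ evenCentralizer σ x y) (hcq : c ^ q = 1)
    (hd : d ∈ evenCentralizer σ x y) (hdq : d ^ q = 1) : (c * d) ^ q = 1 := by
  obtain ⟨n, hn, h0⟩ := (isLieNilpotent_iff _).1 hL
  have h0' : lieSub (symmSub F σ) (n + 1) = ⊥ := lieSub_eq_bot_of_le hn (by omega) h0
  have h1 := hq.mul_sub_one_sq_mem Q hc hcq hd hdq
  have h3 := hq.twist_mul_eq_zero Q h0' (Submodule.pow_mem_pow _ h1 (n + 1))
  have : CharP (MonoidAlgebra F G) p := charP_of_injective_algebraMap' F p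
  have hlt : 2 * (n + 1) ≤ p ^ (2 * (n + 1)) := (Nat.lt_pow_self (by omega)).le
  rw [← pow_two, ← pow_mul] at h3
  have h4 : twist F z * (of F G (c * d) - 1) ^ p ^ (2 * (n + 1)) = 0 := by
    rw [← Nat.add_sub_cancel' hlt, pow_add, ← mul_assoc, h3, zero_mul]
  rw [sub_pow_char_pow_of_commute _ _ (Commute.one_right _), one_pow, ← map_pow, mul_sub,
    sub_eq_zero, ← map_one (of F G)] at h4
  have h5 := one_sub_mul_cancel hq.two_ne Q.z_ne h4
  exact hq.pow_eq_one_of_pow_eq_one Q (mul_mem hc hd)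
    (((Fact.out : p.Prime).odd_of_ne_two (by omega)).pow) h5

end IsEngelExponent

/-- `P` is a subgroup of odd exponent and `G` is the central product of `⟨x, y⟩`, the centre, and
`P`. -/
structure IsQuaternionExtension {G : Type*} [Group G] (σ : G →* ℤˣ) (x y z : G) (P : Subgroup G) :
    Prop extends IsQuaternionPair x y z where
  z_comm : ∀ h, z * h = h * z
  map_x : σ x = 1
  map_y : σ y = 1
  x_comm : ∀ h, h * x = x * h ∨ h * x = x * h * z
  y_comm : ∀ h, h * y = y * h ∨ h * y = y * h * z
  le : P ≤ evenCentralizer σ x y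
  odd : ∃ n, Odd n ∧ ∀ r ∈ P, r ^ n = 1
  decomp : ∀ h, ∃ k ∈ ({1, x, y, x * y} : Set G), ∃ c, ∃ r ∈ P, h = k * c * r ∧
    (∀ g, Commute c g) ∧ ((σ c = 1 ∧ c * c = 1) ∨ (σ c = -1 ∧ c * c = z))

theorem two_ne_zero_of_charP (F : Type*) [Field F] {p : ℕ} [CharP F p] (hp : 2 < p) :
    (2 : F) ≠ 0 := by
  intro h
  have h1 : ((2 : ℕ) : F) = 0 := by exact_mod_cast h
  have := Nat.le_of_dvd (by norm_num) ((CharP.cast_eq_zero_iff F p 2).1 h1)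
  omega

/-- The span of the elements of a subgroup. -/
def groupSpan (F : Type*) {G : Type*} [Field F] [Group G] (P : Subgroup G) :
    Submodule F (MonoidAlgebra F G) :=
  Submodule.span F (of F G '' P)

theorem delta_pow_le_groupSpan (F : Type*) {G : Type*} [Field F] [Group G] (P : Subgroup G)
    (n : ℕ) : delta F P ^ n ≤ groupSpan F P := by
  have h1 : (1 : MonoidAlgebra F G) ∈ groupSpan F P :=
    Submodule.subset_span ⟨1, one_mem P, map_one _⟩
  have h2 : delta F P ≤ groupSpan F P := by
    rw [delta, Submodule.span_le]
    rintro _ ⟨h, hh, rfl⟩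
    exact sub_mem (Submodule.subset_span ⟨h, hh, rfl⟩) h1
  induction n with
  | zero => rwa [pow_zero, Submodule.one_le]
  | succ n ih =>
    rw [pow_succ]
    refine (mul_le_mul' ih h2).trans ?_
    rw [groupSpan, Submodule.span_mul_span]
    refine Submodule.span_mono ?_
    rintro _ ⟨_, ⟨g, hg, rfl⟩, _, ⟨h, hh, rfl⟩, rfl⟩
    exact ⟨g * h, mul_mem hg hh, map_mul _ _ _⟩

theorem coeff_eq_zero_of_mem_groupSpan {F G : Type*} [Field F] [Group G] {P : Subgroup G}
    {a : MonoidAlgebra F G} (ha : a ∈ groupSpan F P) {g : G} (hg : g ∉ P) : a.coeff g = 0 := by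
  classical
  refine Submodule.span_induction (p := fun a _ => a.coeff g = 0) ?_ ?_ ?_ ?_ ha
  · rintro _ ⟨h, hh, rfl⟩
    rw [coeff_of_apply, if_neg]
    rintro rfl
    exact hg hh
  · simp
  · intro a b _ _ h1 h2
    simp [h1, h2]
  · intro r a _ h1
    simp [h1]

/-- The supports of a and za lie in the different cosets P and zP, so a - za = 0 forces a = 0. -/
theorem eq_zero_of_twist_mul {F G : Type*} [Field F] [Group G] {P : Subgroup G} {z : G}
    (hz : z ∉ P) {a : MonoidAlgebra F G} (ha : a ∈ groupSpan F P) (h : twist F z * a = 0) :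
    a = 0 := by
  ext g
  by_cases hg : g ∈ P
  · have h1 := congrArg (fun b => b.coeff g) h
    rw [twist, sub_mul, one_mul, of_apply] at h1
    simp only [coeff_sub, Finsupp.sub_apply, coeff_single_mul_apply, one_mul, coeff_zero,
      Finsupp.coe_zero, Pi.zero_apply] at h1
    rw [coeff_eq_zero_of_mem_groupSpan ha (g := z⁻¹ * g), sub_zero] at h1
    · simpa using h1
    · intro hzg
      exact hz (by simpa using mul_mem hg (inv_mem hzg))
  · simp [coeff_eq_zero_of_mem_groupSpan ha hg]

theorem IsQuaternionExtension.z_not_mem {G : Type*} [Group G] {σ : G →* ℤˣ} {x y z : G}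
    {P : Subgroup G} (X : IsQuaternionExtension σ x y z P) : z ∉ P := by
  intro hz
  obtain ⟨n, ⟨m, rfl⟩, h⟩ := X.odd
  have := h z hz
  rw [pow_succ, pow_mul, pow_two, X.zz, one_pow, one_mul] at this
  exact X.z_ne this

/-! ### The Sylow subgroup and the nilpotency of its augmentation ideal -/

section Main

variable {F G : Type*} [Field F] [Group G] {p : ℕ} [Fact p.Prime] [CharP F p] (hp : 2 < p)
  {σ : G →* ℤˣ} {x y z : G} (Q : IsQuaternionPair x y z)
  (hL : IsLieNilpotent (symmSub F σ : Set (MonoidAlgebra F G)))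
include hp hL

theorem exists_isEngelExponent : ∃ j, IsEngelExponent F σ (p ^ j) := by
  obtain ⟨j, hj, h⟩ := exists_pow_commute (p := p) hp hL
  refine ⟨j, two_ne_zero_of_charP F hp, hj, fun g h' => ?_⟩
  have := h _ (sy_mem σ h') _ (sy_mem σ g)
  rw [sy_pow hp] at this
  exact this.symm

include Q in
theorem isQuaternionExtension (P : Sylow p G) :
    IsQuaternionExtension σ x y z (P : Subgroup G) ∧ ∃ n, delta F (P : Subgroup G) ^ n = ⊥ := by
  obtain ⟨j, hq⟩ := exists_isEngelExponent (F := F) hp hL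
  -- By the previous lemmas this is the set of all p-elements of G; being a p-group, it equals P by
  -- maximality.
  let P₀ : Subgroup G :=
    { carrier := {c | c ∈ evenCentralizer σ x y ∧ c ^ p ^ j = 1}
      mul_mem' := fun ha hb =>
        ⟨mul_mem ha.1 hb.1, hq.mul_pow_eq_one Q hp hL ha.1 ha.2 hb.1 hb.2⟩
      one_mem' := ⟨one_mem _, one_pow _⟩
      inv_mem' := fun ha => ⟨inv_mem ha.1, by rw [inv_pow, ha.2, inv_one]⟩ }
  have hP₀ : IsPGroup p P₀ := fun c => ⟨j, Subtype.ext c.2.2⟩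
  have hle : (P : Subgroup G) ≤ P₀ := by
    intro h hh
    obtain ⟨a, ha⟩ := P.isPGroup' ⟨h, hh⟩
    have ha' : h ^ p ^ a = 1 := congrArg Subtype.val ha
    have hodd : Odd (p ^ a) := ((Fact.out : p.Prime).odd_of_ne_two (by omega)).pow
    have h1 := hq.mem_of_pow_eq_one Q hodd ha'
    exact ⟨h1, hq.pow_eq_one_of_pow_eq_one Q h1 hodd ha'⟩
  have hPP : (P : Subgroup G) = P₀ := (P.is_maximal' hP₀ hle).symm
  rw [hPP]
  have ext : IsQuaternionExtension σ x y z P₀ := by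
    refine ⟨Q, hq.z_comm Q, hq.map_x Q, hq.map_y Q, hq.x_comm Q, hq.y_comm Q, fun c hc => hc.1,
      ⟨p ^ j, hq.odd, fun r hr => hr.2⟩, fun h => ?_⟩
    obtain ⟨k, hk, c, rfl, hx, hy⟩ := hq.exists_mul_centralizing Q h
    have hcen := hq.pow_central Q hx hy
    have hw := hq.pow_mul_pow Q hx hy
    have hσ : σ (c ^ p ^ j) = σ c := by
      rcases Int.units_eq_one_or (σ c) with h | h <;> simp [h, hq.odd.neg_one_pow]
    -- The centralizing factor is split as c = c^q · (c^(-q) c). The first factor is central of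
    -- order dividing 4; the q-th power of the second is 1, because q ≡ 1 (mod 4).
    refine ⟨k, hk, c ^ p ^ j, (c ^ p ^ j)⁻¹ * c, ⟨?_, ?_⟩, by group, hcen, by rwa [hσ]⟩
    · refine mem_evenCentralizer.2 ⟨(hx.pow_left _).inv_left.mul_left hx,
        (hy.pow_left _).inv_left.mul_left hy, ?_⟩
      rw [map_mul, map_inv, hσ, inv_mul_cancel]
    · rw [(hcen c).inv_left.mul_pow, inv_pow, hq.pow_eq, inv_mul_cancel]
      rcases hw with ⟨-, h⟩ | ⟨-, h⟩ <;> simp [h, Q.zz]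
  refine ⟨ext, ?_⟩
  obtain ⟨n, hn, h0⟩ := (isLieNilpotent_iff _).1 hL
  have h0' : lieSub (symmSub F σ) (n + 1) = ⊥ := lieSub_eq_bot_of_le hn (by omega) h0
  have h3 : delta F P₀ ^ 3 ≤ jordanIdeal F σ x y := by
    rw [pow_succ, pow_two, delta, Submodule.span_mul_span, Submodule.span_mul_span,
      Submodule.span_le]
    rintro _ ⟨_, ⟨_, ⟨a, ha, rfl⟩, _, ⟨b, hb, rfl⟩, rfl⟩, _, ⟨c, hc, rfl⟩, rfl⟩
    exact hq.triple_mem Q ha.1 ha.2 hb.1 hb.2 hc.1 hc.2 (mul_mem ha hb).2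
  refine ⟨3 * (n + 1), (Submodule.eq_bot_iff _).2 fun a ha => ?_⟩
  refine eq_zero_of_twist_mul ext.z_not_mem (delta_pow_le_groupSpan F P₀ _ ha) ?_
  rw [pow_mul] at ha
  exact hq.twist_mul_eq_zero Q h0' (pow_le_pow_left' h3 _ ha)

end Main

/-! ### Powers of the augmentation ideal -/

section AugIdeal

variable {F G : Type*} [Field F] [Group G]

/-- Exponent 0 is excluded: the zeroth power is the whole ring for ideals but the line of scalars
for subspaces. -/
theorem restrictScalars_ideal_pow {R : Type*} [Ring R] [Algebra F R] (I : Ideal R) (n : ℕ) :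
    (I ^ (n + 1)).restrictScalars F = I.restrictScalars F ^ (n + 1) := by
  induction n with
  | zero => rw [zero_add, Submodule.pow_one, pow_one]
  | succ n ih => rw [Submodule.pow_succ, Submodule.restrictScalars_mul, ih, ← pow_succ]

theorem restrictScalars_augIdeal (H : Type*) [Group H] :
    (augIdeal F H).restrictScalars F = Submodule.span F (Set.range fun h : H => of F H h - 1) := by
  apply le_antisymm
  · intro a ha
    have key : ∀ a : MonoidAlgebra F H, a - (lift F F H (1 : H →* F) a) • 1 ∈
        Submodule.span F (Set.range fun h : H => of F H h - 1) := by
      intro a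
      induction a using MonoidAlgebra.induction_on with
      | of g => 
        rw [lift_of, MonoidHom.one_apply, one_smul]
        exact Submodule.subset_span ⟨g, rfl⟩
      | add a b ha hb =>
        rw [map_add, add_smul, add_sub_add_comm]
        exact add_mem ha hb
      | smul r a ha =>
        rw [map_smul, smul_assoc, ← smul_sub]
        exact Submodule.smul_mem _ _ ha
    have := key a
    rwa [show lift F F H (1 : H →* F) a = 0 from ha, zero_smul, sub_zero] at this
  · rw [Submodule.span_le]
    rintro _ ⟨h, rfl⟩
    change lift F F H (1 : H →* F) (of F H h - 1) = 0
    rw [map_sub, lift_of, map_one]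
    simp

theorem augIdeal_pow_eq_bot_iff (P : Subgroup G) (n : ℕ) :
    augIdeal F P ^ (n + 1) = ⊥ ↔ delta F P ^ (n + 1) = ⊥ := by
  have hι : ∀ h : P, (mapDomainAlgHom F F P.subtype).toLinearMap (of F P h - 1) =
      of F G h - 1 := by
    intro h
    rw [map_sub, AlgHom.toLinearMap_apply, AlgHom.toLinearMap_apply, map_one]
    simp [of_apply]
  have h1 : Submodule.map (mapDomainAlgHom F F P.subtype).toLinearMap
      ((augIdeal F P).restrictScalars F) = delta F P := by
    rw [restrictScalars_augIdeal, Submodule.map_span, delta]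
    congr 1
    ext a
    constructor
    · rintro ⟨_, ⟨h, rfl⟩, rfl⟩
      exact ⟨h, h.2, (hι h).symm⟩
    · rintro ⟨h, hh, rfl⟩
      exact ⟨_, ⟨⟨h, hh⟩, rfl⟩, hι ⟨h, hh⟩⟩
  have hinj : Function.Injective (mapDomainAlgHom F F P.subtype).toLinearMap :=
    mapDomain_injective P.subtype_injective
  rw [← h1, ← Submodule.map_pow, ← restrictScalars_ideal_pow]
  rw [(Submodule.map_injective_of_injective hinj).eq_iff' (Submodule.map_bot _),
    Submodule.restrictScalars_eq_bot_iff]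

theorem delta_pow_tNil (P : Subgroup G) (h : ∃ n, delta F P ^ n = ⊥) :
    1 ≤ tNil F P ∧ delta F P ^ tNil F P = ⊥ ∧
      ∀ n, 1 ≤ n → n < tNil F P → delta F P ^ n ≠ ⊥ := by
  have hne : {n | augIdeal F P ^ n = ⊥}.Nonempty := by
    obtain ⟨n, hn⟩ := h
    refine ⟨n + 1, (augIdeal_pow_eq_bot_iff P n).2 ?_⟩
    rw [pow_succ, hn, Submodule.bot_mul]
  have h1 : 1 ≤ tNil F P := by
    rw [Nat.one_le_iff_ne_zero]
    intro h0
    have h2 : augIdeal F P ^ tNil F P = ⊥ := Nat.sInf_mem hne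
    rw [h0, Submodule.pow_zero] at h2
    have : (1 : MonoidAlgebra F P) ∈ (⊥ : Ideal (MonoidAlgebra F P)) := by
      rw [← h2]
      exact Submodule.one_le.1 le_rfl
    exact one_ne_zero ((Submodule.mem_bot _).1 this)
  refine ⟨h1, ?_, fun n hn hlt h0 => ?_⟩
  · have h2 : augIdeal F P ^ tNil F P = ⊥ := Nat.sInf_mem hne
    obtain ⟨n, hn⟩ := Nat.exists_eq_add_of_le' h1
    rw [hn] at h2 ⊢
    exact (augIdeal_pow_eq_bot_iff P n).1 h2
  · obtain ⟨n, rfl⟩ := Nat.exists_eq_add_of_le' hn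
    exact Nat.notMem_of_lt_sInf hlt ((augIdeal_pow_eq_bot_iff P n).2 h0)

end AugIdeal

/-! ### Two-sided ideals as subspaces -/

section TwoSided

variable {F R : Type*} [Field F] [Ring R] [Algebra F R]

/-- The subspace `I` is a two-sided ideal. -/
structure IsTwoSidedSub (I : Submodule F R) : Prop where
  left : ∀ b : R, ∀ a ∈ I, b * a ∈ I
  right : ∀ b : R, ∀ a ∈ I, a * b ∈ I

theorem IsTwoSidedSub.pow_succ {I : Submodule F R} (h : IsTwoSidedSub I) (n : ℕ) :
    IsTwoSidedSub (I ^ (n + 1)) := by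
  constructor
  · intro b a ha
    rw [pow_succ'] at ha ⊢
    refine Submodule.mul_induction_on ha ?_ ?_
    · intro c hc d hd
      rw [← mul_assoc]
      exact Submodule.mul_mem_mul (h.left b c hc) hd
    · intro c d hc hd
      rw [mul_add]
      exact add_mem hc hd
  · intro b a ha
    rw [_root_.pow_succ] at ha ⊢
    refine Submodule.mul_induction_on ha ?_ ?_
    · intro c hc d hd
      rw [mul_assoc]
      exact Submodule.mul_mem_mul hc (h.right b d hd)
    · intro c d hc hd
      rw [add_mul]
      exact add_mem hc hd

theorem IsTwoSidedSub.pow_le_pow {I : Submodule F R} (h : IsTwoSidedSub I) {m n : ℕ}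
    (hmn : m ≤ n) (hm : 1 ≤ m) : I ^ n ≤ I ^ m := by
  induction n, hmn using Nat.le_induction with
  | base => exact le_rfl
  | succ n hn ih =>
    refine le_trans ?_ ih
    obtain ⟨k, rfl⟩ := Nat.exists_eq_add_of_le' (hm.trans hn)
    rw [_root_.pow_succ I (k + 1), Submodule.mul_le]
    exact fun a ha b _ => (h.pow_succ k).right b a ha

theorem twoSidedIdeal_span_subset {I : Submodule F R} (h : IsTwoSidedSub I) {s : Set R}
    (hs : s ⊆ I) : (TwoSidedIdeal.span s : Set R) ⊆ I := by
  let J : TwoSidedIdeal R := TwoSidedIdeal.mk' (I : Set R) (zero_mem I) (fun ha hb => add_mem ha hb)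
    (fun ha => neg_mem ha) (fun {a b} hb => h.left a b hb) (fun {a b} ha => h.right b a ha)
  have hJ : ∀ a, a ∈ J ↔ a ∈ I := fun a => TwoSidedIdeal.mem_mk' _ _ _ _ _ _ _
  intro a ha
  exact (hJ a).1 (TwoSidedIdeal.span_le.2 (fun b hb => (hJ b).2 (hs hb)) ha)

/-- The units congruent to `1` modulo a two-sided ideal. -/
def congruenceSubgroup {I : Submodule F R} (h : IsTwoSidedSub I) : Subgroup Rˣ where
  carrier := {u | (u : R) - 1 ∈ I}
  mul_mem' := by
    intro u v hu hv
    have : ((u * v : Rˣ) : R) - 1 = ((u : R) - 1) * v + ((v : R) - 1) := by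
      push_cast; noncomm_ring
    rw [Set.mem_ofPred_eq, this]
    exact add_mem (h.right _ _ hu) hv
  one_mem' := by simp
  inv_mem' := by
    intro u hu
    have : ((u⁻¹ : Rˣ) : R) - 1 = -(((u⁻¹ : Rˣ) : R) * ((u : R) - 1)) := by
      rw [mul_sub, Units.inv_mul]; noncomm_ring
    rw [Set.mem_ofPred_eq, this]
    exact neg_mem (h.left _ _ hu)

theorem mem_congruenceSubgroup {I : Submodule F R} {h : IsTwoSidedSub I} {u : Rˣ} :
    u ∈ congruenceSubgroup h ↔ (u : R) - 1 ∈ I := Iff.rfl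

theorem lieSeries_subset_upperLieSeries (S : Set R) (n : ℕ) :
    lieSeries S n ⊆ upperLieSeries S n := by
  induction n using Nat.strong_induction_on with
  | _ n ih =>
    match n with
    | 0 => exact subset_rfl
    | 1 => exact subset_rfl
    | n + 2 =>
      have h1 := ih (n + 1) (by omega)
      rw [lieSeries, upperLieSeries]
      intro a ha
      refine AddSubgroup.closure_induction (p := fun a _ => a ∈ TwoSidedIdeal.span
        {c : R | ∃ a ∈ upperLieSeries S (n + 1), ∃ b ∈ S, c = a * b - b * a}) ?_ (zero_mem _)
        (fun _ _ _ _ => add_mem) (fun _ _ => neg_mem) ha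
      rintro _ ⟨a, ha, b, hb, rfl⟩
      exact TwoSidedIdeal.subset_span ⟨a, h1 ha, b, hb, rfl⟩

/-- This identity is the bridge between group commutators and Lie commutators. -/
theorem commutator_unit_sub_one (u v : Rˣ) :
    ((u⁻¹ * v⁻¹ * u * v : Rˣ) : R) - 1 =
      ((u⁻¹ * v⁻¹ : Rˣ) : R) * ((u : R) * v - v * u) := by
  have : ((u⁻¹ * v⁻¹ : Rˣ) : R) * (v * u) = 1 := by
    rw [← Units.val_mul, ← Units.val_mul, ← mul_inv_rev, inv_mul_cancel, Units.val_one]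
  rw [mul_sub, this]
  push_cast
  noncomm_ring

/-- Modulo the powers of the two-sided ideal `D`, every commutator with an element of `S` agrees
with a commutator with an element of `S ∩ D`. -/
structure IsCentralModulo (S D : Submodule F R) : Prop where
  twoSided : IsTwoSidedSub D
  exists_mem : ∀ s ∈ S, ∃ d ∈ S, d ∈ D ∧ ∀ a, a * s - s * a = a * d - d * a

namespace IsCentralModulo

variable {S D : Submodule F R} (h : IsCentralModulo S D)
include h

theorem commutator_mem {n : ℕ} {a s : R} (ha : a ∈ D ^ n) (hs : s ∈ S) :
    a * s - s * a ∈ D ^ (n + 1) := by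
  obtain ⟨d, -, hd, e⟩ := h.exists_mem s hs
  rw [e]
  refine sub_mem ?_ ?_
  · rw [pow_succ]; exact Submodule.mul_mem_mul ha hd
  · rw [pow_succ']; exact Submodule.mul_mem_mul hd ha

theorem commutator_mem_sq {s t : R} (hs : s ∈ S) (ht : t ∈ S) : s * t - t * s ∈ D ^ 2 := by
  obtain ⟨d, -, hd, e⟩ := h.exists_mem s hs
  have : s * t - t * s = -(t * s - s * t) := by noncomm_ring
  rw [this, e t, neg_sub]
  exact h.commutator_mem (by rwa [pow_one]) ht

/-- The bound starts at level 2, since S itself need not lie in D; a first commutator already gains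
two factors, both entries being replaceable by elements of D. -/
theorem upperLieSeries_subset (n : ℕ) : 
    upperLieSeries (S : Set R) (n + 2) ⊆ (D ^ (n + 2) : Submodule F R) := by
  induction n with
  | zero =>
    refine twoSidedIdeal_span_subset (h.twoSided.pow_succ 1) ?_
    rintro _ ⟨a, ha, b, hb, rfl⟩
    exact h.commutator_mem_sq ha hb
  | succ n ih =>
    refine twoSidedIdeal_span_subset (h.twoSided.pow_succ (n + 2)) ?_
    rintro _ ⟨a, ha, b, hb, rfl⟩
    exact h.commutator_mem (ih ha) hb

theorem lieSub_le (n : ℕ) : lieSub S (n + 2) ≤ D ^ (n + 2) := by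
  rw [← SetLike.coe_subset_coe, ← coe_lieSub]
  exact (lieSeries_subset_upperLieSeries _ _).trans (h.upperLieSeries_subset n)

theorem upperLieSeries_eq_zero {t : ℕ} (ht : 2 ≤ t) (h0 : D ^ t = ⊥) :
    upperLieSeries (S : Set R) t = {0} := by
  obtain ⟨n, rfl⟩ := Nat.exists_eq_add_of_le' ht
  apply Set.Subset.antisymm
  · have := h.upperLieSeries_subset n
    rw [h0] at this
    exact this
  · rintro _ rfl
    exact zero_mem (TwoSidedIdeal.span _)

theorem lieIndex_le_upperLieIndex {t : ℕ} (ht : 2 ≤ t) (h0 : D ^ t = ⊥) :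
    lieIndex (S : Set R) ≤ upperLieIndex (S : Set R) ∧ upperLieIndex (S : Set R) ≤ t := by
  have h1 : t ∈ {n | 1 ≤ n ∧ upperLieSeries (S : Set R) n = {0}} :=
    ⟨by omega, h.upperLieSeries_eq_zero ht h0⟩
  refine ⟨?_, Nat.sInf_le h1⟩
  obtain ⟨h2, h3⟩ : upperLieIndex (S : Set R) ∈ _ := Nat.sInf_mem ⟨t, h1⟩
  refine Nat.sInf_le ⟨h2, ?_⟩
  have := lieSeries_subset_upperLieSeries (S : Set R) (upperLieIndex (S : Set R))
  rw [h3] at this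
  refine this.antisymm ?_
  rintro _ rfl
  rw [coe_lieSub]
  exact zero_mem _

theorem groupSeries_subset {H : Set Rˣ} (hH : ∀ u ∈ H, (u : R) ∈ S) (n : ℕ) :
    groupSeries H (n + 2) ⊆ congruenceSubgroup (h.twoSided.pow_succ (n + 1)) := by
  induction n with
  | zero =>
    rw [groupSeries, SetLike.coe_subset_coe, Subgroup.closure_le]
    rintro _ ⟨u, hu, v, hv, rfl⟩
    rw [SetLike.mem_coe, mem_congruenceSubgroup, commutator_unit_sub_one]
    exact (h.twoSided.pow_succ 1).left _ _ (h.commutator_mem_sq (hH u hu) (hH v hv))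
  | succ n ih =>
    rw [groupSeries, SetLike.coe_subset_coe, Subgroup.closure_le]
    rintro _ ⟨u, hu, v, hv, rfl⟩
    rw [SetLike.mem_coe, mem_congruenceSubgroup, commutator_unit_sub_one]
    refine (h.twoSided.pow_succ (n + 2)).left _ _ ?_
    have h1 : (u : R) - 1 ∈ D ^ (n + 1 + 1) := ih hu
    have := h.commutator_mem h1 (hH v hv)
    convert this using 1
    noncomm_ring

theorem groupSeries_eq_one {H : Set Rˣ} (hH : ∀ u ∈ H, (u : R) ∈ S) {t : ℕ} (ht : 2 ≤ t)
    (h0 : D ^ t = ⊥) : groupSeries H t = {1} := by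
  obtain ⟨n, rfl⟩ := Nat.exists_eq_add_of_le' ht
  apply Set.Subset.antisymm
  · intro u hu
    have h1 : (u : R) - 1 ∈ D ^ (n + 2) := h.groupSeries_subset hH n hu
    rw [h0, Submodule.mem_bot, sub_eq_zero] at h1
    exact Units.ext h1
  · rintro _ rfl
    exact one_mem (Subgroup.closure _)

end IsCentralModulo

theorem groupSeries_eq_one_of_le {U : Type*} [Group U] {H : Set U} {m n : ℕ} (hm : 1 ≤ m)
    (hmn : m ≤ n) (h : groupSeries H m = {1}) : groupSeries H n = {1} := by
  induction n, hmn using Nat.le_induction with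
  | base => exact h
  | succ n hn ih =>
    obtain ⟨k, rfl⟩ := Nat.exists_eq_add_of_le' (hm.trans hn)
    apply Set.Subset.antisymm
    · rw [groupSeries, ← Subgroup.coe_bot, SetLike.coe_subset_coe, Subgroup.closure_le]
      rintro _ ⟨u, hu, v, hv, rfl⟩
      rw [ih, Set.mem_singleton_iff] at hu
      simp [hu]
    · rintro _ rfl
      exact one_mem (Subgroup.closure _)

/-! ### Approximation of Lie commutators by group commutators -/

namespace IsCentralModulo

variable {S D : Submodule F R} (h : IsCentralModulo S D)
include h

/-- Sums correspond to products: the cross term (u₁ - 1)(u₂ - 1) lies in D^(2k+4), which is below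
the required precision. -/
theorem approx_of_generators {H : Set Rˣ} (hH : ∀ u ∈ H, (u : R) ∈ S) (k : ℕ)
    (hg : ∀ r : F, ∀ a ∈ lieSub S (k + 1), ∀ b ∈ S, ∃ u ∈ groupSeries H (k + 2),
      (u : R) - 1 - r • (a * b - b * a) ∈ D ^ (k + 3)) {w : R} (hw : w ∈ lieSub S (k + 2)) :
    ∃ u ∈ groupSeries H (k + 2), (u : R) - 1 - w ∈ D ^ (k + 3) := by
  refine Submodule.closure_induction
    (p := fun w _ => ∃ u ∈ groupSeries H (k + 2), (u : R) - 1 - w ∈ D ^ (k + 3)) ?_ ?_ ?_ hw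
  · exact ⟨1, one_mem (Subgroup.closure _), by simp⟩
  · rintro w₁ w₂ - - ⟨u₁, h1, h1'⟩ ⟨u₂, h2, h2'⟩
    refine ⟨u₁ * u₂, mul_mem (S := Subgroup Rˣ) (s := Subgroup.closure _) h1 h2, ?_⟩
    have e : ((u₁ * u₂ : Rˣ) : R) - 1 - (w₁ + w₂) = ((u₁ : R) - 1 - w₁) + ((u₂ : R) - 1 - w₂) +
        ((u₁ : R) - 1) * ((u₂ : R) - 1) := by
      push_cast; noncomm_ring
    rw [e]
    refine add_mem (add_mem h1' h2') ?_
    have h3 : (u₁ : R) - 1 ∈ D ^ (k + 2) := h.groupSeries_subset hH k h1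
    have h4 : (u₂ : R) - 1 ∈ D ^ (k + 2) := h.groupSeries_subset hH k h2
    have h5 := Submodule.mul_mem_mul h3 h4
    rw [← pow_add] at h5
    exact h.twoSided.pow_le_pow (by omega) (by omega) h5
  · rintro r _ ⟨a, ha, b, hb, rfl⟩
    exact hg r a ha b hb

/-- Group commutators of symmetric units approximate Lie commutators. -/
theorem exists_groupSeries_approx {H : Set Rˣ}
    (hS : ∀ s ∈ S, s ∈ D → ∃ u ∈ H, (u : R) = 1 + s) {n k : ℕ} {a s : R}
    (hk : k = n + 1)
    (ha : a ∈ D ^ k) (hu : ∃ u ∈ groupSeries H k, (u : R) - 1 - a ∈ D ^ (k + 1))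
    (hs : s ∈ S) :
    ∃ u ∈ groupSeries H (k + 1), (u : R) - 1 - (a * s - s * a) ∈ D ^ (k + 2) := by
  obtain ⟨d, hdS, hdD, e⟩ := h.exists_mem s hs
  obtain ⟨u, huH, hu'⟩ := hu
  obtain ⟨v, hvH, hv⟩ := hS d hdS hdD
  subst hk
  refine ⟨u⁻¹ * v⁻¹ * u * v, Subgroup.subset_closure ⟨u, huH, v, hvH, rfl⟩, ?_⟩
  rw [e, commutator_unit_sub_one]
  have hu1 : (u : R) - 1 ∈ D ^ (n + 1) := by
    have := add_mem (h.twoSided.pow_le_pow (by omega : n + 1 ≤ n + 1 + 1) (by omega) hu') ha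
    simpa using this
  have hD : (u : R) - 1 ∈ D := by
    simpa using h.twoSided.pow_le_pow (by omega : 1 ≤ n + 1) le_rfl hu1
  have hw : ((u⁻¹ * v⁻¹ : Rˣ) : R) - 1 ∈ D :=
    mul_mem (inv_mem (show u ∈ congruenceSubgroup h.twoSided from hD))
      (inv_mem (show v ∈ congruenceSubgroup h.twoSided by
        change (v : R) - 1 ∈ D
        rw [hv]; simpa using hdD))
  set w := ((u⁻¹ * v⁻¹ : Rˣ) : R)
  -- The first summand is the error from the unit u⁻¹v⁻¹ ≡ 1 (mod D), the second the error of u - 1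
  -- against a; each gains one power of D.
  have e1 : w * (u * v - v * u) - (a * d - d * a) =
      (w - 1) * (u * v - v * u) + (((u : R) - 1 - a) * d - d * ((u : R) - 1 - a)) := by
    rw [hv]; noncomm_ring
  rw [e1]
  refine add_mem ?_ (h.commutator_mem hu' hdS)
  have e2 : (u : R) * v - v * u = ((u : R) - 1) * d - d * ((u : R) - 1) := by
    rw [hv]; noncomm_ring
  rw [pow_succ', e2]
  exact Submodule.mul_mem_mul hw (h.commutator_mem hu1 hdS)

theorem exists_groupSeries_of_mem_lieSub {H : Set Rˣ} (hH : ∀ u ∈ H, (u : R) ∈ S)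
    (hS : ∀ s ∈ S, s ∈ D → ∃ u ∈ H, (u : R) = 1 + s) (k : ℕ) {w : R} (hw : w ∈ lieSub S (k + 2)) :
    ∃ u ∈ groupSeries H (k + 2), (u : R) - 1 - w ∈ D ^ (k + 3) := by
  induction k generalizing w with
  | zero =>
    refine h.approx_of_generators hH 0 ?_ hw
    intro r a ha b hb
    obtain ⟨d, hdS, hdD, e⟩ := h.exists_mem a ha
    -- The scalar must enter before the unit is chosen, because the group series has no scalar
    -- action.
    have e1 : r • (a * b - b * a) = (r • d) * b - b * (r • d) := by
      rw [← neg_sub, e b, neg_sub, smul_sub, smul_mul_assoc, mul_smul_comm]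
    rw [e1]
    have hd' : r • d ∈ D := D.smul_mem r hdD
    obtain ⟨u, huH, hu⟩ := hS _ (S.smul_mem r hdS) hd'
    exact h.exists_groupSeries_approx hS rfl (by rwa [pow_one])
      ⟨u, huH, by rw [hu]; simp⟩ hb
  | succ k ih =>
    refine h.approx_of_generators hH (k + 1) ?_ hw
    intro r a ha b hb
    have e1 : r • (a * b - b * a) = (r • a) * b - b * (r • a) := by
      rw [smul_sub, smul_mul_assoc, mul_smul_comm]
    rw [e1]
    have ha' := Submodule.smul_mem _ r ha
    exact h.exists_groupSeries_approx hS rfl (h.lieSub_le k ha') (ih ha') hb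

/-- If the class were smaller, γ_(t-1)(H) would be trivial; then every w ∈ γ^(t-1)(S), being
approximated by the unit 1 modulo Dᵗ = 0, would vanish. -/
theorem le_nilClass_add_one {H : Set Rˣ} (hH : ∀ u ∈ H, (u : R) ∈ S)
    (hS : ∀ s ∈ S, s ∈ D → ∃ u ∈ H, (u : R) = 1 + s) {t : ℕ} (ht : 3 ≤ t) (h0 : D ^ t = ⊥)
    (hne : lieSub S (t - 1) ≠ ⊥) : t ≤ nilClass H + 1 := by
  obtain ⟨k, rfl⟩ := Nat.exists_eq_add_of_le' ht
  by_contra! hlt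
  have h1 : nilClass H ∈ {n | groupSeries H (n + 1) = {1}} :=
    Nat.sInf_mem ⟨k + 2, h.groupSeries_eq_one hH (by omega) h0⟩
  have h2 := groupSeries_eq_one_of_le (by omega) (by omega : nilClass H + 1 ≤ k + 2) h1
  apply hne
  rw [Submodule.eq_bot_iff]
  intro w hw
  obtain ⟨u, hu, hu'⟩ := h.exists_groupSeries_of_mem_lieSub hH hS k hw
  rw [h2, Set.mem_singleton_iff] at hu
  rw [h0, Submodule.mem_bot, hu] at hu'
  simpa using hu'

end IsCentralModulo

end TwoSided

/-! ### Symmetric elements modulo the centre -/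

theorem isTwoSidedSub_mul_top {F R : Type*} [Field F] [Ring R] [Algebra F R] {K : Submodule F R}
    (h : ⊤ * K ≤ K * ⊤) : IsTwoSidedSub (K * ⊤) :=
  ⟨fun b _ ha => mul_mem_mul_top_left h b ha, fun b _ ha => mul_mem_mul_top_right b ha⟩

namespace IsQuaternionExtension

variable {F G : Type*} [Field F] [Group G] {σ : G →* ℤˣ} {x y z : G} {P : Subgroup G}
  (X : IsQuaternionExtension σ x y z P)
include X

theorem commute_of_mem {k : G} (hk : k ∈ ({1, x, y, x * y} : Set G)) {r : G} (hr : r ∈ P) :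
    Commute k r := by
  obtain ⟨hx, hy, -⟩ := mem_evenCentralizer.1 (X.le hr)
  rcases hk with rfl | rfl | rfl | rfl
  · exact Commute.one_left _
  · exact hx.symm
  · exact hy.symm
  · exact (hx.mul_right hy).symm

theorem map_eq_one_of_mem {r : G} (hr : r ∈ P) : σ r = 1 := (mem_evenCentralizer.1 (X.le hr)).2.2

theorem map_quaternion {k : G} (hk : k ∈ ({1, x, y, x * y} : Set G)) : σ k = 1 := by
  rcases hk with rfl | rfl | rfl | rfl <;> simp [X.map_x, X.map_y]

theorem commute_mod {k : G} (hk : k ∈ ({1, x, y, x * y} : Set G)) (h : G) :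
    h * k = k * h ∨ h * k = k * h * z := by
  have zc := X.z_comm
  rcases hk with rfl | rfl | rfl | rfl
  · simp
  · exact X.x_comm h
  · exact X.y_comm h
  · have swapz : ∀ a b : G, a * z * b = a * b * z := fun a b => by
      rw [mul_assoc, zc, mul_assoc]
    rcases X.x_comm h with hx | hx <;> rcases X.y_comm h with hy | hy
    · left; rw [← mul_assoc, hx, mul_assoc, hy, mul_assoc]
    · right; rw [← mul_assoc, hx, mul_assoc, hy]; simp only [mul_assoc]
    · right; rw [← mul_assoc, hx, swapz, mul_assoc x h, hy]; simp only [mul_assoc]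
    · left; rw [← mul_assoc, hx, swapz, mul_assoc x h, hy, mul_assoc x, mul_assoc (y * h), X.zz,
        mul_one, mul_assoc]

theorem conj_mem {r : G} (hr : r ∈ P) (g : G) : g * r * g⁻¹ ∈ P := by
  obtain ⟨k, hk, c, r', hr', rfl, hc, -⟩ := X.decomp g
  have e : k * c * r' * r * (k * c * r')⁻¹ = r' * r * r'⁻¹ := by
    have h1 : Commute (k * c) (r' * r * r'⁻¹) :=
      (X.commute_of_mem hk (mul_mem (mul_mem hr' hr) (inv_mem hr'))).mul_left (hc _)
    calc _ = (k * c) * (r' * r * r'⁻¹) * (k * c)⁻¹ := by group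
      _ = _ := by rw [h1.eq, mul_inv_cancel_right]
  rw [e]
  exact mul_mem (mul_mem hr' hr) (inv_mem hr')

theorem top_mul_delta : ⊤ * delta F P ≤ delta F P * ⊤ := by
  apply top_mul_le_of_conj
  intro g a ha
  have : delta F P ≤ (delta F P).comap
      (LinearMap.mulRight F (of F G g⁻¹) ∘ₗ LinearMap.mulLeft F (of F G g)) := by
    conv_lhs => rw [delta]
    rw [Submodule.span_le]
    rintro _ ⟨r, hr, rfl⟩
    refine Submodule.subset_span ⟨g * r * g⁻¹, X.conj_mem hr g, ?_⟩
    simp only [LinearMap.comp_apply, LinearMap.mulLeft_apply, LinearMap.mulRight_apply, mul_sub,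
      sub_mul, mul_one, ← map_mul, mul_inv_cancel, map_one]
  exact this ha

/-- The symmetric element attached to an element of `{1, x, y, xy}` times a central element is
central. -/
theorem sy_central {k c : G} (hk : k ∈ ({1, x, y, x * y} : Set G)) (hc : ∀ g, Commute c g)
    (hcc : (σ c = 1 ∧ c * c = 1) ∨ (σ c = -1 ∧ c * c = z)) (a : MonoidAlgebra F G) :
    Commute (sy F σ (k * c)) a := by
  have zc := X.z_comm
  have hcom : ∀ {u : G}, (∀ g, Commute u g) → ∀ a : MonoidAlgebra F G, Commute (of F G u) a :=
    fun hu a => of_comm hu a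
  have hsq : k = 1 ∨ k * k = z := by
    rcases hk with rfl | rfl | rfl | rfl
    · exact Or.inl rfl
    · exact Or.inr X.xx
    · exact Or.inr X.yy
    · exact Or.inr X.xy_mul_xy
  rcases hsq with rfl | hkk
  · rw [one_mul, sy]
    exact (hcom hc a).add_left ((hcom (fun g => (hc g).inv_left) a).smul_left _)
  · have hww : k * c * (k * c) = z * (c * c) := by
      rw [mul_assoc, ← mul_assoc c, (hc k).eq, ← mul_assoc, ← mul_assoc, hkk, mul_assoc]
    -- If σ(c) = 1 the element is kc(1 + z), unchanged when conjugation multiplies k by z. If σ(c) =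
    -- -1, then (kc)² = 1 and the element is zero.
    rcases hcc with ⟨h1, h2⟩ | ⟨h1, h2⟩
    · have hinv : (k * c)⁻¹ = k * c * z := by
        rw [inv_eq_iff_mul_eq_one, ← mul_assoc, hww, h2, mul_one, X.zz]
      rw [sy, hinv, sgn_of_eq_one (by rw [map_mul, h1, X.map_quaternion hk, one_mul]), one_smul]
      induction a using MonoidAlgebra.induction_on with
      | of g =>
        have h3 : g * (k * c) = k * c * g ∨ g * (k * c) = k * c * z * g := by
          rw [← mul_assoc]
          rcases X.commute_mod hk g with h | h
          · left; rw [h, mul_assoc, ← (hc g).eq, mul_assoc]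
          · right
            rw [h, mul_assoc, zc, ← mul_assoc, mul_assoc k g, ← (hc g).eq, mul_assoc (k * c) z g,
              zc]
            simp only [mul_assoc]
        have h4 : ∀ b : G, b * z * z = b := fun b => by rw [mul_assoc, X.zz, mul_one]
        rw [commute_iff_eq, add_mul, mul_add]
        simp only [← map_mul]
        rw [← mul_assoc g (k * c) z]
        rcases h3 with h | h
        · rw [h, mul_assoc _ z, zc, mul_assoc _ g]
        · rw [h, mul_assoc _ g z, ← zc g, ← mul_assoc (k * c * z) z g, h4, add_comm]
      | add a b ha hb => exact ha.add_right hb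
      | smul r a ha => exact ha.smul_right r
    · have hinv : (k * c)⁻¹ = k * c := by
        rw [inv_eq_iff_mul_eq_one, hww, h2, X.zz]
      rw [sy, hinv, sgn_of_eq_neg_one (by rw [map_mul, h1, X.map_quaternion hk, one_mul]),
        neg_one_smul, add_neg_cancel]
      exact Commute.zero_left _

/-- For h = kcr the symmetric element of h differs from that of kc, which is central, by an element
of Δ(P)FG. -/
theorem isCentralModulo (h2 : (2 : F) ≠ 0) :
    IsCentralModulo (symmSub F σ) (delta F P * ⊤) := by
  have hD := isTwoSidedSub_mul_top (X.top_mul_delta (F := F))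
  refine ⟨hD, fun s hs => ?_⟩
  rw [symmSub_eq_span h2] at hs
  refine Submodule.span_induction (p := fun s _ => ∃ d ∈ symmSub F σ, d ∈ delta F P * ⊤ ∧
    ∀ a, a * s - s * a = a * d - d * a) ?_ ?_ ?_ ?_ hs
  · rintro _ ⟨h, rfl⟩
    obtain ⟨k, hk, c, r, hr, rfl, hc, hcc⟩ := X.decomp h
    refine ⟨sy F σ (k * c * r) - sy F σ (k * c), sub_mem (sy_mem _ _) (sy_mem _ _), ?_, ?_⟩
    · have hcom : Commute (k * c) r := (X.commute_of_mem hk hr).mul_left (hc r)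
      have hmem : ∀ r ∈ P, of F G r - 1 ∈ delta F P * ⊤ := by
        intro r hr
        rw [← mul_one (of F G r - 1)]
        exact Submodule.mul_mem_mul (Submodule.subset_span ⟨r, hr, rfl⟩) Submodule.mem_top
      have e : sy F σ (k * c * r) - sy F σ (k * c) = of F G (k * c) * (of F G r - 1) +
          sgn F σ (k * c) • (of F G (k * c)⁻¹ * (of F G r⁻¹ - 1)) := by
        have hinv : (k * c * r)⁻¹ = (k * c)⁻¹ * r⁻¹ := by
          rw [mul_inv_rev, hcom.inv_inv.eq]
        rw [sy, sy, hinv, sgn_mul σ (k * c) r, sgn_of_eq_one (X.map_eq_one_of_mem hr), mul_one,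
          map_mul _ (k * c) r, map_mul _ (k * c)⁻¹, mul_sub, mul_sub, smul_sub, mul_one, mul_one]
        abel
      rw [e]
      exact add_mem (hD.left _ _ (hmem r hr))
        (Submodule.smul_mem _ _ (hD.left _ _ (hmem _ (inv_mem hr))))
    · intro a
      have := (X.sy_central (F := F) hk hc hcc a).eq
      rw [mul_sub, sub_mul, this]
      abel
  · exact ⟨0, zero_mem _, zero_mem _, by simp⟩
  · rintro s t - - ⟨d, h1, h3, h4⟩ ⟨e, h5, h6, h7⟩
    refine ⟨d + e, add_mem h1 h5, add_mem h3 h6, fun a => ?_⟩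
    rw [mul_add, add_mul, add_sub_add_comm, h4, h7, mul_add, add_mul, add_sub_add_comm]
  · rintro r s - ⟨d, h1, h3, h4⟩
    refine ⟨r • d, Submodule.smul_mem _ _ h1, Submodule.smul_mem _ _ h3, fun a => ?_⟩
    simp only [mul_smul_comm, smul_mul_assoc, ← smul_sub, h4]

theorem deltaIdeal_pow_eq_bot {n : ℕ} (h : delta F P ^ (n + 1) = ⊥) :
    (delta F P * ⊤) ^ (n + 1) = ⊥ := by
  have h1 := mul_top_pow_le (X.top_mul_delta (F := F)) n
  rw [h, Submodule.bot_mul] at h1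
  exact le_bot_iff.1 h1

end IsQuaternionExtension

theorem symmUnits_subset {F G : Type*} [Field F] [Group G] {σ : G →* ℤˣ} :
    ∀ u ∈ symmUnits F σ, (u : MonoidAlgebra F G) ∈ symmSub F σ := by
  intro u hu
  rw [← SetLike.mem_coe, coe_symmSub]
  exact hu

theorem one_mem_symmSub {F G : Type*} [Field F] [Group G] (σ : G →* ℤˣ) :
    (1 : MonoidAlgebra F G) ∈ symmSub F σ := by
  rw [mem_symmSub, ← map_one (of F G), starLin_of, inv_one, sgn_of_eq_one (map_one σ), one_smul]

theorem exists_symmUnit {F G : Type*} [Field F] [Group G] {σ : G →* ℤˣ}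
    {D : Submodule F (MonoidAlgebra F G)} {t : ℕ} (h0 : D ^ t = ⊥) :
    ∀ s ∈ symmSub F σ, s ∈ D → ∃ u ∈ symmUnits F σ, (u : MonoidAlgebra F G) = 1 + s := by
  intro s hs hsD
  have hn : IsNilpotent s := by
    refine ⟨t, ?_⟩
    have := Submodule.pow_mem_pow D hsD t
    rwa [h0, Submodule.mem_bot] at this
  obtain ⟨u, hu⟩ := hn.isUnit_one_add
  refine ⟨u, ?_, hu⟩
  change (u : MonoidAlgebra F G) ∈ symm F σ
  rw [hu, ← coe_symmSub]
  exact add_mem (one_mem_symmSub σ) hs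

/-! ### Lower bounds for the Lie nilpotency index -/

theorem dif_mem_groupSpan {F G : Type*} [Field F] [Group G] {P : Subgroup G} {c : G} (hc : c ∈ P) :
    dif F c ∈ groupSpan F P :=
  sub_mem (Submodule.subset_span ⟨c, hc, rfl⟩) (Submodule.subset_span ⟨_, inv_mem hc, rfl⟩)

theorem groupSpan_mul_mem {F G : Type*} [Field F] [Group G] {P : Subgroup G}
    {a b : MonoidAlgebra F G} (ha : a ∈ groupSpan F P) (hb : b ∈ groupSpan F P) :
    a * b ∈ groupSpan F P := by
  have : groupSpan F P * groupSpan F P ≤ groupSpan F P := by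
    rw [groupSpan, Submodule.span_mul_span]
    refine Submodule.span_mono ?_
    rintro _ ⟨_, ⟨g, hg, rfl⟩, _, ⟨h, hh, rfl⟩, rfl⟩
    exact ⟨g * h, mul_mem hg hh, map_mul _ _ _⟩
  exact this (Submodule.mul_mem_mul ha hb)

theorem coeff_of_mul {F G : Type*} [Field F] [Group G] (g h : G) (a : MonoidAlgebra F G) :
    (of F G g * a).coeff h = a.coeff (g⁻¹ * h) := by
  rw [of_apply, coeff_single_mul_apply, one_mul]

/-! ### Multiples of the sum over a subgroup -/

section Invariant

variable {F G : Type*} [Field F] [Group G]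

/-- `v` is supported on `W` and fixed by left multiplication by elements of `W`. -/
structure IsInvariantElement (W : Subgroup G) (v : MonoidAlgebra F G) : Prop where
  mem : v ∈ groupSpan F W
  fixed : ∀ h ∈ W, of F G h * v = v

/-- Left invariance makes the coefficients constant on W, so the coefficient at 1 determines the
element. -/
theorem IsInvariantElement.ext {W : Subgroup G} {v w : MonoidAlgebra F G}
    (hv : IsInvariantElement W v) (hw : IsInvariantElement W w) (h1 : v.coeff 1 = w.coeff 1) :
    v = w := by
  have key : ∀ {u : MonoidAlgebra F G}, IsInvariantElement W u → ∀ g ∈ W,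
      u.coeff g = u.coeff 1 := by
    intro u hu g hg
    conv_lhs => rw [← hu.fixed g hg, coeff_of_mul, inv_mul_cancel]
  ext g
  by_cases hg : g ∈ W
  · rw [key hv g hg, key hw g hg, h1]
  · rw [coeff_eq_zero_of_mem_groupSpan hv.mem hg, coeff_eq_zero_of_mem_groupSpan hw.mem hg]

theorem IsInvariantElement.commute {W : Subgroup G} {v : MonoidAlgebra F G}
    (hv : IsInvariantElement W v) {c : G} (hc : ∀ h ∈ W, c * h * c⁻¹ ∈ W)
    (hc' : ∀ h ∈ W, c⁻¹ * h * c ∈ W) : Commute (of F G c) v := by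
  have hconj : IsInvariantElement W (of F G c * v * of F G c⁻¹) := by
    constructor
    · have : groupSpan F W ≤ (groupSpan F W).comap
          (LinearMap.mulRight F (of F G c⁻¹) ∘ₗ LinearMap.mulLeft F (of F G c)) := by
        conv_lhs => rw [groupSpan]
        rw [Submodule.span_le]
        rintro _ ⟨h, hh, rfl⟩
        exact Submodule.subset_span ⟨_, hc h hh, by simp only [map_mul]; rfl⟩
      exact this hv.mem
    · intro h hh
      have e : of F G h * of F G c = of F G c * of F G (c⁻¹ * h * c) := by
        rw [← map_mul, ← map_mul]; congr 1; group
      rw [← mul_assoc, ← mul_assoc, e, mul_assoc (of F G c), hv.fixed _ (hc' h hh)]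
  have hcoeff : (of F G c * v * of F G c⁻¹).coeff 1 = v.coeff 1 := by
    rw [mul_assoc, coeff_of_mul, of_apply, coeff_mul_single_apply, mul_one, mul_one, inv_inv,
      inv_mul_cancel]
  have := hconj.ext hv hcoeff
  rw [commute_iff_eq]
  conv_rhs => rw [← this, mul_assoc, ← map_mul, inv_mul_cancel, map_one, mul_one]

end Invariant

section Chain

variable {G : Type*} [Group G] {p : ℕ} [Fact p.Prime]

/-- A subgroup of index p in a finite p-group is normal, and it is maximal. -/
theorem exists_generator_of_card {W K : Subgroup G} {i : ℕ} (hWK : W ≤ K)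
    (hW : Nat.card W = p ^ i) (hK : Nat.card K = p ^ (i + 1)) :
    ∃ c ∈ K, c ∉ W ∧ c ^ p ∈ W ∧ (∀ h ∈ W, c * h * c⁻¹ ∈ W) ∧ (∀ h ∈ W, c⁻¹ * h * c ∈ W) ∧
      ∀ T : Subgroup G, W ≤ T → c ∈ T → K ≤ T := by
  have hp := (Fact.out : p.Prime)
  have hKfin : Finite K := Nat.finite_of_card_ne_zero (by rw [hK]; exact pow_ne_zero _ hp.ne_zero)
  have hindex : (W.subgroupOf K).index = p := by
    have h1 := (W.subgroupOf K).card_mul_index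
    have h2 : Nat.card (W.subgroupOf K) = Nat.card W :=
      Nat.card_congr (Subgroup.subgroupOfEquivOfLe hWK).toEquiv
    rw [h2, hW, hK, pow_succ] at h1
    exact Nat.eq_of_mul_eq_mul_left (pow_pos hp.pos i) h1
  have hnormal : (W.subgroupOf K).Normal := by
    apply Subgroup.normal_of_index_eq_minFac_card
    rw [hindex, hK, hp.pow_minFac (by omega)]
  have hne : ∃ c ∈ K, c ∉ W := by
    by_contra! hcon
    have : W = K := le_antisymm hWK hcon
    rw [this, hK] at hW
    exact absurd (Nat.pow_right_injective hp.two_le hW) (by omega)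
  obtain ⟨c, hcK, hcW⟩ := hne
  refine ⟨c, hcK, hcW, ?_, ?_, ?_, ?_⟩
  · have := (W.subgroupOf K).pow_index_mem ⟨c, hcK⟩
    rw [hindex] at this
    exact this
  · intro h hh
    exact hnormal.conj_mem ⟨h, hWK hh⟩ hh ⟨c, hcK⟩
  · intro h hh
    have h1 : c⁻¹ * h * c⁻¹⁻¹ ∈ W := hnormal.conj_mem ⟨h, hWK hh⟩ hh ⟨c⁻¹, inv_mem hcK⟩
    rwa [inv_inv] at h1
  · intro T hWT hcT
    have hdvd : Nat.card (T ⊓ K : Subgroup G) ∣ p ^ (i + 1) := by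
      rw [← hK]
      exact Subgroup.card_dvd_of_le inf_le_right
    obtain ⟨j, hj, hcard⟩ := (Nat.dvd_prime_pow hp).1 hdvd
    have hfin : Finite (T ⊓ K : Subgroup G) :=
      Nat.finite_of_card_ne_zero (by rw [hcard]; exact pow_ne_zero _ hp.ne_zero)
    have hij : ¬ j ≤ i := by
      intro hji
      have : W = T ⊓ K := Subgroup.eq_of_le_of_card_ge (le_inf hWT hWK) (by
        rw [hcard, hW]; exact Nat.pow_le_pow_right hp.pos hji)
      exact hcW (this ▸ Subgroup.mem_inf.2 ⟨hcT, hcK⟩)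
    have : T ⊓ K = K := Subgroup.eq_of_le_of_card_ge inf_le_right (by
      rw [hcard, hK]; exact Nat.pow_le_pow_right hp.pos (by omega))
    exact inf_eq_right.1 this

variable {F : Type*} [Field F] [CharP F p]

/-- Up to a power of c, multiplying by (c - c⁻¹)^(p-1) means multiplying by (c² - 1)^(p-1). One more
factor c² - 1 gives (c^(2p) - 1)v = 0, so the result is fixed by c²; it is also fixed by W, hence by
c as p is odd and c^p ∈ W. -/
theorem IsInvariantElement.mul_dif_pow (hp : 2 < p) {W K : Subgroup G} {i : ℕ} (hWK : W ≤ K)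
    (hW : Nat.card W = p ^ i) (hK : Nat.card K = p ^ (i + 1)) {v : MonoidAlgebra F G}
    (hv : IsInvariantElement W v) (h1 : v.coeff 1 ≠ 0) :
    ∃ c ∈ K, Commute (dif F c) v ∧ IsInvariantElement K (v * dif F c ^ (p - 1)) ∧
      (v * dif F c ^ (p - 1)).coeff 1 ≠ 0 := by
  obtain ⟨c, hcK, hcW, hcp, hc, hc', hT⟩ := exists_generator_of_card hWK hW hK
  have hprime := (Fact.out : p.Prime)
  have hodd : Odd p := hprime.odd_of_ne_two (by omega)
  have : CharP (MonoidAlgebra F G) p := charP_of_injective_algebraMap' F p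
  have hcv : Commute (of F G c) v := hv.commute hc hc'
  have hcv' : Commute (of F G c⁻¹) v := hv.commute (c := c⁻¹) (by simpa using hc')
    (by simpa using hc)
  have hcom : Commute (dif F c) v := hcv.sub_left hcv'
  have e1 : dif F c = of F G c⁻¹ * (of F G (c * c) - 1) := by
    rw [mul_sub, ← map_mul, mul_one, dif]; congr 2; group
  have hc1 : Commute (of F G c⁻¹) (of F G (c * c) - 1) := by
    refine Commute.sub_right ?_ (Commute.one_right _)
    exact (show Commute c⁻¹ (c * c) from (Commute.refl c).inv_left.mul_right
      (Commute.refl c).inv_left).map (of F G)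
  set w := (of F G (c * c) - 1) ^ (p - 1) * v with hw
  have e2 : v * dif F c ^ (p - 1) = of F G (c⁻¹ ^ (p - 1)) * w := by
    rw [← (hcom.pow_left (p - 1)).eq, e1, hc1.mul_pow, map_pow, mul_assoc]
  have hccv : Commute (of F G (c * c)) v := by
    rw [map_mul]; exact hcv.mul_left hcv
  have hwfix : of F G (c * c) * w = w := by
    have h2 : (of F G (c * c) - 1) * w = 0 := by
      rw [hw, ← mul_assoc, ← pow_succ', Nat.sub_add_cancel hprime.one_le]
      have := sub_pow_char_pow_of_commute p 1 (Commute.one_right (of F G (c * c)))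
      rw [pow_one] at this
      rw [this, one_pow, ← map_pow, sub_mul, one_mul, sub_eq_zero]
      apply hv.fixed
      rw [(Commute.refl c).mul_pow]
      exact mul_mem hcp hcp
    rwa [sub_mul, one_mul, sub_eq_zero] at h2
  let T : Subgroup G :=
    { carrier := {g | of F G g * (v * dif F c ^ (p - 1)) = v * dif F c ^ (p - 1)}
      mul_mem' := by
        intro a b ha hb
        change of F G (a * b) * _ = _
        rw [map_mul, mul_assoc, hb, ha]
      one_mem' := by
        change of F G 1 * _ = _
        rw [map_one, one_mul]
      inv_mem' := by
        intro a ha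
        change of F G a⁻¹ * _ = _
        conv_lhs => rw [← (show of F G a * (v * dif F c ^ (p - 1)) = _ from ha), ← mul_assoc,
          ← map_mul, inv_mul_cancel, map_one, one_mul] }
  have hWT : W ≤ T := by
    intro h hh
    change of F G h * _ = _
    rw [← mul_assoc, hv.fixed h hh]
  have hccT : c * c ∈ T := by
    change of F G (c * c) * _ = _
    have e3 : c * c * c⁻¹ ^ (p - 1) = c⁻¹ ^ (p - 1) * (c * c) :=
      ((Commute.refl c).inv_right.mul_left (Commute.refl c).inv_right).pow_right _
    rw [e2, ← mul_assoc, ← map_mul, e3, map_mul, mul_assoc, hwfix]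
  have hcT : c ∈ T := by
    obtain ⟨k, hk⟩ := hodd
    have h2 := hWT hcp
    rw [hk, pow_succ, pow_mul, pow_two] at h2
    exact (Subgroup.mul_mem_cancel_left T (pow_mem hccT k)).1 h2
  have hKT := hT T hWT hcT
  have hinv : IsInvariantElement K (v * dif F c ^ (p - 1)) := by
    refine ⟨?_, fun h hh => hKT hh⟩
    have hpow : ∀ n, dif F c ^ n ∈ groupSpan F K := by
      intro n
      induction n with
      | zero =>
        rw [pow_zero, ← map_one (of F G)]
        exact Submodule.subset_span ⟨1, one_mem K, rfl⟩
      | succ n ih => rw [pow_succ]; exact groupSpan_mul_mem ih (dif_mem_groupSpan hcK)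
    refine groupSpan_mul_mem ?_ (hpow _)
    exact Submodule.span_mono (Set.image_mono hWK) hv.mem
  refine ⟨c, hcK, hcom, hinv, ?_⟩
  have hw1 : v * dif F c ^ (p - 1) = w := by
    have h2 : c ^ (p - 1) ∈ T := pow_mem hcT _
    rw [← (show of F G (c ^ (p - 1)) * _ = _ from h2), e2, ← mul_assoc, ← map_mul, inv_pow,
      mul_inv_cancel, map_one, one_mul]
  -- In the binomial expansion only the constant term meets W: the translates of v by (c²)^j with 0
  -- < j < p are supported on other cosets.
  rw [hw1, hw, sub_eq_add_neg, (Commute.one_right (of F G (c * c))).neg_right.add_pow,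
    Finset.sum_mul, coeff_sum, Finset.sum_apply', Finset.sum_eq_single 0]
  · simp only [pow_zero, one_mul, Nat.choose_zero_right, Nat.cast_one, mul_one, Nat.sub_zero]
    have heven : Even (p - 1) := by
      obtain ⟨k, hk⟩ := hodd
      exact ⟨k, by omega⟩
    rw [heven.neg_one_pow, one_mul]
    exact h1
  · intro j hj hj0
    rw [Finset.mem_range] at hj
    have hmem : (c * c) ^ j ∉ W := by
      intro hmem
      have hcop : Nat.Coprime (2 * j) p := by
        rw [Nat.coprime_comm, hprime.coprime_iff_not_dvd, hprime.dvd_mul]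
        rintro (h | h)
        · exact absurd (Nat.le_of_dvd (by norm_num) h) (by omega)
        · exact absurd (Nat.le_of_dvd (by omega) h) (by omega)
      have hb := Nat.gcd_eq_gcd_ab (2 * j) p
      rw [hcop.gcd_eq_one] at hb
      apply hcW
      rw [← pow_two, ← pow_mul] at hmem
      have : c ^ (1 : ℤ) ∈ W := by
        rw [show (1 : ℤ) = ((1 : ℕ) : ℤ) by norm_num, hb, zpow_add, zpow_mul, zpow_mul,
          zpow_natCast, zpow_natCast]
        exact mul_mem (zpow_mem hmem _) (zpow_mem hcp _)
      simpa using this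
    have hcoeff : (of F G ((c * c) ^ j) * v).coeff 1 = 0 := by
      rw [coeff_of_mul]
      apply coeff_eq_zero_of_mem_groupSpan hv.mem
      simpa using hmem
    have e3 : of F G (c * c) ^ j * (-1) ^ (p - 1 - j) * ((p - 1).choose j : ℕ) * v =
        ((-1) ^ (p - 1 - j) * ((p - 1).choose j : F)) • (of F G ((c * c) ^ j) * v) := by
      rw [← map_pow]
      generalize of F G ((c * c) ^ j) = a
      rcases Nat.even_or_odd (p - 1 - j) with h | h <;>
        simp [h.neg_one_pow, ← nsmul_eq_mul', ← Nat.cast_smul_eq_nsmul F]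
    rw [e3, coeff_smul, Finsupp.smul_apply, hcoeff, smul_zero]
  · intro h
    simp at h

end Chain

/-- When b commutes with v, the Jordan product is 2vb, so each factor b costs exactly one step of
the Lie series. -/
theorem IsTwistedQuaternion.mul_pow_mem {F R : Type*} [Field F] [Ring R] [Algebra F R]
    {f i j k : R} (H : IsTwistedQuaternion f i j k) (h2 : (2 : F) ≠ 0) {S : Submodule F R} {n : ℕ}
    (hn : 1 ≤ n) {v b : R} (hv : v ∈ quatComp f i j k (lieSub S n)) (hb : b ∈ quatComp f i j k S)
    (hc : Commute b v) (e : ℕ) : v * b ^ e ∈ quatComp f i j k (lieSub S (n + e)) := by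
  induction e with
  | zero => simpa using hv
  | succ e ih =>
    have h1 := H.jordan_mem h2 (fun a ha s hs => commutator_mem_lieSub (by omega) ha hs) ih hb
    have h3 : Commute b (v * b ^ e) := hc.mul_right ((Commute.refl b).pow_right e)
    rw [h3.eq] at h1
    rw [pow_succ, ← mul_assoc]
    exact mem_of_add_self_mem h2 h1

section Chain

variable {F G : Type*} [Field F] [Group G] {p : ℕ} [Fact p.Prime] [CharP F p]

theorem exists_isInvariantElement (hp : 2 < p) {f i j k : MonoidAlgebra F G}
    (H : IsTwistedQuaternion f i j k) {S : Submodule F (MonoidAlgebra F G)} {P : Subgroup G}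
    (hA : skewSpan F P ≤ quatComp f i j k S) {m : ℕ} (hP : Nat.card P = p ^ m) (e : ℕ)
    (he : e ≤ m) :
    ∃ W ≤ P, Nat.card W = p ^ e ∧ ∃ v, IsInvariantElement W v ∧ v.coeff 1 ≠ 0 ∧
      ((e = 0 ∧ v = 1) ∨ (1 ≤ e ∧ v ∈ quatComp f i j k (lieSub S (e * (p - 1))))) := by
  have h2 := two_ne_zero_of_charP F hp
  have hprime := (Fact.out : p.Prime)
  have : Finite P := Nat.finite_of_card_ne_zero (by rw [hP]; exact pow_ne_zero _ hprime.ne_zero)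
  induction e with
  | zero =>
    refine ⟨⊥, bot_le, by simp, 1, ⟨?_, ?_⟩, ?_, Or.inl ⟨rfl, rfl⟩⟩
    · rw [← map_one (of F G)]
      exact Submodule.subset_span ⟨1, one_mem _, rfl⟩
    · intro h hh
      rw [Subgroup.mem_bot.1 hh, map_one, one_mul]
    · simp [one_def]
  | succ e ih =>
    obtain ⟨W, hWP, hW, v, hv, h1, hve⟩ := ih (by omega)
    have hW' : Nat.card (W.subgroupOf P) = p ^ e := by
      rw [← hW]
      exact Nat.card_congr (Subgroup.subgroupOfEquivOfLe hWP).toEquiv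
    obtain ⟨K, hK, hWK⟩ := Sylow.exists_subgroup_card_pow_succ (p := p) (n := e)
      (by rw [hP]; exact pow_dvd_pow _ he) hW'
    have hK' : Nat.card (K.map P.subtype) = p ^ (e + 1) := by
      rw [← hK]
      exact (Nat.card_congr (K.equivMapOfInjective _ P.subtype_injective).toEquiv).symm
    have hWK' : W ≤ K.map P.subtype := by
      intro w hw
      exact ⟨⟨w, hWP hw⟩, hWK hw, rfl⟩
    have hKP : K.map P.subtype ≤ P := Subgroup.map_subtype_le K
    obtain ⟨c, hc, hcv, hinv, hne⟩ := hv.mul_dif_pow hp hWK' hW hK' h1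
    refine ⟨_, hKP, hK', _, hinv, hne, Or.inr ⟨by omega, ?_⟩⟩
    have hb := hA (Submodule.subset_span ⟨c, hKP hc, rfl⟩)
    -- The starting element 1 belongs to no level. In the first link the factor b itself sits at
    -- level 1, and only p - 2 further factors are needed to reach level p - 1.
    rcases hve with ⟨rfl, rfl⟩ | ⟨he1, hv⟩
    · have := H.mul_pow_mem h2 (n := 1) le_rfl hb hb (Commute.refl _) (p - 2)
      rw [← pow_succ'] at this
      rw [one_mul, show p - 1 = p - 2 + 1 by omega]
      convert this using 2
      rw [zero_add, one_mul, add_comm]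
    · have := H.mul_pow_mem h2 (Nat.mul_pos he1 (by omega)) hv hb hcv (p - 1)
      rwa [add_one_mul]

/-- The element f x v is nonzero, because x is invertible and f can be cancelled on FP. -/
theorem IsQuaternionExtension.lt_lieIndex {σ : G →* ℤˣ} {x y z : G} {P : Subgroup G}
    (X : IsQuaternionExtension σ x y z P) {j k : MonoidAlgebra F G}
    (hL : IsLieNilpotent (symmSub F σ : Set (MonoidAlgebra F G))) {n : ℕ} {v : MonoidAlgebra F G}
    (hv : v ∈ quatComp (twist F z) (of F G x) j k (lieSub (symmSub F σ) n))
    (hvP : v ∈ groupSpan F P) (h0 : v ≠ 0) :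
    n < lieIndex (symmSub F σ : Set (MonoidAlgebra F G)) := by
  refine SymmLie.lt_lieIndex hL hv.2.1 fun h => h0 ?_
  rw [(twist_comm X.z_comm _).eq, mul_assoc] at h
  refine eq_zero_of_twist_mul X.z_not_mem hvP ?_
  exact ((Group.isUnit x).map (of F G)).mul_left_cancel (by rw [h, mul_zero])

theorem IsQuaternionExtension.card_lt_lieIndex (hp : 2 < p) {σ : G →* ℤˣ} {x y z : G}
    {P : Subgroup G} (X : IsQuaternionExtension σ x y z P)
    (hL : IsLieNilpotent (symmSub F σ : Set (MonoidAlgebra F G)))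
    (H : IsTwistedQuaternion (twist F z) (of F G x) (of F G y) (of F G (x * y)))
    (hA : skewSpan F P ≤
      quatComp (twist F z) (of F G x) (of F G y) (of F G (x * y)) (symmSub F σ))
    {m : ℕ} (hm : 1 ≤ m) (hP : Nat.card P = p ^ m) :
    m * (p - 1) < lieIndex (symmSub F σ : Set (MonoidAlgebra F G)) := by
  obtain ⟨W, hW, -, v, hv, h1, h | ⟨-, hvm⟩⟩ := exists_isInvariantElement hp H hA hP m le_rfl
  · omega
  refine X.lt_lieIndex hL hvm (Submodule.span_mono (Set.image_mono hW) hv.mem) ?_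
  rintro rfl
  simp at h1

end Chain

/-! ### Powerful groups -/

section Powerful

variable {F G : Type*} [Field F] [Group G] {P : Subgroup G}

theorem of_sub_one_mem_delta {h : G} (hh : h ∈ P) : of F G h - 1 ∈ delta F P :=
  Submodule.subset_span ⟨h, hh, rfl⟩

variable (F P) in
theorem delta_mul_delta_le : delta F P * delta F P ≤ delta F P := by
  conv_lhs => rw [delta, Submodule.span_mul_span]
  rw [Submodule.span_le]
  rintro _ ⟨_, ⟨a, ha, rfl⟩, _, ⟨b, hb, rfl⟩, rfl⟩
  have : (of F G a - 1) * (of F G b - 1) =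
      (of F G (a * b) - 1) - (of F G a - 1) - (of F G b - 1) := by
    rw [map_mul]; noncomm_ring
  change (of F G a - 1) * (of F G b - 1) ∈ _
  rw [this]
  exact sub_mem (sub_mem (of_sub_one_mem_delta (mul_mem ha hb)) (of_sub_one_mem_delta ha))
    (of_sub_one_mem_delta hb)

theorem delta_pow_le_pow {m n : ℕ} (hm : 1 ≤ m) (hmn : m ≤ n) :
    delta F P ^ n ≤ delta F P ^ m := by
  induction n, hmn using Nat.le_induction with
  | base => exact le_rfl
  | succ n hn ih =>
    refine le_trans ?_ ih
    obtain ⟨k, rfl⟩ := Nat.exists_eq_add_of_le' (hm.trans hn)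
    rw [pow_succ, pow_succ, mul_assoc]
    exact mul_le_mul' le_rfl (delta_mul_delta_le F P)

theorem of_mul_mem_delta_pow {h : G} (hh : h ∈ P) {n : ℕ} (hn : 1 ≤ n) {a : MonoidAlgebra F G}
    (ha : a ∈ delta F P ^ n) : of F G h * a ∈ delta F P ^ n := by
  have : of F G h * a = (of F G h - 1) * a + a := by noncomm_ring
  rw [this]
  refine add_mem (delta_pow_le_pow hn (Nat.le_succ n) ?_) ha
  rw [pow_succ']
  exact Submodule.mul_mem_mul (of_sub_one_mem_delta hh) ha

/-- The dimension subgroup of elements `h ∈ P` with `h - 1 ∈ δ(P)^(n+1)`. -/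
def dimensionSubgroup (F : Type*) {G : Type*} [Field F] [Group G] (P : Subgroup G) (n : ℕ) :
    Subgroup G where
  carrier := {h | h ∈ P ∧ of F G h - 1 ∈ delta F P ^ (n + 1)}
  mul_mem' := by
    rintro a b ⟨ha, ha'⟩ ⟨hb, hb'⟩
    refine ⟨mul_mem ha hb, ?_⟩
    have : of F G (a * b) - 1 = of F G a * (of F G b - 1) + (of F G a - 1) := by
      rw [map_mul]; noncomm_ring
    rw [this]
    exact add_mem (of_mul_mem_delta_pow ha (by omega) hb') ha'
  one_mem' := ⟨one_mem P, by rw [map_one, sub_self]; exact zero_mem _⟩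
  inv_mem' := by
    rintro a ⟨ha, ha'⟩
    refine ⟨inv_mem ha, ?_⟩
    have : of F G a⁻¹ - 1 = -(of F G a⁻¹ * (of F G a - 1)) := by
      rw [mul_sub, ← map_mul, inv_mul_cancel, map_one]; noncomm_ring
    rw [this]
    exact neg_mem (of_mul_mem_delta_pow (inv_mem ha) (by omega) ha')

theorem commutator_mem_delta_pow {a b : G} (ha : a ∈ P) (hb : b ∈ P) {n : ℕ}
    (h : (b * a)⁻¹ * (a * b) ∈ dimensionSubgroup F P n) :
    (of F G a - 1) * (of F G b - 1) - (of F G b - 1) * (of F G a - 1) ∈ delta F P ^ (n + 1) := by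
  have : (of F G a - 1) * (of F G b - 1) - (of F G b - 1) * (of F G a - 1) =
      of F G (b * a) * (of F G ((b * a)⁻¹ * (a * b)) - 1) := by
    rw [mul_sub (of F G (b * a)), ← map_mul, mul_inv_cancel_left, map_mul, map_mul]; noncomm_ring
  rw [this]
  exact of_mul_mem_delta_pow (mul_mem hb ha) (by omega) h.2

theorem pow_char_mem_dimensionSubgroup {p : ℕ} [Fact p.Prime] [CharP F p] {n : ℕ} (hn : n < p)
    {h : G} (hh : h ∈ P) : h ^ p ∈ dimensionSubgroup F P n := by
  have : CharP (MonoidAlgebra F G) p := charP_of_injective_algebraMap' F p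
  refine ⟨pow_mem hh p, delta_pow_le_pow (by omega) (show n + 1 ≤ p from hn) ?_⟩
  have h1 := sub_pow_char_pow_of_commute p 1 (Commute.one_right (of F G h))
  rw [pow_one, one_pow, ← map_pow] at h1
  rw [← h1]
  exact Submodule.pow_mem_pow _ (of_sub_one_mem_delta hh) p

/-- For h ∈ P one has h^p - 1 = (h - 1)^p ∈ Δ(P)^p ⊆ Δ(P)³, as p ≥ 3. So P^p, and with it P', lies
in the corresponding dimension subgroup. -/
theorem IsPowerful.commutator_mem {p : ℕ} [Fact p.Prime] [CharP F p] (hp : 2 < p)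
    (hpow : IsPowerful p P) : ∀ a ∈ delta F P, ∀ b ∈ delta F P,
      a * b - b * a ∈ delta F P ^ 3 := by
  have key : ∀ a ∈ P, ∀ b ∈ P, (b * a)⁻¹ * (a * b) ∈ dimensionSubgroup F P 2 := by
    intro a ha b hb
    have h1 : Subgroup.closure (Set.range fun h : P => h ^ p) ≤
        (dimensionSubgroup F P 2).comap P.subtype := by
      rw [Subgroup.closure_le]
      rintro _ ⟨h, rfl⟩
      exact pow_char_mem_dimensionSubgroup hp h.2
    have h2 := Subgroup.commutator_mem_commutator (Subgroup.mem_top (⟨a, ha⟩ : P)⁻¹)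
      (Subgroup.mem_top (⟨b, hb⟩ : P)⁻¹)
    have h3 : a⁻¹ * b⁻¹ * a⁻¹⁻¹ * b⁻¹⁻¹ ∈ dimensionSubgroup F P 2 := h1 (hpow h2)
    convert h3 using 1
    group
  intro a ha b hb
  have h1 : delta F P ≤ (delta F P ^ 3).comap (LinearMap.mulRight F b - LinearMap.mulLeft F b) := by
    conv_lhs => rw [delta]
    rw [Submodule.span_le]
    rintro _ ⟨a, ha, rfl⟩
    have h2 : delta F P ≤ (delta F P ^ 3).comap
        (LinearMap.mulLeft F (of F G a - 1) - LinearMap.mulRight F (of F G a - 1)) := by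
      conv_lhs => rw [delta]
      rw [Submodule.span_le]
      rintro _ ⟨b, hb, rfl⟩
      exact commutator_mem_delta_pow ha hb (key a ha b hb)
    exact h2 hb
  exact h1 ha

theorem commutator_delta_pow_mem (h : ∀ a ∈ delta F P, ∀ b ∈ delta F P,
    a * b - b * a ∈ delta F P ^ 3) (n : ℕ) : ∀ a ∈ delta F P ^ (n + 1), ∀ b ∈ delta F P,
      a * b - b * a ∈ delta F P ^ (n + 3) := by
  intro a ha b hb
  induction n generalizing a with
  | zero => exact h a (by simpa using ha) b hb
  | succ n ih =>
    rw [pow_succ] at ha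
    refine Submodule.mul_induction_on ha ?_ ?_
    · intro c hc d hd
      have : c * d * b - b * (c * d) = c * (d * b - b * d) + (c * b - b * c) * d := by
        noncomm_ring
      rw [this]
      refine add_mem ?_ ?_
      · rw [show n + 1 + 3 = (n + 1) + 3 from rfl, pow_add _ (n + 1) 3]
        exact Submodule.mul_mem_mul hc (h d hd b hb)
      · rw [show n + 1 + 3 = (n + 3) + 1 from rfl, pow_succ]
        exact Submodule.mul_mem_mul (ih c hc) hd
    · intro c d hc hd
      have : (c + d) * b - b * (c + d) = (c * b - b * c) + (d * b - b * d) := by noncomm_ring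
      rw [this]
      exact add_mem hc hd

theorem dif_sub_mem {h : G} (hh : h ∈ P) :
    dif F h - (of F G h - 1) - (of F G h - 1) ∈ delta F P ^ 2 := by
  have : dif F h - (of F G h - 1) - (of F G h - 1) = (of F G h - 1) * (of F G h⁻¹ - 1) := by
    rw [mul_sub, sub_mul, ← map_mul, mul_inv_cancel, map_one, dif]; noncomm_ring
  rw [this, pow_two]
  exact Submodule.mul_mem_mul (of_sub_one_mem_delta hh) (of_sub_one_mem_delta (inv_mem hh))

/-- Modulo Δ(P)², h - h⁻¹ is 2(h - 1). If u ∈ Δ(P)ⁿ⁺¹, commutators of u lie two powers higher, so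
the Jordan product of u with h - h⁻¹ is 4u(h - 1) to leading order. -/
theorem delta_pow_le_quatComp_sup (h2 : (2 : F) ≠ 0) {f i j k : MonoidAlgebra F G}
    (H : IsTwistedQuaternion f i j k) {S : Submodule F (MonoidAlgebra F G)}
    (hA : skewSpan F P ≤ quatComp f i j k S)
    (h : ∀ a ∈ delta F P, ∀ b ∈ delta F P, a * b - b * a ∈ delta F P ^ 3) (n : ℕ) :
    delta F P ^ (n + 1) ≤ quatComp f i j k (lieSub S (n + 1)) ⊔ delta F P ^ (n + 2) := by
  have hdif : ∀ {h : G}, h ∈ P → dif F h ∈ quatComp f i j k S := fun hh =>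
    hA (Submodule.subset_span ⟨_, hh, rfl⟩)
  induction n with
  | zero =>
    rw [zero_add, pow_one]
    conv_lhs => rw [delta]
    rw [Submodule.span_le]
    rintro _ ⟨g, hg, rfl⟩
    apply mem_of_add_self_mem h2
    have : of F G g - 1 + (of F G g - 1) =
        dif F g - (dif F g - (of F G g - 1) - (of F G g - 1)) := by abel
    change of F G g - 1 + (of F G g - 1) ∈ _
    rw [this]
    exact sub_mem (Submodule.mem_sup_left (hdif hg)) (Submodule.mem_sup_right (dif_sub_mem hg))
  | succ n ih =>
    rw [pow_succ _ (n + 1), Submodule.mul_le]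
    intro a ha d hd
    suffices hle : delta F P ≤ (quatComp f i j k (lieSub S (n + 1 + 1)) ⊔
        delta F P ^ (n + 1 + 2)).comap (LinearMap.mulLeft F a) from hle hd
    clear hd d
    conv_lhs => rw [delta]
    rw [Submodule.span_le]
    rintro _ ⟨g, hg, rfl⟩
    obtain ⟨u, hu, w, hw, rfl⟩ := Submodule.mem_sup.1 (ih ha)
    have hu' : u ∈ delta F P ^ (n + 1) := by
      have := sub_mem ha (delta_pow_le_pow (by omega) (Nat.le_succ _) hw)
      rwa [add_sub_cancel_right] at this
    change (u + w) * (of F G g - 1) ∈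
      quatComp f i j k (lieSub S (n + 1 + 1)) ⊔ delta F P ^ (n + 1 + 2)
    have hg' := of_sub_one_mem_delta (F := F) hg
    have hd : dif F g ∈ delta F P := by
      have : dif F g = (of F G g - 1) - (of F G g⁻¹ - 1) := by rw [dif]; abel
      rw [this]
      exact sub_mem hg' (of_sub_one_mem_delta (inv_mem hg))
    have m1 := H.jordan_mem h2 (fun a ha s hs => commutator_mem_lieSub (n := n + 1) (by omega) ha hs)
      hu (hdif hg)
    have m2 := commutator_delta_pow_mem h n u hu' _ hd
    have m3 : u * (dif F g - (of F G g - 1) - (of F G g - 1)) ∈ delta F P ^ (n + 3) := by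
      rw [show n + 3 = (n + 1) + 2 from rfl, pow_add]
      exact Submodule.mul_mem_mul hu' (dif_sub_mem hg)
    have m4 : w * (of F G g - 1) ∈ delta F P ^ (n + 3) := by
      rw [show n + 3 = (n + 2) + 1 from rfl, pow_succ]
      exact Submodule.mul_mem_mul hw hg'
    apply mem_of_add_self_mem h2
    apply mem_of_add_self_mem h2
    have e : (u + w) * (of F G g - 1) + (u + w) * (of F G g - 1) +
        ((u + w) * (of F G g - 1) + (u + w) * (of F G g - 1)) =
        (u * dif F g + dif F g * u) + ((u * dif F g - dif F g * u) -
          (u * (dif F g - (of F G g - 1) - (of F G g - 1)) +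
            u * (dif F g - (of F G g - 1) - (of F G g - 1))) +
          (w * (of F G g - 1) + w * (of F G g - 1) + (w * (of F G g - 1) + w * (of F G g - 1)))) := by
      noncomm_ring
    rw [e]
    exact add_mem (Submodule.mem_sup_left m1) (Submodule.mem_sup_right
      (add_mem (sub_mem m2 (add_mem m3 m3)) (add_mem (add_mem m4 m4) (add_mem m4 m4))))

end Powerful

/-! ### The nilpotency indices -/

namespace IsQuaternionExtension

variable {F G : Type*} [Field F] [Group G] {p : ℕ} [Fact p.Prime] [CharP F p] (hp : 2 < p)
  {σ : G →* ℤˣ} {x y z : G} {P : Subgroup G} (X : IsQuaternionExtension σ x y z P)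
  (hL : IsLieNilpotent (symmSub F σ : Set (MonoidAlgebra F G)))
  (hδ : ∃ n, delta F P ^ n = ⊥) {m : ℕ} (hm : 1 ≤ m) (hP : Nat.card P = p ^ m)
include hp X

section

include hL hδ hm hP

theorem indices : m * (p - 1) < lieIndex (symmSub F σ : Set (MonoidAlgebra F G)) ∧
    lieIndex (symmSub F σ : Set (MonoidAlgebra F G)) ≤
      upperLieIndex (symmSub F σ : Set (MonoidAlgebra F G)) ∧
    upperLieIndex (symmSub F σ : Set (MonoidAlgebra F G)) ≤ tNil F P ∧
    3 ≤ tNil F P ∧ (delta F P * ⊤) ^ tNil F P = ⊥ := by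
  obtain ⟨j, hq⟩ := exists_isEngelExponent (F := F) hp hL
  have h1 := X.card_lt_lieIndex hp hL (hq.isTwistedQuaternion X.toIsQuaternionPair)
    ((Submodule.span_mono (Set.image_mono X.le)).trans (hq.skewSpan_le X.toIsQuaternionPair)) hm hP
  obtain ⟨ht, h0, -⟩ := delta_pow_tNil P hδ
  have h2 : (delta F P * ⊤) ^ tNil F P = ⊥ := by
    obtain ⟨n, hn⟩ := Nat.exists_eq_add_of_le' ht
    rw [hn] at h0 ⊢
    exact X.deltaIdeal_pow_eq_bot h0
  have hc := X.isCentralModulo (two_ne_zero_of_charP F hp)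
  -- The comparison needs an exponent at least 2, which is not yet known for `tNil F P`. It is
  -- applied to the maximum with 2; the lower bound m(p - 1) ≥ 2 then shows that `tNil F P` is at
  -- least 3.
  have key : ∀ T, tNil F P ≤ T → 2 ≤ T → lieIndex (symmSub F σ : Set (MonoidAlgebra F G)) ≤
      upperLieIndex (symmSub F σ : Set (MonoidAlgebra F G)) ∧
      upperLieIndex (symmSub F σ : Set (MonoidAlgebra F G)) ≤ T := by
    intro T hT h2T
    refine hc.lieIndex_le_upperLieIndex h2T (le_bot_iff.1 ?_)
    rw [← h2]
    exact hc.twoSided.pow_le_pow hT ht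
  obtain ⟨h4, h5⟩ := key (max (tNil F P) 2) (le_max_left _ _) (le_max_right _ _)
  have h6 : 2 ≤ m * (p - 1) := by
    calc 2 = 1 * 2 := rfl
      _ ≤ _ := Nat.mul_le_mul hm (by omega)
  exact ⟨h1, h4, by omega, by omega, h2⟩

theorem isStronglyLieNilpotent :
    IsStronglyLieNilpotent (symmSub F σ : Set (MonoidAlgebra F G)) := by
  obtain ⟨-, -, -, h1, h2⟩ := X.indices hp hL hδ hm hP
  exact ⟨_, by omega, (X.isCentralModulo (two_ne_zero_of_charP F hp)).upperLieSeries_eq_zero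
    (by omega) h2⟩

theorem groupSeries_symmUnits : groupSeries (symmUnits F σ) (tNil F P) = {1} := by
  obtain ⟨-, -, -, h1, h2⟩ := X.indices hp hL hδ hm hP
  exact (X.isCentralModulo (two_ne_zero_of_charP F hp)).groupSeries_eq_one symmUnits_subset
    (by omega) h2

theorem isNilpotentSubset_symmUnits : IsNilpotentSubset (symmUnits F σ) := by
  obtain ⟨-, -, -, h1, -⟩ := X.indices hp hL hδ hm hP
  have := X.groupSeries_symmUnits hp hL hδ hm hP
  obtain ⟨n, hn⟩ := Nat.exists_eq_add_of_le' (show 1 ≤ tNil F P by omega)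
  exact ⟨n, hn ▸ this⟩

theorem nilClass_symmUnits_lt : nilClass (symmUnits F σ) + 1 ≤ tNil F P := by
  obtain ⟨-, -, -, h1, -⟩ := X.indices hp hL hδ hm hP
  have := X.groupSeries_symmUnits hp hL hδ hm hP
  obtain ⟨n, hn⟩ := Nat.exists_eq_add_of_le' (show 1 ≤ tNil F P by omega)
  rw [hn] at this ⊢
  exact Nat.succ_le_succ (Nat.sInf_le this)

theorem nilClass_symmUnits_eq
    (h : lieIndex (symmSub F σ : Set (MonoidAlgebra F G)) = tNil F P) :
    nilClass (symmUnits F σ) + 1 = tNil F P := by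
  obtain ⟨-, -, -, h1, h2⟩ := X.indices hp hL hδ hm hP
  refine le_antisymm (X.nilClass_symmUnits_lt hp hL hδ hm hP) ?_
  refine (X.isCentralModulo (two_ne_zero_of_charP F hp)).le_nilClass_add_one symmUnits_subset
    (exists_symmUnit h2) h1 h2 fun h3 => ?_
  have h4 : lieIndex (symmSub F σ : Set (MonoidAlgebra F G)) ≤ tNil F P - 1 := by
    refine Nat.sInf_le ⟨by omega, ?_⟩
    rw [coe_lieSub, h3, Submodule.bot_coe]
  omega

/-- With t the nilpotency index, Δ(P)ᵗ = 0 removes the error term in level t - 1, so a nonzero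
element of Δ(P)^(t-1) witnesses γ^(t-1)(FG⁺) ≠ 0. -/
theorem lieIndex_eq_of_isPowerful (hpow : IsPowerful p P) :
    lieIndex (symmSub F σ : Set (MonoidAlgebra F G)) = tNil F P := by
  obtain ⟨-, h1, h2, h3, -⟩ := X.indices hp hL hδ hm hP
  obtain ⟨-, h4, h5⟩ := delta_pow_tNil P hδ
  refine le_antisymm (h1.trans h2) ?_
  obtain ⟨n, hn⟩ := Nat.exists_eq_add_of_le' (show 2 ≤ tNil F P by omega)
  obtain ⟨v, hv, hv0⟩ := Submodule.exists_mem_ne_zero_of_ne_bot (h5 (n + 1) (by omega) (by omega))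
  obtain ⟨j, hq⟩ := exists_isEngelExponent (F := F) hp hL
  have h6 := delta_pow_le_quatComp_sup (two_ne_zero_of_charP F hp)
    (hq.isTwistedQuaternion X.toIsQuaternionPair)
    ((Submodule.span_mono (Set.image_mono X.le)).trans (hq.skewSpan_le X.toIsQuaternionPair))
    (IsPowerful.commutator_mem hp hpow) n hv
  rw [← hn, h4, sup_bot_eq] at h6
  have := X.lt_lieIndex hL h6 (delta_pow_le_groupSpan F P _ hv) hv0
  omega

end

end IsQuaternionExtension

/-! ### Direct decompositions -/

section

variable {G : Type*} [Group G]

/-- The subgroup generated by `M` and a central element `e` with `e² ∈ M`. -/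
def adjoinCentral (M : Subgroup G) (e : G) (he : ∀ g, Commute e g) (hee : e * e ∈ M) :
    Subgroup G where
  carrier := {a | a ∈ M ∨ a * e ∈ M}
  mul_mem' := by
    rintro a b (ha | ha) (hb | hb)
    · exact Or.inl (mul_mem ha hb)
    · exact Or.inr (by rw [mul_assoc]; exact mul_mem ha hb)
    · exact Or.inr (by rw [mul_assoc, ← he b, ← mul_assoc]; exact mul_mem ha hb)
    · have := mul_mem ha hb
      rw [mul_assoc, ← mul_assoc e, he b, mul_assoc, ← mul_assoc a,
        Subgroup.mul_mem_cancel_right _ hee] at this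
      exact Or.inl this
  one_mem' := Or.inl (one_mem M)
  inv_mem' := by
    rintro a (ha | ha)
    · exact Or.inl (inv_mem ha)
    · have := mul_mem hee (inv_mem ha)
      rw [mul_inv_rev, mul_assoc, mul_inv_cancel_left, he] at this
      exact Or.inr this

/-- By Zorn's lemma there is E maximal among the subgroups of T avoiding z. If neither e nor ze were
in E, adjoining e would contradict maximality. -/
theorem exists_complement {T : Subgroup G} (hT : ∀ e ∈ T, (∀ g, Commute e g) ∧ e * e = 1) {z : G}
    (z_ne : z ≠ 1) :
    ∃ E ≤ T, z ∉ E ∧ ∀ e ∈ T, e ∈ E ∨ z * e ∈ E := by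
  obtain ⟨E, hE⟩ := zorn_le_nonempty₀ {E : Subgroup G | E ≤ T ∧ z ∉ E} (by
    intro c hc hchain y hy
    refine ⟨sSup c, ⟨sSup_le fun E hE => (hc hE).1, fun hz => ?_⟩, fun E hE => le_sSup hE⟩
    obtain ⟨E, hE, hzE⟩ := (Subgroup.mem_sSup_of_directedOn ⟨y, hy⟩ hchain.directedOn).1 hz
    exact (hc hE).2 hzE) ⊥ ⟨bot_le, fun h => z_ne (Subgroup.mem_bot.1 h)⟩
  obtain ⟨-, ⟨hET, hzE⟩, hmax⟩ := hE
  refine ⟨E, hET, hzE, fun e he => ?_⟩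
  by_contra! hcon
  obtain ⟨hec, hee⟩ := hT e he
  let M := adjoinCentral E e hec (by rw [hee]; exact one_mem E)
  have heM : e ∈ M := Or.inr (by rw [hee]; exact one_mem E)
  refine hcon.1 (hmax (y := M) ⟨?_, ?_⟩ (fun a ha => Or.inl ha) heM)
  · rintro a (ha | ha)
    · exact hET ha
    · exact (Subgroup.mul_mem_cancel_right T he).1 (hET ha)
  · rintro (h | h)
    · exact hzE h
    · exact hcon.2 h

theorem isInternalProd_of {A B C K : Subgroup G} (hAB : ∀ a ∈ A, ∀ b ∈ B, Commute a b)
    (hAC : ∀ a ∈ A, ∀ c ∈ C, Commute a c) (hBC : ∀ b ∈ B, ∀ c ∈ C, Commute b c)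
    (hA : A ≤ K) (hB : B ≤ K) (hC : C ≤ K)
    (hsurj : ∀ h ∈ K, ∃ a ∈ A, ∃ b ∈ B, ∃ c ∈ C, h = a * b * c)
    (hinj : ∀ a ∈ A, ∀ b ∈ B, ∀ c ∈ C, a * b * c = 1 → a = 1 ∧ b = 1 ∧ c = 1) :
    IsInternalProd A B C K := by
  refine ⟨hAB, hAC, hBC, ?_, ?_, ?_⟩
  · rintro ⟨a, b, c⟩ ⟨ha, hb, hc⟩
    exact mul_mem (mul_mem (hA ha) (hB hb)) (hC hc)
  · rintro ⟨a, b, c⟩ ⟨ha, hb, hc⟩ ⟨a', b', c'⟩ ⟨ha', hb', hc'⟩ h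
    change a * b * c = a' * b' * c' at h
    have h1 := hinj (a'⁻¹ * a) (mul_mem (inv_mem ha') ha) (b'⁻¹ * b) (mul_mem (inv_mem hb') hb)
      (c * c'⁻¹) (mul_mem hc (inv_mem hc')) (by
        have e := hAB _ (mul_mem (inv_mem ha') ha) _ (inv_mem hb')
        calc a'⁻¹ * a * (b'⁻¹ * b) * (c * c'⁻¹) = (a'⁻¹ * a * b'⁻¹) * b * c * c'⁻¹ := by
              simp only [mul_assoc]
          _ = b'⁻¹ * a'⁻¹ * (a * b * c) * c'⁻¹ := by rw [e.eq]; simp only [mul_assoc]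
          _ = 1 := by rw [h]; group)
    obtain ⟨h1, h2, h3⟩ := h1
    rw [inv_mul_eq_one] at h1 h2
    rw [mul_inv_eq_one] at h3
    rw [h1, h2, h3]
  · rintro h hh
    obtain ⟨a, ha, b, hb, c, hc, rfl⟩ := hsurj h hh
    exact ⟨(a, b, c), ⟨ha, hb, hc⟩, rfl⟩

namespace IsQuaternionPair

variable {x y z : G} (Q : IsQuaternionPair x y z)
include Q

theorem mul_self_of_mem {k : G} (hk : k ∈ ({1, x, y, x * y} : Set G)) : k = 1 ∨ k * k = z := by
  rcases hk with rfl | rfl | rfl | rfl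
  · exact Or.inl rfl
  · exact Or.inr Q.xx
  · exact Or.inr Q.yy
  · exact Or.inr Q.xy_mul_xy

theorem eq_one_of_commute {k : G} (hk : k ∈ ({1, x, y, x * y} : Set G)) (hx : Commute k x)
    (hy : Commute k y) : k = 1 := by
  rcases hk with rfl | rfl | rfl | rfl
  · rfl
  · exact absurd hy.symm Q.xy_ne
  · exact absurd hx Q.xy_ne
  · refine absurd ?_ Q.xy_ne
    have h1 : x * (y * x) = x * (x * y) := by rw [← mul_assoc]; exact hx
    exact mul_left_cancel h1

theorem mul_x_of_mem {k : G} (hk : k ∈ ({1, x, y, x * y} : Set G)) :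
    ∃ k' ∈ ({1, x, y, x * y} : Set G), k * x = k' ∨ k * x = k' * z := by
  rcases hk with rfl | rfl | rfl | rfl
  · exact ⟨x, by simp, Or.inl (one_mul x)⟩
  · exact ⟨1, by simp, Or.inr (by rw [Q.xx, one_mul])⟩
  · exact ⟨x * k, by simp, Or.inr Q.yx⟩
  · refine ⟨y, by simp, Or.inl ?_⟩
    rw [mul_assoc, Q.yx, mul_assoc, ← mul_assoc, ← mul_assoc, Q.xx, Q.zy, mul_assoc, Q.zz, mul_one]

theorem mul_y_of_mem {k : G} (hk : k ∈ ({1, x, y, x * y} : Set G)) :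
    ∃ k' ∈ ({1, x, y, x * y} : Set G), k * y = k' ∨ k * y = k' * z := by
  rcases hk with rfl | rfl | rfl | rfl
  · exact ⟨y, by simp, Or.inl (one_mul y)⟩
  · exact ⟨k * y, by simp, Or.inl rfl⟩
  · exact ⟨1, by simp, Or.inr (by rw [Q.yy, one_mul])⟩
  · exact ⟨x, by simp, Or.inr (by rw [mul_assoc, Q.yy])⟩

/-- The coset representatives 1, x, y, xy are permuted by right multiplication by x and y up to
factors z, which M absorbs. -/
theorem exists_of_mem_closure {M : Subgroup G} (hz : z ∈ M)
    (hM : ∀ c ∈ M, Commute c x ∧ Commute c y) {s : Set G} (hs : ∀ a ∈ s, a = x ∨ a = y ∨ a ∈ M)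
    {a : G} (ha : a ∈ Subgroup.closure s) :
    ∃ k ∈ ({1, x, y, x * y} : Set G), ∃ c ∈ M, a = k * c := by
  have step : ∀ {u : G}, (∀ k ∈ ({1, x, y, x * y} : Set G),
      ∃ k' ∈ ({1, x, y, x * y} : Set G), k * u = k' ∨ k * u = k' * z) →
      ∀ {k c : G}, k ∈ ({1, x, y, x * y} : Set G) → c ∈ M → Commute c u →
      ∃ k' ∈ ({1, x, y, x * y} : Set G), ∃ c' ∈ M, k * c * u = k' * c' := by
    intro u hu k c hk hc hcu
    obtain ⟨k', hk', h | h⟩ := hu k hk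
    · exact ⟨k', hk', c, hc, by rw [mul_assoc, hcu.eq, ← mul_assoc, h]⟩
    · exact ⟨k', hk', z * c, mul_mem hz hc, by rw [mul_assoc, hcu.eq, ← mul_assoc, h, mul_assoc]⟩
  have step' : ∀ {u : G}, u⁻¹ = u * z → ∀ {k c : G},
      (∃ k' ∈ ({1, x, y, x * y} : Set G), ∃ c' ∈ M, k * c * u = k' * c') →
      ∃ k' ∈ ({1, x, y, x * y} : Set G), ∃ c' ∈ M, k * c * u⁻¹ = k' * c' := by
    rintro u hu k c ⟨k', hk', c', hc', h⟩
    exact ⟨k', hk', c' * z, mul_mem hc' hz, by rw [hu, ← mul_assoc, h, mul_assoc]⟩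
  induction ha using Subgroup.closure_induction_right with
  | one => exact ⟨1, by simp, 1, one_mem M, by simp⟩
  | mul_right a _ b hb ih =>
    obtain ⟨k, hk, c, hc, rfl⟩ := ih
    rcases hs b hb with rfl | rfl | hb
    · exact step (fun _ => Q.mul_x_of_mem) hk hc (hM c hc).1
    · exact step (fun _ => Q.mul_y_of_mem) hk hc (hM c hc).2
    · exact ⟨k, hk, c * b, mul_mem hc hb, mul_assoc _ _ _⟩
  | mul_inv_cancel a _ b hb ih =>
    obtain ⟨k, hk, c, hc, rfl⟩ := ih
    rcases hs b hb with rfl | rfl | hb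
    · exact step' Q.x_inv (step (fun _ => Q.mul_x_of_mem) hk hc (hM c hc).1)
    · exact step' Q.y_inv (step (fun _ => Q.mul_y_of_mem) hk hc (hM c hc).2)
    · exact ⟨k, hk, c * b⁻¹, mul_mem hc (inv_mem hb), mul_assoc _ _ _⟩

variable (zc : ∀ h, z * h = h * z)
include zc

theorem exists_of_mem_closure_pair {a : G} (ha : a ∈ Subgroup.closure {x, y}) :
    ∃ k ∈ ({1, x, y, x * y} : Set G), a = k ∨ a = k * z := by
  have hz := zc
  let M := adjoinCentral (⊥ : Subgroup G) z hz (by rw [Q.zz]; exact one_mem _)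
  obtain ⟨k, hk, c, hc, rfl⟩ := Q.exists_of_mem_closure (M := M) (s := {x, y})
    (Or.inr (by rw [Q.zz]; exact one_mem _)) (by
      rintro c (hc | hc)
      · rw [Subgroup.mem_bot.1 hc]
        exact ⟨Commute.one_left _, Commute.one_left _⟩
      · rw [eq_inv_of_mul_eq_one_left (Subgroup.mem_bot.1 hc), Q.z_inv]
        exact ⟨zc x, zc y⟩) (by
      rintro a (rfl | rfl)
      · exact Or.inl rfl
      · exact Or.inr (Or.inl rfl)) ha
  refine ⟨k, hk, ?_⟩
  rcases hc with hc | hc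
  · exact Or.inl (by rw [Subgroup.mem_bot.1 hc, mul_one])
  · exact Or.inr (by rw [eq_inv_of_mul_eq_one_left (Subgroup.mem_bot.1 hc), Q.z_inv])

theorem exists_of_mem_closure_triple {g : G} (hg : ∀ h, Commute g h) (hgg : g * g = z) {a : G}
    (ha : a ∈ Subgroup.closure {x, y, g}) :
    ∃ k ∈ ({1, x, y, x * y} : Set G), ∃ c ∈ ({1, z, g, z * g} : Set G), a = k * c := by
  have hz := zc
  let M₀ := adjoinCentral (⊥ : Subgroup G) z hz (by rw [Q.zz]; exact one_mem _)
  have hzM₀ : z ∈ M₀ := Or.inr (by rw [Q.zz]; exact one_mem _)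
  let M := adjoinCentral M₀ g hg (by rw [hgg]; exact hzM₀)
  have hM₀ : ∀ c ∈ M₀, c = 1 ∨ c = z := by
    rintro c (hc | hc)
    · exact Or.inl (Subgroup.mem_bot.1 hc)
    · exact Or.inr (by rw [eq_inv_of_mul_eq_one_left (Subgroup.mem_bot.1 hc), Q.z_inv])
  have ginv : g⁻¹ = z * g := inv_eq_of_mul_eq_one_left (by rw [mul_assoc, hgg, Q.zz])
  have hM : ∀ c ∈ M, c ∈ ({1, z, g, z * g} : Set G) := by
    rintro c (hc | hc)
    · rcases hM₀ c hc with rfl | rfl <;> simp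
    · rcases hM₀ _ hc with h | h
      · rw [eq_inv_of_mul_eq_one_left h, ginv]; simp
      · rw [eq_mul_inv_of_mul_eq h, ginv, ← mul_assoc, Q.zz, one_mul]; simp
  have hcen : ∀ c ∈ M, ∀ h, Commute c h := by
    intro c hc h
    rcases hM c hc with rfl | rfl | rfl | rfl
    · exact Commute.one_left h
    · exact zc h
    · exact hg h
    · exact Commute.mul_left (zc h) (hg h)
  obtain ⟨k, hk, c, hc, rfl⟩ := Q.exists_of_mem_closure (M := M) (s := {x, y, g})
    (Or.inl hzM₀) (fun c hc => ⟨hcen c hc x, hcen c hc y⟩) (by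
      rintro a (rfl | rfl | rfl)
      · exact Or.inl rfl
      · exact Or.inr (Or.inl rfl)
      · exact Or.inr (Or.inr (Or.inr (by rw [hgg]; exact hzM₀)))) ha
  exact ⟨k, hk, c, hM c hc, rfl⟩

end IsQuaternionPair

end

/-- The central elements of `ker σ` with square `1`. -/
def centralInvolutions {G : Type*} [Group G] (σ : G →* ℤˣ) : Subgroup G where
  carrier := {c | (∀ g, Commute c g) ∧ σ c = 1 ∧ c * c = 1}
  mul_mem' := by
    rintro a b ⟨ha, ha', ha''⟩ ⟨hb, hb', hb''⟩
    refine ⟨fun g => (ha g).mul_left (hb g), by rw [map_mul, ha', hb', one_mul], ?_⟩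
    rw [(hb a).mul_mul_mul_comm, ha'', hb'', one_mul]
  one_mem' := ⟨fun g => Commute.one_left g, map_one σ, one_mul 1⟩
  inv_mem' := by
    rintro a ⟨ha, ha', ha''⟩
    rw [← eq_inv_of_mul_eq_one_left ha'']
    exact ⟨ha, ha', ha''⟩

namespace IsQuaternionExtension

variable {G : Type*} [Group G] {σ : G →* ℤˣ} {x y z : G} {P : Subgroup G}
  (X : IsQuaternionExtension σ x y z P)
include X

theorem map_z : σ z = 1 := by rw [← X.xx, map_mul, X.map_x, one_mul]

/-- The factor ae has order dividing 4 and r has odd order, so r = 1. Then the quaternion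
representative in a is central, hence 1, and what remains lies in E ∩ ⟨z⟩ = 1. -/
theorem eq_one_of_mul_eq_one {E : Subgroup G} (hE : E ≤ centralInvolutions σ) (hzE : z ∉ E)
    {g : G} (hg : ∀ h, Commute g h) (hgg : g * g = z) (σg : σ g = -1) {a e r : G}
    (ha : a ∈ Subgroup.closure {x, y, g}) (he : e ∈ E) (hr : r ∈ P) (h : a * e * r = 1) :
    a = 1 ∧ e = 1 ∧ r = 1 := by
  obtain ⟨k, hk, c, hc, rfl⟩ := X.exists_of_mem_closure_triple X.z_comm hg hgg ha
  obtain ⟨hec, σe, hee⟩ := hE he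
  have hcc : (∀ h, Commute c h) ∧ c * c * (c * c) = 1 ∧ (σ c = 1 → c = 1 ∨ c = z) := by
    have σzg : σ (z * g) = -1 := by rw [map_mul, X.map_z, one_mul, σg]
    rcases hc with rfl | rfl | rfl | rfl
    · exact ⟨fun h => Commute.one_left h, by simp, fun _ => Or.inl rfl⟩
    · exact ⟨X.z_comm, by simp [X.zz], fun _ => Or.inr rfl⟩
    · exact ⟨hg, by simp [hgg, X.zz], fun h => absurd (σg.symm.trans h) (by decide)⟩
    · refine ⟨fun h => Commute.mul_left (X.z_comm h) (hg h), ?_,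
        fun h => absurd (σzg.symm.trans h) (by decide)⟩
      rw [Commute.mul_mul_mul_comm (hg z), X.zz, one_mul, hgg, X.zz]
  obtain ⟨hcc, hc4, hcz⟩ := hcc
  have hk4 : k ^ 4 = 1 := by
    rw [show 4 = 2 * 2 by norm_num, pow_mul, pow_two k]
    rcases X.mul_self_of_mem hk with rfl | h
    · simp
    · rw [h, pow_two, X.zz]
  have hw : (k * c * e) ^ 4 = 1 := by
    rw [Commute.mul_pow ((hec _).symm), Commute.mul_pow ((hcc k).symm), hk4, one_mul]
    rw [show 4 = 2 * 2 by norm_num, pow_mul, pow_mul, pow_two c, pow_two e, hee, pow_two, hc4]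
    simp
  have hr1 : r = 1 := by
    rw [eq_inv_of_mul_eq_one_left h, inv_pow, inv_eq_one] at hw
    obtain ⟨n, ⟨i, rfl⟩, hn⟩ := X.odd
    have hn := hn r hr
    have hcop : Nat.Coprime 4 (2 * i + 1) := by
      rw [show 4 = 2 ^ 2 by norm_num]
      exact Nat.Coprime.pow_left 2 (by simp)
    have := Nat.dvd_gcd (orderOf_dvd_of_pow_eq_one hw) (orderOf_dvd_of_pow_eq_one hn)
    rw [hcop.gcd_eq_one, Nat.dvd_one, orderOf_eq_one_iff] at this
    exact this
  subst hr1
  rw [mul_one] at h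
  have hkce : k = (c * e)⁻¹ := eq_inv_of_mul_eq_one_left (by rw [← mul_assoc]; exact h)
  have hkcen : ∀ u, Commute k u := by
    intro u
    rw [hkce]
    exact ((hcc u).mul_left (hec u)).inv_left
  obtain rfl := X.eq_one_of_commute hk (hkcen x) (hkcen y)
  rw [one_mul] at h
  have hce : c = e := by
    rw [eq_inv_of_mul_eq_one_left h]
    exact inv_eq_of_mul_eq_one_left hee
  subst hce
  rcases hcz σe with rfl | rfl
  · simp
  · exact absurd he hzE

theorem exists_isQuaternionDecomposition (hσ : σ ≠ 1) :
    ∃ (E : Subgroup G) (g : G), IsQuaternionDecomposition σ x y P E g := by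
  have zc := X.z_comm
  obtain ⟨E, hE, hzE, hEz⟩ := exists_complement (T := centralInvolutions σ)
    (fun e he => ⟨he.1, he.2.2⟩) X.z_ne
  -- In a product kcr the factors k and r are even, so an odd element of G has an odd central factor
  -- c, and c² = z.
  obtain ⟨g, hg, hgg, σg⟩ : ∃ g, (∀ h, Commute g h) ∧ g * g = z ∧ σ g = -1 := by
    obtain ⟨h, hh⟩ : ∃ h, σ h ≠ 1 := by
      by_contra! hcon
      exact hσ (MonoidHom.ext hcon)
    obtain ⟨k, hk, c, r, hr, rfl, hc, ⟨h1, -⟩ | ⟨h1, h2⟩⟩ := X.decomp h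
    · rw [map_mul, map_mul, X.map_quaternion hk, h1, X.map_eq_one_of_mem hr] at hh
      exact absurd (by simp) hh
    · exact ⟨c, hc, h2, h1⟩
  have hx : x ∈ Subgroup.closure {x, y, g} := Subgroup.subset_closure (by simp)
  have hy : y ∈ Subgroup.closure {x, y, g} := Subgroup.subset_closure (by simp)
  have hg' : g ∈ Subgroup.closure {x, y, g} := Subgroup.subset_closure (by simp)
  have hle : Subgroup.closure {x, y} ≤ Subgroup.closure {x, y, g} :=
    Subgroup.closure_mono (by rintro a (rfl | rfl) <;> simp)
  have hzQ : z ∈ Subgroup.closure {x, y} := by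
    rw [← X.xx]
    exact mul_mem (Subgroup.subset_closure (by simp)) (Subgroup.subset_closure (by simp))
  have hkQ : ∀ k ∈ ({1, x, y, x * y} : Set G), k ∈ Subgroup.closure {x, y} := by
    have hx : x ∈ Subgroup.closure {x, y} := Subgroup.subset_closure (by simp)
    have hy : y ∈ Subgroup.closure {x, y} := Subgroup.subset_closure (by simp)
    rintro k (rfl | rfl | rfl | rfl)
    exacts [one_mem _, hx, hy, mul_mem hx hy]
  have hAC : ∀ a ∈ Subgroup.closure {x, y, g}, ∀ r ∈ P, Commute a r := by
    intro a ha r hr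
    have : Subgroup.closure {x, y, g} ≤ Subgroup.centralizer {r} := by
      rw [Subgroup.closure_le]
      obtain ⟨h1, h2, -⟩ := mem_evenCentralizer.1 (X.le hr)
      rintro a (rfl | rfl | rfl) <;>
        rw [SetLike.mem_coe, Subgroup.mem_centralizer_singleton_iff]
      exacts [h1.symm, h2.symm, hg r]
    exact Subgroup.mem_centralizer_singleton_iff.1 (this ha)
  have hAB : ∀ a : G, ∀ e ∈ E, Commute a e := fun a e he => ((hE he).1 a).symm
  have hinj := fun a ha e he r hr h =>
    X.eq_one_of_mul_eq_one hE hzE hg hgg σg (a := a) (e := e) (r := r) ha he hr h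
  have hcen : ∀ c, (∀ g, Commute c g) → σ c = 1 → c * c = 1 → c ∈ E ∨ z * c ∈ E :=
    fun c h1 h2 h3 => hEz c ⟨h1, h2, h3⟩
  refine ⟨E, g, fun e he => by rw [pow_two]; exact (hE he).2.2, ?_, hg x, hg y,
    by rw [pow_two, pow_two, hgg, X.xx], ?_, ?_⟩
  · rw [MonoidHom.mem_ker, σg]
    decide
  · refine isInternalProd_of (fun a _ => hAB a) (fun a ha => hAC a (hle ha))
      (fun e he r _ => (hE he).1 r) ?_ (fun e he => (hE he).2.1) (fun r => X.map_eq_one_of_mem) ?_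
      (fun a ha => hinj a (hle ha))
    · rw [Subgroup.closure_le]
      rintro a (rfl | rfl)
      exacts [X.map_x, X.map_y]
    · intro h hh
      obtain ⟨k, hk, c, r, hr, rfl, hc, hcc⟩ := X.decomp h
      rw [MonoidHom.mem_ker, map_mul, map_mul, X.map_quaternion hk, X.map_eq_one_of_mem hr,
        one_mul, mul_one] at hh
      have hcc : c * c = 1 := by
        rcases hcc with h | h
        · exact h.2
        · exact absurd (hh.symm.trans h.1) (by decide)
      rcases hcen c hc hh hcc with hc | hc
      · exact ⟨k, hkQ k hk, c, hc, r, hr, rfl⟩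
      · refine ⟨k * z, mul_mem (hkQ k hk) hzQ, z * c, hc, r, hr, ?_⟩
        simp only [mul_assoc]
        rw [← mul_assoc z z, X.zz, one_mul]
  · refine isInternalProd_of (fun a _ => hAB a) hAC
      (fun e he r _ => (hE he).1 r) le_top le_top le_top ?_ hinj
    intro h _
    obtain ⟨k, hk, c, r, hr, rfl, hc, hcc⟩ := X.decomp h
    have key : ∀ c, (∀ g, Commute c g) → σ c = 1 → c * c = 1 → ∀ a ∈ Subgroup.closure {x, y, g},
        ∃ b ∈ Subgroup.closure {x, y, g}, ∃ e ∈ E, a * c = b * e := by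
      intro c h1 h2 h3 a ha
      rcases hcen c h1 h2 h3 with hc | hc
      · exact ⟨a, ha, c, hc, rfl⟩
      · refine ⟨a * z, mul_mem ha (hle hzQ), z * c, hc, ?_⟩
        rw [← mul_assoc, mul_assoc a, X.zz, mul_one]
    have : ∃ b ∈ Subgroup.closure {x, y, g}, ∃ e ∈ E, k * c = b * e := by
      rcases hcc with ⟨h1, h2⟩ | ⟨h1, h2⟩
      · exact key c hc h1 h2 k (hle (hkQ k hk))
      -- An odd central factor c is made even by g: gc is central with (gc)² = z² = 1, and g⁻¹ is
      -- moved into ⟨x, y, g⟩.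
      · have := key (g * c) (fun h => (hg h).mul_left (hc h)) (by rw [map_mul, σg, h1]; decide)
          (by rw [Commute.mul_mul_mul_comm (hc g), hgg, h2, X.zz]) (k * g⁻¹)
          (mul_mem (hle (hkQ k hk)) (inv_mem hg'))
        rwa [← mul_assoc, inv_mul_cancel_right] at this
    obtain ⟨b, hb, e, he, hbe⟩ := this
    exact ⟨b, hb, e, he, r, hr, by rw [hbe]⟩

end IsQuaternionExtension

/-! ### The Lie series when `P` is abelian -/

section DiffProd

variable {F G : Type*} [Field F] [Group G]

theorem diffProd_succ {n : ℕ} (h : Fin (n + 1) → G) :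
    diffProd F h = dif F (h 0) * diffProd F fun i => h i.succ := by
  rw [diffProd, List.ofFn_succ, List.prod_cons]
  rfl

theorem commute_diffProd {n : ℕ} {h : Fin n → G} (hh : ∀ i, ∀ g, Commute (h i) g)
    (a : MonoidAlgebra F G) : Commute (diffProd F h) a := by
  induction n with
  | zero => simp [diffProd]
  | succ n ih =>
    rw [diffProd_succ]
    refine Commute.mul_left (Commute.sub_left ?_ ?_) (ih fun i => hh i.succ)
    · exact of_comm (hh 0) a
    · exact of_comm (fun g => (hh 0 g).inv_left) a

end DiffProd

namespace IsQuaternionDecomposition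

variable {G : Type*} [Group G] {σ : G →* ℤˣ} {x y z : G} {P E : Subgroup G} {g : G}
  (D : IsQuaternionDecomposition σ x y P E g)
include D

theorem mul_self_eq_one {e : G} (he : e ∈ E) : e * e = 1 := by rw [← pow_two, D.sq_eq_one e he]

theorem exists_eq (h : G) : ∃ a ∈ Subgroup.closure {x, y, g}, ∃ e ∈ E, ∃ r ∈ P, h = a * e * r := by
  obtain ⟨⟨a, e, r⟩, ⟨ha, he, hr⟩, rfl⟩ := D.prod_top.2.2.2.surjOn (Subgroup.mem_top h)
  exact ⟨a, ha, e, he, r, hr, rfl⟩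

theorem central_of_mem {e : G} (he : e ∈ E) (h : G) : Commute e h := by
  obtain ⟨a, ha, b, hb, r, hr, rfl⟩ := D.exists_eq h
  refine Commute.mul_right (Commute.mul_right (D.prod_top.1 a ha e he).symm ?_)
    (D.prod_top.2.2.1 e he r hr)
  have h1 := eq_inv_of_mul_eq_one_left (D.mul_self_eq_one (mul_mem he hb))
  rw [mul_inv_rev, ← eq_inv_of_mul_eq_one_left (D.mul_self_eq_one he),
    ← eq_inv_of_mul_eq_one_left (D.mul_self_eq_one hb)] at h1
  exact h1

theorem map_of_mem {e : G} (he : e ∈ E) : σ e = 1 := by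
  have := D.prod_ker.2.2.2.mapsTo (show ((1, e, 1) : G × G × G) ∈ _ from
    ⟨one_mem _, he, one_mem _⟩)
  simpa using this

theorem central_of_commute {c : G} (hx : Commute c x) (hy : Commute c y) (hg : Commute c g)
    (hE : ∀ e ∈ E, Commute c e) (hP : ∀ r ∈ P, Commute c r) (h : G) : Commute c h := by
  obtain ⟨a, ha, b, hb, r, hr, rfl⟩ := D.exists_eq h
  refine Commute.mul_right (Commute.mul_right ?_ (hE b hb)) (hP r hr)
  have : Subgroup.closure {x, y, g} ≤ Subgroup.centralizer {c} := by
    rw [Subgroup.closure_le]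
    rintro a (rfl | rfl | rfl) <;>
      rw [SetLike.mem_coe, Subgroup.mem_centralizer_singleton_iff]
    exacts [hx.symm, hy.symm, hg.symm]
  exact (Subgroup.mem_centralizer_singleton_iff.1 (this ha)).symm

theorem g_central (h : G) : Commute g h := by
  have hg : g ∈ Subgroup.closure {x, y, g} := Subgroup.subset_closure (by simp)
  exact D.central_of_commute D.comm_x D.comm_y (Commute.refl g) (D.prod_top.1 g hg)
    (D.prod_top.2.1 g hg) h

theorem p_central (hP : ∀ a ∈ P, ∀ b ∈ P, a * b = b * a) {r : G} (hr : r ∈ P) (h : G) :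
    Commute r h := by
  have hc : ∀ a ∈ Subgroup.closure {x, y, g}, Commute r a :=
    fun a ha => (D.prod_top.2.1 a ha r hr).symm
  exact D.central_of_commute (hc x (Subgroup.subset_closure (by simp)))
    (hc y (Subgroup.subset_closure (by simp))) (hc g (Subgroup.subset_closure (by simp)))
    (fun e he => (D.prod_top.2.2.1 e he r hr).symm) (hP r hr) h

theorem map_g : σ g = -1 :=
  (Int.units_eq_one_or (σ g)).resolve_left D.not_mem

variable (X : IsQuaternionExtension σ x y z P)
include X

theorem g_mul_g : g * g = z := by rw [← pow_two, D.sq_eq, pow_two, X.xx]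

/-- The subgroup `⟨z⟩ × E`. -/
def evenPart (_ : IsQuaternionDecomposition σ x y P E g)
    (X : IsQuaternionExtension σ x y z P) : Subgroup G :=
  adjoinCentral E z X.z_comm (by rw [X.zz]; exact one_mem E)

/-- The subgroup `⟨g⟩ × E`. -/
def centralPart (D : IsQuaternionDecomposition σ x y P E g)
    (X : IsQuaternionExtension σ x y z P) : Subgroup G :=
  adjoinCentral (D.evenPart X) g D.g_central
    (Or.inr (by rw [D.g_mul_g X, X.zz]; exact one_mem E))

theorem le_evenPart : E ≤ D.evenPart X := fun _ => Or.inl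

theorem z_mem_evenPart : z ∈ D.evenPart X := Or.inr (by rw [X.zz]; exact one_mem E)

theorem evenPart_le : D.evenPart X ≤ D.centralPart X := fun _ => Or.inl

theorem g_mem_centralPart : g ∈ D.centralPart X :=
  Or.inr (by rw [D.g_mul_g X]; exact D.z_mem_evenPart X)

theorem evenPart_spec {c : G} (hc : c ∈ D.evenPart X) :
    (∀ h, Commute c h) ∧ σ c = 1 ∧ c * c = 1 := by
  have key : ∀ e ∈ E, (∀ h, Commute e h) ∧ σ e = 1 ∧ e * e = 1 :=
    fun e he => ⟨D.central_of_mem he, D.map_of_mem he, D.mul_self_eq_one he⟩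
  rcases hc with hc | hc
  · exact key c hc
  · obtain ⟨h1, h2, h3⟩ := key _ hc
    have e : c = c * z * z := by rw [mul_assoc, X.zz, mul_one]
    rw [e]
    refine ⟨fun h => (h1 h).mul_left (X.z_comm h), by rw [map_mul, h2, X.map_z, one_mul], ?_⟩
    rw [Commute.mul_mul_mul_comm (X.z_comm _), h3, X.zz, one_mul]

theorem mem_centralPart {c : G} (hc : c ∈ D.centralPart X) :
    c ∈ D.evenPart X ∨ ∃ b ∈ D.evenPart X, c = g * b := by
  rcases hc with hc | hc
  · exact Or.inl hc
  · refine Or.inr ⟨z * (c * g), mul_mem (D.z_mem_evenPart X) hc, ?_⟩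
    rw [← D.g_central c, X.z_comm, ← mul_assoc, ← mul_assoc, D.g_mul_g X, mul_assoc, ← X.z_comm c,
      ← mul_assoc, X.zz, one_mul]

theorem centralPart_spec {c : G} (hc : c ∈ D.centralPart X) :
    (∀ h, Commute c h) ∧ ((σ c = 1 ∧ c * c = 1) ∨ (σ c = -1 ∧ c * c = z)) := by
  rcases D.mem_centralPart X hc with hc | ⟨b, hb, rfl⟩
  · obtain ⟨h1, h2⟩ := D.evenPart_spec X hc
    exact ⟨h1, Or.inl h2⟩
  · obtain ⟨h1, h2, h3⟩ := D.evenPart_spec X hb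
    refine ⟨fun h => (D.g_central h).mul_left (h1 h), Or.inr ⟨?_, ?_⟩⟩
    · rw [map_mul, h2, D.map_g, mul_one]
    · rw [Commute.mul_mul_mul_comm (h1 g), h3, D.g_mul_g X, mul_one]

theorem exists_eq_mul (h : G) : ∃ k ∈ ({1, x, y, x * y} : Set G), ∃ c ∈ D.centralPart X, ∃ r ∈ P,
    h = k * c * r := by
  obtain ⟨a, ha, e, he, r, hr, rfl⟩ := D.exists_eq h
  obtain ⟨k, hk, c, hc, rfl⟩ :=
    X.exists_of_mem_closure_triple X.z_comm D.g_central (D.g_mul_g X) ha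
  refine ⟨k, hk, c * e, mul_mem ?_ (D.evenPart_le X (D.le_evenPart X he)), r, hr, by
    simp only [mul_assoc]⟩
  have hz := D.evenPart_le X (D.z_mem_evenPart X)
  have hg := D.g_mem_centralPart X
  rcases hc with rfl | rfl | rfl | rfl
  exacts [one_mem _, hz, hg, mul_mem hz hg]

/-- The products `(h₁ - h₁⁻¹) ⋯ (h_n - h_n⁻¹) c` with `h_i ∈ P` and `c ∈ ⟨g⟩ × E`. -/
def coeffSet (D : IsQuaternionDecomposition σ x y P E g)
    (X : IsQuaternionExtension σ x y z P) (F : Type*) [Field F] (n : ℕ) : Set (MonoidAlgebra F G) :=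
  {u | ∃ h : Fin n → G, (∀ i, h i ∈ P) ∧ ∃ c ∈ D.centralPart X, u = diffProd F h * of F G c}

variable {F : Type*} [Field F]

theorem eq_mul_of_mem_coeffSet {n : ℕ} {u : MonoidAlgebra F G} (hu : u ∈ D.coeffSet X F (n + 1)) :
    ∃ v ∈ D.coeffSet X F 1, ∃ w ∈ D.coeffSet X F n, u = v * w := by
  obtain ⟨h, hh, c, hc, rfl⟩ := hu
  refine ⟨dif F (h 0), ⟨fun _ => h 0, fun _ => hh 0, 1, one_mem _, ?_⟩, _,
    ⟨fun i => h i.succ, fun i => hh i.succ, c, hc, rfl⟩, ?_⟩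
  · rw [map_one, mul_one, diffProd_succ]
    simp [diffProd]
  · rw [diffProd_succ, mul_assoc]

theorem mem_coeffSet_one {u : MonoidAlgebra F G} (hu : u ∈ D.coeffSet X F 1) :
    ∃ r ∈ P, ∃ c ∈ D.centralPart X, u = dif F r * of F G c := by
  obtain ⟨h, hh, c, hc, rfl⟩ := hu
  refine ⟨h 0, hh 0, c, hc, ?_⟩
  rw [diffProd_succ]
  simp [diffProd]

theorem dif_mul_mem_coeffSet {r c : G} (hr : r ∈ P) (hc : c ∈ D.centralPart X) :
    dif F r * of F G c ∈ D.coeffSet X F 1 := by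
  refine ⟨fun _ => r, fun _ => hr, c, hc, ?_⟩
  rw [diffProd_succ]
  simp [diffProd]

theorem mul_mem_coeffSet {n : ℕ} {v u : MonoidAlgebra F G} (hv : v ∈ D.coeffSet X F 1)
    (hu : u ∈ D.coeffSet X F n) : v * u ∈ D.coeffSet X F (n + 1) := by
  obtain ⟨r, hr, c, hc, rfl⟩ := D.mem_coeffSet_one X hv
  obtain ⟨h, hh, c', hc', rfl⟩ := hu
  refine ⟨Fin.cons r h, fun i => ?_, c * c', mul_mem hc hc', ?_⟩
  · refine Fin.cases ?_ (fun i => ?_) i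
    · exact hr
    · exact hh i
  · rw [diffProd_succ, map_mul]
    have hcom := of_comm (F := F) (D.centralPart_spec X hc).1 (diffProd F h)
    simp only [Fin.cons_zero, Fin.cons_succ, mul_assoc]
    rw [← mul_assoc (of F G c), hcom.eq, mul_assoc]

variable (hP : ∀ a ∈ P, ∀ b ∈ P, a * b = b * a)
include hP

theorem commute_of_mem_coeffSet {n : ℕ} {u : MonoidAlgebra F G} (hu : u ∈ D.coeffSet X F n)
    (a : MonoidAlgebra F G) : Commute u a := by
  obtain ⟨h, hh, c, hc, rfl⟩ := hu
  exact (commute_diffProd (fun i => D.p_central hP (hh i)) a).mul_left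
    (of_comm (D.centralPart_spec X hc).1 a)

omit hP in
theorem exists_of_mem_sup {a : G} (ha : a ∈ Subgroup.closure {x, y} ⊔ E) :
    ∃ k ∈ ({1, x, y, x * y} : Set G), ∃ b ∈ D.evenPart X, a = k * b := by
  have hE : E.Normal := ⟨fun e he h => by
    rwa [← D.central_of_mem he h, mul_inv_cancel_right]⟩
  obtain ⟨q, hq, e, he, rfl⟩ := Subgroup.mem_sup_of_normal_right.1 ha
  obtain ⟨k, hk, rfl | rfl⟩ := X.exists_of_mem_closure_pair X.z_comm hq
  · exact ⟨q, hk, e, D.le_evenPart X he, rfl⟩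
  · exact ⟨k, hk, z * e, mul_mem (D.z_mem_evenPart X) (D.le_evenPart X he), mul_assoc _ _ _⟩

omit hP in
theorem mul_mem_sup {k b : G} (hk : k ∈ ({1, x, y, x * y} : Set G)) (hb : b ∈ D.evenPart X) :
    k * b ∈ Subgroup.closure {x, y} ⊔ E := by
  have hx : x ∈ Subgroup.closure {x, y} := Subgroup.subset_closure (by simp)
  have hy : y ∈ Subgroup.closure {x, y} := Subgroup.subset_closure (by simp)
  have hk' : k ∈ Subgroup.closure {x, y} := by
    rcases hk with rfl | rfl | rfl | rfl
    exacts [one_mem _, hx, hy, mul_mem hx hy]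
  refine mul_mem (Subgroup.mem_sup_left hk') ?_
  rcases hb with hb | hb
  · exact Subgroup.mem_sup_right hb
  · rw [← X.xx] at hb
    exact (Subgroup.mul_mem_cancel_right _ (Subgroup.mem_sup_left (mul_mem hx hx))).1
      (Subgroup.mem_sup_right hb)

/-- A noncentral a is kb with k ∈ {x, y, xy} and b central with b² = 1. Hence a² = z always, and 1 -
a² is the fixed factor f. -/
theorem halfGenSet_eq (n : ℕ) : halfGenSet F P (Subgroup.closure {x, y} ⊔ E) n =
    {a | ∃ k ∈ ({x, y, x * y} : Set G), ∃ h : Fin n → G, (∀ i, h i ∈ P) ∧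
      ∃ b ∈ D.evenPart X, a = twist F z * of F G k * (diffProd F h * of F G b)} := by
  have key : ∀ {k b : G}, k ∈ ({1, x, y, x * y} : Set G) → k ≠ 1 → b ∈ D.evenPart X →
      ∀ h : Fin n → G, (∀ i, h i ∈ P) →
      diffProd F h * (1 - of F G ((k * b) ^ 2)) * of F G (k * b) =
        twist F z * of F G k * (diffProd F h * of F G b) := by
    intro k b hk hk1 hb h hh
    obtain ⟨h1, -, h2⟩ := D.evenPart_spec X hb
    have e : (k * b) ^ 2 = z := by
      rw [(h1 k).symm.mul_pow, pow_two, pow_two, h2, mul_one]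
      exact (X.mul_self_of_mem hk).resolve_left hk1
    have hc := commute_diffProd (F := F) fun i => D.p_central hP (hh i)
    rw [e, map_mul, ← twist, (hc _).eq, mul_assoc, ← mul_assoc (diffProd F h),
      (hc (of F G k)).eq]
    simp only [mul_assoc]
  ext a
  constructor
  · rintro ⟨h, hh, a, ⟨ha, hac⟩, rfl⟩
    obtain ⟨k, hk, b, hb, rfl⟩ := D.exists_of_mem_sup X ha
    have hk1 : k ≠ 1 := by
      rintro rfl
      refine hac ⟨⟨1 * b, ha⟩, ?_, rfl⟩
      rw [SetLike.mem_coe, Subgroup.mem_center_iff]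
      intro u
      refine Subtype.ext ?_
      change (u : G) * (1 * b) = 1 * b * u
      rw [one_mul]
      exact ((D.evenPart_spec X hb).1 u).symm
    exact ⟨k, hk.resolve_left hk1, h, hh, b, hb, key hk hk1 hb h hh⟩
  · rintro ⟨k, hk, h, hh, b, hb, rfl⟩
    have hk' : k ∈ ({1, x, y, x * y} : Set G) := Or.inr hk
    have hxy : ¬ (Commute k x ∧ Commute k y) := by
      rintro ⟨h1, h2⟩
      have hk1 := X.eq_one_of_commute hk' h1 h2
      have hne := X.xy_ne
      rcases hk with rfl | rfl | rfl
      · simp [hk1] at hne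
      · simp [hk1] at hne
      · rw [X.yx, hk1, one_mul] at hne
        exact X.z_ne (X.toIsQuaternionPair.zz ▸ (by
          have := X.xy_mul_xy
          rw [hk1, one_mul] at this
          rw [X.zz, this]))
    have hk1 : k ≠ 1 := by
      rintro rfl
      exact hxy ⟨Commute.one_left x, Commute.one_left y⟩
    refine ⟨h, hh, k * b, ⟨D.mul_mem_sup X hk' hb, ?_⟩, (key hk' hk1 hb h hh).symm⟩
    rintro ⟨⟨c, hc⟩, hcc, hcb⟩
    change c = k * b at hcb
    subst hcb
    rw [SetLike.mem_coe, Subgroup.mem_center_iff] at hcc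
    have hcc' : ∀ u ∈ Subgroup.closure {x, y} ⊔ E, Commute k u := by
      intro u hu
      have h1 : u * (k * b) = k * b * u := congrArg Subtype.val (hcc ⟨u, hu⟩)
      rw [mul_assoc, (D.evenPart_spec X hb).1 u, ← mul_assoc, ← mul_assoc] at h1
      exact (mul_right_cancel h1).symm
    exact hxy ⟨hcc' x (Subgroup.mem_sup_left (Subgroup.subset_closure (by simp))),
      hcc' y (Subgroup.mem_sup_left (Subgroup.subset_closure (by simp)))⟩

/-- The two halves of the generating set correspond to the two cosets of ⟨z⟩E in ⟨g⟩E, so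
multiplication by g is absorbed into the central factor. -/
theorem genSet_eq (n : ℕ) : genSet F P (Subgroup.closure {x, y} ⊔ E) g n =
    {a | ∃ k ∈ ({x, y, x * y} : Set G), ∃ u ∈ D.coeffSet X F n,
      a = twist F z * of F G k * u} := by
  have key : ∀ (k b : G) (d : MonoidAlgebra F G), of F G g * (twist F z * of F G k *
      (d * of F G b)) = twist F z * of F G k * (d * of F G (g * b)) := by
    intro k b d
    have hc := of_comm (F := F) D.g_central
    rw [map_mul, ← mul_assoc, (hc _).eq, mul_assoc, ← mul_assoc (of F G g), (hc d).eq, mul_assoc d]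
  rw [genSet, D.halfGenSet_eq X hP]
  ext a
  constructor
  · rintro (⟨k, hk, h, hh, b, hb, rfl⟩ | ⟨_, ⟨k, hk, h, hh, b, hb, rfl⟩, rfl⟩)
    · exact ⟨k, hk, _, ⟨h, hh, b, D.evenPart_le X hb, rfl⟩, rfl⟩
    · exact ⟨k, hk, _, ⟨h, hh, g * b, mul_mem (D.g_mem_centralPart X) (D.evenPart_le X hb), rfl⟩,
        key _ _ _⟩
  · rintro ⟨k, hk, _, ⟨h, hh, c, hc, rfl⟩, rfl⟩
    rcases D.mem_centralPart X hc with hc | ⟨b, hb, rfl⟩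
    · exact Or.inl ⟨k, hk, h, hh, c, hc, rfl⟩
    · exact Or.inr ⟨_, ⟨k, hk, h, hh, b, hb, rfl⟩, key _ _ _⟩

end IsQuaternionDecomposition

/-- For central u and v the Jordan product uv + vu is 2vu, which gives the factor 4. -/
theorem IsTwistedQuaternion.commutator_eq {F R : Type*} [Field F] [Ring R] [Algebra F R]
    {f i j k : R} (H : IsTwistedQuaternion f i j k) {a b c u v : R} (hu : ∀ a, Commute u a)
    (hv : ∀ a, Commute v a) (hab : f * (a * b) = f * c) (hba : f * (b * a) = -(f * c)) :
    f * a * u * (f * b * v) - f * b * v * (f * a * u) = (4 : F) • (f * c * (v * u)) := by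
  rw [H.mul_mul (hu b), H.mul_mul (hv a), hab, hba, (hu v).eq,
    show (4 : F) = 1 + 1 + 1 + 1 by norm_num]
  simp only [add_smul, one_smul]
  noncomm_ring

namespace IsQuaternionDecomposition

variable {F G : Type*} [Field F] [Group G] {σ : G →* ℤˣ} {x y z : G} {P E : Subgroup G} {g : G}
  (D : IsQuaternionDecomposition σ x y P E g) (X : IsQuaternionExtension σ x y z P)
include X

omit X in
/-- Commutators of basic elements, up to sign and the factor `4`. -/
theorem exists_commutator_eq
    (H : IsTwistedQuaternion (twist F z) (of F G x) (of F G y) (of F G (x * y))) {k : G}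
    (hk : k ∈ ({x, y, x * y} : Set G)) :
    ∃ a ∈ ({x, y, x * y} : Set G), ∃ b ∈ ({x, y, x * y} : Set G),
      ∀ u v : MonoidAlgebra F G, (∀ a, Commute u a) → (∀ a, Commute v a) →
        twist F z * of F G a * u * (twist F z * of F G b * v) -
          twist F z * of F G b * v * (twist F z * of F G a * u) =
            (4 : F) • (twist F z * of F G k * (v * u)) := by
  rcases hk with rfl | rfl | rfl
  · exact ⟨y, by simp, k * y, by simp, fun u v hu hv => H.commutator_eq hu hv H.jk H.kj⟩
  · exact ⟨x * k, by simp, x, by simp, fun u v hu hv => H.commutator_eq hu hv H.ki H.ik⟩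
  · exact ⟨x, by simp, y, by simp, fun u v hu hv => H.commutator_eq hu hv H.ij H.ji⟩

omit X in
theorem commutator_mem_span
    (H : IsTwistedQuaternion (twist F z) (of F G x) (of F G y) (of F G (x * y))) {V : Submodule F (MonoidAlgebra F G)}
    {u v : MonoidAlgebra F G} (hu : ∀ a, Commute u a) (hv : ∀ a, Commute v a)
    (hV : ∀ k ∈ ({x, y, x * y} : Set G), twist F z * of F G k * (v * u) ∈ V) {a b : G}
    (ha : a ∈ ({x, y, x * y} : Set G)) (hb : b ∈ ({x, y, x * y} : Set G)) :
    twist F z * of F G a * u * (twist F z * of F G b * v) -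
      twist F z * of F G b * v * (twist F z * of F G a * u) ∈ V := by
  have hself : ∀ c : G, twist F z * of F G c * u * (twist F z * of F G c * v) -
      twist F z * of F G c * v * (twist F z * of F G c * u) ∈ V := by
    intro c
    rw [H.mul_mul (hu _), H.mul_mul (hv _), (hu v).eq, sub_self]
    exact zero_mem V
  have h1 : ∀ {a b c : MonoidAlgebra F G}, twist F z * (a * b) = twist F z * c →
      twist F z * (b * a) = -(twist F z * c) → twist F z * c * (v * u) ∈ V →
      twist F z * a * u * (twist F z * b * v) - twist F z * b * v * (twist F z * a * u) ∈ V := by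
    intro a b c hab hba hc
    rw [H.commutator_eq (F := F) hu hv hab hba]
    exact V.smul_mem _ hc
  have h2 : ∀ {a b c : MonoidAlgebra F G}, twist F z * (b * a) = twist F z * c →
      twist F z * (a * b) = -(twist F z * c) → twist F z * c * (v * u) ∈ V →
      twist F z * a * u * (twist F z * b * v) - twist F z * b * v * (twist F z * a * u) ∈ V := by
    intro a b c hab hba hc
    rw [← neg_sub, H.commutator_eq (F := F) hv hu hab hba, (hu v).eq]
    exact neg_mem (V.smul_mem _ hc)
  have hx := hV x (by simp)
  have hy := hV y (by simp)
  have hxy := hV (x * y) (by simp)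
  have comb : ∀ (a b : G) {a' b' : G}, a = a' → b = b' →
      (twist F z * of F G a * u * (twist F z * of F G b * v) -
        twist F z * of F G b * v * (twist F z * of F G a * u) ∈ V) →
      (twist F z * of F G a' * u * (twist F z * of F G b' * v) -
        twist F z * of F G b' * v * (twist F z * of F G a' * u) ∈ V) := by
    rintro a b _ _ rfl rfl h
    exact h
  rcases ha with ha | ha | ha <;> rcases hb with hb | hb | hb <;>
    refine comb _ _ ha.symm hb.symm ?_
  · exact hself x
  · exact h1 H.ij H.ji hxy
  · exact h2 H.ki H.ik hy
  · exact h2 H.ij H.ji hxy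
  · exact hself y
  · exact h1 H.jk H.kj hx
  · exact h1 H.ki H.ik hy
  · exact h2 H.jk H.kj hx
  · exact hself (x * y)

variable (hP : ∀ a ∈ P, ∀ b ∈ P, a * b = b * a)
include D hP

/-- Two sign changes balance: c⁻¹ = c when σ(c) = 1 and c⁻¹ = zc when σ(c) = -1, while f z = -f. In
both cases the inverse contributes -f k r⁻¹ c. -/
theorem twist_mul_sy {k c r : G} (hk : k ∈ ({x, y, x * y} : Set G)) (hc : c ∈ D.centralPart X)
    (hr : r ∈ P) :
    twist F z * sy F σ (k * c * r) = twist F z * of F G k * (dif F r * of F G c) := by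
  obtain ⟨hcc, hcσ⟩ := D.centralPart_spec X hc
  have hrc := D.p_central hP hr
  have hk' : k ∈ ({1, x, y, x * y} : Set G) := Or.inr hk
  have hkinv : k⁻¹ = k * z := by
    rcases hk with rfl | rfl | rfl
    · exact X.x_inv
    · exact X.y_inv
    · exact X.right.y_inv
  have hσ : σ (k * c * r) = σ c := by
    rw [map_mul, map_mul, X.map_quaternion hk', X.map_eq_one_of_mem hr, one_mul, mul_one]
  have hinv : (k * c * r)⁻¹ = k * z * c⁻¹ * r⁻¹ := by
    rw [mul_inv_rev, mul_inv_rev, hkinv, ((hcc (k * z)).inv_left).eq,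
      ((hrc _).inv_left).eq]
  have fz : twist F z * of F G z = -twist F z := twist_mul_of X.zz
  have hzk : ∀ a : G, twist F z * of F G (k * z * a) = -(twist F z * of F G (k * a)) := by
    intro a
    rw [← X.z_comm, mul_assoc, map_mul, ← mul_assoc, fz, neg_mul]
  have e : twist F z * of F G k * (dif F r * of F G c) =
      twist F z * of F G (k * c * r) - twist F z * of F G (k * c * r⁻¹) := by
    rw [dif, sub_mul, mul_sub, ← map_mul, ← map_mul, hrc c, ((hrc c).inv_left).eq, mul_assoc,
      mul_assoc, ← map_mul, ← map_mul, mul_assoc, mul_assoc]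
  rw [e, sy, mul_add, mul_smul_comm, hinv, sgn, hσ]
  rcases hcσ with ⟨h1, h2⟩ | ⟨h1, h2⟩
  · rw [h1, ← eq_inv_of_mul_eq_one_left h2, mul_assoc (k * z), hzk]
    simp [mul_assoc, sub_eq_add_neg]
  · have hcinv : c⁻¹ = z * c := inv_eq_of_mul_eq_one_left (by rw [mul_assoc, h2, X.zz])
    rw [h1, hcinv, ← mul_assoc (k * z), mul_assoc k z z, X.zz, mul_one]
    simp [sub_eq_add_neg]

theorem span_genSet_one_le (h2 : (2 : F) ≠ 0) :
    Submodule.span F (genSet F P (Subgroup.closure {x, y} ⊔ E) g 1) ≤ symmSub F σ := by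
  rw [D.genSet_eq X hP, Submodule.span_le]
  rintro _ ⟨k, hk, u, hu, rfl⟩
  obtain ⟨r, hr, c, hc, rfl⟩ := D.mem_coeffSet_one X hu
  rw [← D.twist_mul_sy X hP hk hc hr]
  exact twist_mul_mem h2 X.z_comm X.zz X.map_z (sy_mem σ _)

/-- When P is abelian it is central, so all commutators of G lie in ⟨z⟩, and 1 + z absorbs z. -/
theorem one_add_mul_comm (a b : MonoidAlgebra F G) :
    Commute ((1 + of F G z) * a) b := by
  have zc := of_comm (F := F) X.z_comm
  have z1 : (1 + of F G z) * of F G z = 1 + of F G z := by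
    rw [add_mul, one_mul, ← map_mul, X.zz, map_one, add_comm]
  have zc1 : ∀ a, Commute (1 + of F G z) a := fun a => (Commute.one_left a).add_left (zc a)
  induction b using MonoidAlgebra.induction_on with
  | add b c hb hc => exact hb.add_right hc
  | smul r b hb => exact hb.smul_right r
  | of b =>
    induction a using MonoidAlgebra.induction_on with
    | add a c ha hc => rw [mul_add]; exact ha.add_left hc
    | smul r a ha => rw [mul_smul_comm]; exact ha.smul_left r
    | of a =>
      obtain ⟨k, hk, c, hc, r, hr, rfl⟩ := D.exists_eq_mul X b
      have hw : ∀ h, Commute (c * r) h := fun h =>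
        ((D.centralPart_spec X hc).1 h).mul_left (D.p_central hP hr h)
      have h1 : a * (k * c * r) = k * c * r * a ∨ a * (k * c * r) = z * (k * c * r * a) := by
        rcases X.commute_mod hk a with h | h
        · left
          rw [mul_assoc k, ← mul_assoc, h, mul_assoc, ← hw a, mul_assoc k]
        · right
          rw [mul_assoc k, ← mul_assoc, h, ← X.z_comm (k * a), mul_assoc z, mul_assoc k a, ← (hw a).eq,
            ← mul_assoc k]
      rw [commute_iff_eq, mul_assoc, ← map_mul, ← mul_assoc (of F G (k * c * r)),
        ← (zc1 _).eq, mul_assoc (1 + of F G z), ← map_mul]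
      rcases h1 with h | h
      · rw [h]
      · rw [h, map_mul, ← mul_assoc, z1]

theorem symmSub_le (h2 : (2 : F) ≠ 0) : symmSub F σ ≤
    Subalgebra.toSubmodule (Subalgebra.center F (MonoidAlgebra F G)) ⊔
      Submodule.span F (genSet F P (Subgroup.closure {x, y} ⊔ E) g 1) := by
  have hcen : ∀ {a : MonoidAlgebra F G}, (∀ b, Commute a b) →
      a ∈ Subalgebra.toSubmodule (Subalgebra.center F (MonoidAlgebra F G)) := fun h =>
    (Subalgebra.mem_center_iff (R := F)).2 fun b => (h b).symm
  rw [symmSub_eq_span h2, Submodule.span_le]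
  rintro _ ⟨h, rfl⟩
  obtain ⟨k, hk, c, hc, r, hr, rfl⟩ := D.exists_eq_mul X h
  rcases hk with rfl | hk
  · refine Submodule.mem_sup_left (hcen fun b => ?_)
    have hw : ∀ h, Commute (1 * c * r) h := fun h => by
      rw [one_mul]
      exact ((D.centralPart_spec X hc).1 h).mul_left (D.p_central hP hr h)
    exact (of_comm hw b).add_left ((of_comm (fun h => (hw h).inv_left) b).smul_left _)
  · apply mem_of_add_self_mem h2
    -- In 2s = (1 + z)s + (1 - z)s the first summand is central and the second is a generator.
    have e : sy F σ (k * c * r) + sy F σ (k * c * r) =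
        (1 + of F G z) * sy F σ (k * c * r) + twist F z * sy F σ (k * c * r) := by
      rw [twist]; noncomm_ring
    rw [e]
    refine add_mem (Submodule.mem_sup_left (hcen (D.one_add_mul_comm X hP _)))
      (Submodule.mem_sup_right (Submodule.subset_span ?_))
    rw [D.genSet_eq X hP, D.twist_mul_sy X hP hk hc hr]
    exact ⟨k, hk, _, D.dif_mul_mem_coeffSet X hr hc, rfl⟩

theorem exists_commutator_eq_of_mem (h2 : (2 : F) ≠ 0) {s : MonoidAlgebra F G}
    (hs : s ∈ symmSub F σ) :
    ∃ v ∈ Submodule.span F (genSet F P (Subgroup.closure {x, y} ⊔ E) g 1),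
      ∀ a, a * s - s * a = a * v - v * a := by
  obtain ⟨c, hc, v, hv, rfl⟩ := Submodule.mem_sup.1 (D.symmSub_le X hP h2 hs)
  refine ⟨v, hv, fun a => ?_⟩
  have : a * c = c * a := (Subalgebra.mem_center_iff (R := F)).1 hc a
  rw [mul_add, add_mul, this, add_sub_add_left_eq_sub]

theorem commutator_mem_span_genSet
    (H : IsTwistedQuaternion (twist F z) (of F G x) (of F G y) (of F G (x * y))) {n : ℕ}
    {a b : MonoidAlgebra F G}
    (ha : a ∈ Submodule.span F (genSet F P (Subgroup.closure {x, y} ⊔ E) g n))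
    (hb : b ∈ Submodule.span F (genSet F P (Subgroup.closure {x, y} ⊔ E) g 1)) :
    a * b - b * a ∈ Submodule.span F (genSet F P (Subgroup.closure {x, y} ⊔ E) g (n + 1)) := by
  have h1 : Submodule.span F (genSet F P (Subgroup.closure {x, y} ⊔ E) g n) ≤
      (Submodule.span F (genSet F P (Subgroup.closure {x, y} ⊔ E) g (n + 1))).comap
        (LinearMap.mulRight F b - LinearMap.mulLeft F b) := by
    rw [Submodule.span_le]
    intro a ha
    have h2 : Submodule.span F (genSet F P (Subgroup.closure {x, y} ⊔ E) g 1) ≤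
        (Submodule.span F (genSet F P (Subgroup.closure {x, y} ⊔ E) g (n + 1))).comap
          (LinearMap.mulLeft F a - LinearMap.mulRight F a) := by
      rw [Submodule.span_le]
      intro b hb
      rw [D.genSet_eq X hP] at ha hb
      obtain ⟨k, hk, u, hu, rfl⟩ := ha
      obtain ⟨l, hl, v, hv, rfl⟩ := hb
      refine commutator_mem_span H (D.commute_of_mem_coeffSet X hP hu)
        (D.commute_of_mem_coeffSet X hP hv) (fun c hc => Submodule.subset_span ?_) hk hl
      rw [D.genSet_eq X hP]
      exact ⟨c, hc, _, D.mul_mem_coeffSet X hv hu, rfl⟩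
    exact h2 hb
  exact h1 ha

/-- Modulo the centre FG⁺ is the span of the generators with k = 1, and bracketing with these adds
one factor r - r⁻¹. The equality starts at level 2, where central summands have disappeared. -/
theorem lieSub_symmSub_eq (h2 : (2 : F) ≠ 0)
    (H : IsTwistedQuaternion (twist F z) (of F G x) (of F G y) (of F G (x * y))) (n : ℕ) :
    lieSub (symmSub F σ) (n + 2) =
      Submodule.span F (genSet F P (Subgroup.closure {x, y} ⊔ E) g (n + 2)) := by
  have h4 : (4 : F) ≠ 0 := by
    rw [show (4 : F) = 2 * 2 by norm_num]
    exact mul_ne_zero h2 h2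
  have hle := D.span_genSet_one_le X hP h2
  apply le_antisymm
  · induction n with
    | zero =>
      rw [lieSub, Submodule.span_le]
      rintro _ ⟨a, ha, b, hb, rfl⟩
      obtain ⟨v, hv, hv'⟩ := D.exists_commutator_eq_of_mem X hP h2 hb
      obtain ⟨w, hw, hw'⟩ := D.exists_commutator_eq_of_mem X hP h2 (s := a) ha
      rw [hv', ← neg_sub, hw', neg_sub]
      exact D.commutator_mem_span_genSet X hP H hw hv
    | succ n ih =>
      rw [lieSub, Submodule.span_le]
      rintro _ ⟨a, ha, b, hb, rfl⟩
      obtain ⟨v, hv, hv'⟩ := D.exists_commutator_eq_of_mem X hP h2 hb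
      rw [hv']
      exact D.commutator_mem_span_genSet X hP H (ih ha) hv
  · have key : ∀ n, Submodule.span F (genSet F P (Subgroup.closure {x, y} ⊔ E) g (n + 1)) ≤
        lieSub (symmSub F σ) (n + 1) := by
      intro n
      induction n with
      | zero => exact hle
      | succ n ih =>
        rw [D.genSet_eq X hP] at ih
        rw [Submodule.span_le] at ih ⊢
        rw [D.genSet_eq X hP]
        rw [D.genSet_eq X hP, Submodule.span_le] at hle
        rintro _ ⟨k, hk, u, hu, rfl⟩
        -- One factor r - r⁻¹ is split off. Writing k, up to f, as a product of two other units
        -- displays the generator as a quarter of a commutator.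
        obtain ⟨v, hv, w, hw, rfl⟩ := D.eq_mul_of_mem_coeffSet X hu
        obtain ⟨a, ha, b, hb, hab⟩ := exists_commutator_eq H hk
        have h1 := commutator_mem_lieSub (by omega) (ih ⟨a, ha, w, hw, rfl⟩) (hle ⟨b, hb, v, hv, rfl⟩)
        rw [hab w v (D.commute_of_mem_coeffSet X hP hw) (D.commute_of_mem_coeffSet X hP hv)] at h1
        simpa [smul_smul, h4] using Submodule.smul_mem _ (4⁻¹ : F) h1
    exact key (n + 1)

end IsQuaternionDecomposition

end SymmLie
end

theorem mainTheorem4 {F G : Type*} [Field F] [Group G] (p : ℕ) [CharP F p] (hp : 2 < p)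
    (σ : G →* ℤˣ) (hσ : σ ≠ 1)
    (x y : G) (hQ : Nonempty (Subgroup.closure ({x, y} : Set G) ≃* QuaternionGroup 2))
    (hLie : SymmLie.IsLieNilpotent (SymmLie.symm F σ))
    (P : Sylow p G) (m : ℕ) (hm : 1 ≤ m) (hP : Nat.card P = p ^ m) :
    -- (i), together with the facts that make the indices well defined
    (SymmLie.IsStronglyLieNilpotent (SymmLie.symm F σ) ∧
      SymmLie.IsNilpotentSubset (SymmLie.symmUnits F σ) ∧
      (∃ n : ℕ, SymmLie.augIdeal F P ^ n = ⊥) ∧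
      1 + m * (p - 1) ≤ SymmLie.lieIndex (SymmLie.symm F σ) ∧
      SymmLie.lieIndex (SymmLie.symm F σ) ≤ SymmLie.upperLieIndex (SymmLie.symm F σ) ∧
      SymmLie.upperLieIndex (SymmLie.symm F σ) ≤ SymmLie.tNil F P ∧
      SymmLie.nilClass (SymmLie.symmUnits F σ) + 1 ≤ SymmLie.tNil F P) ∧
    -- (ii)
    (SymmLie.lieIndex (SymmLie.symm F σ) = SymmLie.tNil F P →
      SymmLie.nilClass (SymmLie.symmUnits F σ) + 1 = SymmLie.lieIndex (SymmLie.symm F σ)) ∧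
    -- (iii)
    (SymmLie.IsPowerful p P →
      SymmLie.lieIndex (SymmLie.symm F σ) = SymmLie.tNil F P) ∧
    -- (iv): the decomposition exists, and for each one the spanning statement holds
    (∃ (E : Subgroup G) (g : G), SymmLie.IsQuaternionDecomposition σ x y P E g) ∧
    ((∀ a ∈ (P : Subgroup G), ∀ b ∈ (P : Subgroup G), a * b = b * a) →
      ∀ (E : Subgroup G) (g : G), SymmLie.IsQuaternionDecomposition σ x y P E g →
        ∀ k : ℕ, 2 ≤ k →
          SymmLie.lieSeries (SymmLie.symm F σ) k =
            (Submodule.span F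
              (SymmLie.genSet F (P : Subgroup G) (Subgroup.closure {x, y} ⊔ E) g k) :
              Set (MonoidAlgebra F G))) := by
  have : Fact p.Prime := ⟨(CharP.char_is_prime_or_zero F p).resolve_right (by omega)⟩
  have h2 := SymmLie.two_ne_zero_of_charP F hp
  have Q := SymmLie.isQuaternionPair_of_equiv hQ
  rw [← SymmLie.coe_symmSub] at hLie ⊢
  obtain ⟨X, hδ⟩ := SymmLie.isQuaternionExtension hp Q hLie P
  obtain ⟨h3, h4, h5, -, -⟩ := X.indices hp hLie hδ hm hP
  refine ⟨⟨X.isStronglyLieNilpotent hp hLie hδ hm hP,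
    X.isNilpotentSubset_symmUnits hp hLie hδ hm hP, ?_, by omega, h4, h5,
    X.nilClass_symmUnits_lt hp hLie hδ hm hP⟩, fun h => ?_,
    X.lieIndex_eq_of_isPowerful hp hLie hδ hm hP, X.exists_isQuaternionDecomposition hσ, ?_⟩
  · obtain ⟨n, hn⟩ := hδ
    refine ⟨n + 1, (SymmLie.augIdeal_pow_eq_bot_iff _ n).2 ?_⟩
    rw [pow_succ, hn, Submodule.bot_mul]
  · rw [h]
    exact X.nilClass_symmUnits_eq hp hLie hδ hm hP h
  · intro hPc E g D k hk
    obtain ⟨j, hq⟩ := SymmLie.exists_isEngelExponent (F := F) hp hLie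
    obtain ⟨n, rfl⟩ := Nat.exists_eq_add_of_le' hk
    rw [SymmLie.coe_lieSub, D.lieSub_symmSub_eq X hPc h2 (hq.isTwistedQuaternion Q)]
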